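/- There is an algorithm that takes as input two integral, symmetric, unimodular matrices $V$ and $V'$ (of arbitrary, possibly different, sizes, each given by the list of its rows) and outputs whether or not $V$ and $V'$ are congruent over $\mathbb{Z}$. Here a matrix is called integral if all its entries are integers; an integral matrix is called unimodular if it is square and has determinant $\pm 1$; and $V$ and $V'$ are congruent over $\mathbb{Z}$ if they have the same size and there is an integral unimodular matrix $P$ with $V = P^{T} V' P$. Explicitly: there is a single total computable (equivalently, Turing-computable) Boolean function of pairs of finite lists of finite lists of integers which, for every pair of integral, symmetric, unimodular matrices $V$, $V'$, given by their lists of rows, takes the value "true" if and only if $V$ and $V'$ are congruent over $\mathbb{Z}$. -/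

import Mathlib

/-- The list of rows of an integral `n × n` matrix (each row being the list of its entries):
the finite data by which matrices are handed to an algorithm. -/
def matrixRows {n : ℕ} (V : Matrix (Fin n) (Fin n) ℤ) : List (List ℤ) :=
  List.ofFn fun i => List.ofFn fun j => V i j

/-- An integral square matrix is unimodular if its determinant is `1` or `-1`. -/
def IsUnimodular {n : ℕ} (V : Matrix (Fin n) (Fin n) ℤ) : Prop :=
  V.det = 1 ∨ V.det = -1

/-- Congruence over `ℤ` of integral square matrices, whose sizes are not known to be equal
beforehand: the sizes agree, and `V = Pᵀ V' P` for some integral unimodular matrix `P`.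
The submatrix only transports `V'` along the equality of the sizes. -/
def IsCongruent {m n : ℕ} (V : Matrix (Fin m) (Fin m) ℤ) (V' : Matrix (Fin n) (Fin n) ℤ) :
    Prop :=
  ∃ (h : m = n) (P : Matrix (Fin m) (Fin m) ℤ),
    IsUnimodular P ∧ V = P.transpose * V'.submatrix (Fin.cast h) (Fin.cast h) * P

/-! Rank, signature and parity are invariants of congruence, and the signature can be read off from
a rational diagonalization. If a form is definite, vectors of bounded value lie in an explicit box
(`abs_apply_le_of_definite`), so a congruence is found or excluded by a finite search. If it is
indefinite and unimodular, the three invariants determine it (`isCongruent_of_indefinite`), and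
comparing them is enough.

The classification rests on the fact that an indefinite unimodular form represents zero
(`exists_isotropic`). It is proved inside the Witt group of `ℚ`, filtered by the subgroups
`smoothSub p` generated by integers whose prime factors are below `p`. On `smoothSub (p + 1)` the
residue at `p` is the projection modulo `smoothSub p`, so a class all of whose residues vanish
descends to a multiple of ⟨1⟩ (`exists_eq_zsmul_of_wittResidue_eq_zero`). The residues of a
unimodular form do vanish: for odd `p` there is an orthogonal family with values prime to `p`, and
at 2 the residue only sees the parity of the valuation of the determinant. So the class is the
signature times ⟨1⟩. For an indefinite form the signature is smaller than the rank in absolute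
value, and a dimension count in the isotropic subspace expressing this equality gives a zero.

Given a zero, an odd form splits off vectors of square ±1 until it is diagonal
(`exists_diagonal_basis`). In an even form a hyperbolic plane is replaced by ⟨1⟩ ⊥ ⟨-1⟩; the
resulting odd forms are isometric, and the isometry, corrected by a reflection if necessary, carries
the even forms to each other (`exists_map_of_oddForm`).

The diagonalization is found by unbounded search. To make the search halt on every input, a nonzero
vector in the radical also counts as a result (`exists_isReduction`). -/

open Module

/-! ### Neutral diagonal forms and their cancellation. -/

/-- The diagonal form with weights `w` is neutral if it has a totally isotropic subspace of at
least half the dimension. -/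
def Neutral {K ι : Type*} [Field K] [Fintype ι] (w : ι → K) : Prop :=
  ∃ L : Submodule K (ι → K), (∀ x ∈ L, ∀ y ∈ L, ∑ i, w i * x i * y i = 0) ∧
    Fintype.card ι ≤ 2 * finrank K L

section Neutral

variable {K ι κ : Type*} [Field K] [Fintype ι] [Fintype κ]

theorem diag_sum_single [DecidableEq ι] (w x : ι → K) (k : ι) :
    ∑ i, w i * x i * (Pi.single k (1 : K) : ι → K) i = w k * x k := by
  rw [Finset.sum_eq_single k]
  · simp
  · intro b _ hb; simp [Pi.single_eq_of_ne hb]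
  · simp

/-- As `w'` has no zero entry, a map preserving the forms is injective, hence bijective by equality
of dimensions, and the isotropic subspace can be pulled back. -/
theorem neutral_of_isometry {w : ι → K} {w' : κ → K} (T : (κ → K) →ₗ[K] (ι → K))
    (hT : ∀ x y, ∑ i, w i * T x i * T y i = ∑ k, w' k * x k * y k) (hw' : ∀ k, w' k ≠ 0)
    (hc : Fintype.card κ = Fintype.card ι) (h : Neutral w) : Neutral w' := by
  classical
  obtain ⟨L, hL, hd⟩ := h
  have hinj : Function.Injective T := by
    rw [← LinearMap.ker_eq_bot, LinearMap.ker_eq_bot']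
    intro x hx
    funext k
    have := hT x (Pi.single k 1)
    rw [diag_sum_single, hx] at this
    simpa [hw' k] using this.symm
  let e : (κ → K) ≃ₗ[K] (ι → K) := LinearEquiv.ofInjectiveOfFinrankEq T hinj (by simp [hc])
  refine ⟨L.comap T, fun x hx y hy => ?_, ?_⟩
  · rw [← hT]; exact hL _ hx _ hy
  · have : finrank K (L.comap T) = finrank K L := by
      have h2 : L.comap T = L.map (e.symm : (ι → K) →ₗ[K] (κ → K)) := by
        rw [Submodule.map_equiv_eq_comap_symm]; rfl
      rw [h2]; exact LinearEquiv.finrank_map_eq e.symm L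
    rw [hc, this]; exact hd

theorem neutral_comp_equiv {w : ι → K} (e : κ ≃ ι) (hw : ∀ i, w i ≠ 0) :
    Neutral (w ∘ e) ↔ Neutral w := by
  constructor
  · refine neutral_of_isometry (LinearMap.funLeft K K e) (fun x y => ?_) hw
      (Fintype.card_congr e.symm)
    simpa [LinearMap.funLeft] using Equiv.sum_comp e (fun i => w i * x i * y i)
  · refine neutral_of_isometry (LinearMap.funLeft K K e.symm) (fun x y => ?_)
      (fun k => hw _) (Fintype.card_congr e)
    simpa [LinearMap.funLeft] using
      (Equiv.sum_comp e (fun i => w i * x (e.symm i) * y (e.symm i))).symm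

theorem finrank_add_le_of_orthogonal {w : ι → K} (hw : ∀ i, w i ≠ 0) (R Z : Submodule K (ι → K))
    (h : ∀ x ∈ R, ∀ y ∈ Z, ∑ i, w i * x i * y i = 0) :
    finrank K R + finrank K Z ≤ Fintype.card ι := by
  classical
  let b : LinearMap.BilinForm K (ι → K) := Matrix.toBilin' (Matrix.diagonal w)
  have hb : b.Nondegenerate := by
    apply LinearMap.BilinForm.nondegenerate_toBilin'_of_det_ne_zero'
    rw [Matrix.det_diagonal]; exact Finset.prod_ne_zero_iff.2 fun i _ => hw i
  have hbv : ∀ x y, b x y = ∑ i, w i * x i * y i := by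
    intro x y
    simp only [b, Matrix.toBilin'_apply', dotProduct, Matrix.mulVec_diagonal]
    exact Finset.sum_congr rfl fun i _ => by ring
  have := LinearMap.BilinForm.finrank_orthogonal hb R
  have hle : Z ≤ b.orthogonal R := by
    intro y hy x hx
    change b x y = 0
    rw [hbv]; exact h x hx y hy
  have h2 := Submodule.finrank_mono hle
  have h3 := Submodule.finrank_le R
  rw [finrank_fintype_fun_eq_card] at *
  omega

theorem Neutral.sumElim {w : ι → K} {w' : κ → K} (h : Neutral w) (h' : Neutral w') :
    Neutral (Sum.elim w w') := by
  obtain ⟨L, hL, hd⟩ := h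
  obtain ⟨L', hL', hd'⟩ := h'
  let F : (L × L') →ₗ[K] (ι ⊕ κ → K) :=
    (LinearEquiv.sumArrowLequivProdArrow ι κ K K).symm.toLinearMap ∘ₗ
      (L.subtype.prodMap L'.subtype)
  have hF : Function.Injective F := by
    rintro ⟨a, b⟩ ⟨c, d⟩ h
    have := (LinearEquiv.sumArrowLequivProdArrow ι κ K K).symm.injective h
    simpa [Prod.ext_iff] using this
  refine ⟨LinearMap.range F, ?_, ?_⟩
  · rintro _ ⟨⟨a, b⟩, rfl⟩ _ ⟨⟨c, d⟩, rfl⟩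
    simp [F, Fintype.sum_sum_type, hL a a.2 c c.2, hL' b b.2 d d.2]
  · rw [LinearMap.finrank_range_of_inj hF, Module.finrank_prod, Fintype.card_sum]; omega

/-- The new isotropic subspace consists of the `ι`-parts of those vectors of `L` whose `κ`-part lies
in `L'`; it is the range of `g` on the kernel of `f`. The kernel of `g` embeds by `z` into `κ → K`,
with image orthogonal to the range of `f`, so these two dimensions add up to at most `card κ`.
Rank-nullity then gives at least `dim L + dim L' - card κ` for the range of `g`. Nothing depends on
the characteristic. -/
theorem Neutral.cancel {w : ι → K} {w' : κ → K} (hw' : ∀ k, w' k ≠ 0)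
    (h : Neutral (Sum.elim w w')) (h' : Neutral w') : Neutral w := by
  obtain ⟨L, hL, hd⟩ := h
  obtain ⟨L', hL', hd'⟩ := h'
  let pι : (ι ⊕ κ → K) →ₗ[K] (ι → K) := LinearMap.funLeft K K Sum.inl
  let pκ : (ι ⊕ κ → K) →ₗ[K] (κ → K) := LinearMap.funLeft K K Sum.inr
  let f : (L × L') →ₗ[K] (κ → K) :=
    (pκ ∘ₗ L.subtype) ∘ₗ LinearMap.fst K L L' - L'.subtype ∘ₗ LinearMap.snd K L L'
  let g : LinearMap.ker f →ₗ[K] (ι → K) :=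
    ((pι ∘ₗ L.subtype) ∘ₗ LinearMap.fst K L L') ∘ₗ (LinearMap.ker f).subtype
  let z : LinearMap.ker g →ₗ[K] (κ → K) :=
    (L'.subtype ∘ₗ LinearMap.snd K L L') ∘ₗ (LinearMap.ker f).subtype ∘ₗ
      (LinearMap.ker g).subtype
  have hz : Function.Injective z := by
    rintro ⟨⟨⟨l, k⟩, h1⟩, h2⟩ ⟨⟨⟨l', k'⟩, h1'⟩, h2'⟩ h3
    have h4 : (k : κ → K) = k' := h3
    have h5 : pκ l - (k : κ → K) = 0 := h1
    have h5' : pκ l' - (k' : κ → K) = 0 := h1'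
    have h6 : pι l = 0 := h2
    have h6' : pι l' = 0 := h2'
    have hk : k = k' := Subtype.ext h4
    have hl : l = l' := by
      apply Subtype.ext
      funext i
      rcases i with i | i
      · exact congrFun (h6.trans h6'.symm) i
      · rw [h4, ← h5', sub_eq_sub_iff_add_eq_add] at h5
        exact congrFun (add_right_cancel h5) i
    subst hk; subst hl; rfl
  have horth := finrank_add_le_of_orthogonal hw' (LinearMap.range f) (LinearMap.range z) (by
    rintro _ ⟨⟨l, k⟩, rfl⟩ _ ⟨⟨⟨⟨l2, k2⟩, h1⟩, h2⟩, rfl⟩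
    have h5 : pκ l2 - (k2 : κ → K) = 0 := h1
    have h6 : pι l2 = 0 := h2
    have e1 := hL l l.2 l2 l2.2
    have e2 := hL' k k.2 k2 k2.2
    rw [Fintype.sum_sum_type] at e1
    have h7 : ∀ i, (l2 : ι ⊕ κ → K) (Sum.inl i) = 0 := fun i => congrFun h6 i
    have h8 : ∀ i, (l2 : ι ⊕ κ → K) (Sum.inr i) = (k2 : κ → K) i := fun i =>
      congrFun (sub_eq_zero.1 h5) i
    simp only [h7, h8, mul_zero, Finset.sum_const_zero, zero_add, Sum.elim_inr] at e1
    change ∑ i, w' i * ((l : ι ⊕ κ → K) (Sum.inr i) - (k : κ → K) i) * (k2 : κ → K) i = 0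
    rw [← sub_eq_zero.2 (e1.trans e2.symm), ← Finset.sum_sub_distrib]
    exact Finset.sum_congr rfl fun i _ => by ring)
  rw [LinearMap.finrank_range_of_inj hz] at horth
  have r1 := LinearMap.finrank_range_add_finrank_ker f
  have r2 := LinearMap.finrank_range_add_finrank_ker (V := LinearMap.ker f) g
  rw [Module.finrank_prod] at r1
  rw [Fintype.card_sum] at hd
  refine ⟨LinearMap.range g, ?_, by omega⟩
  rintro _ ⟨⟨⟨l, k⟩, h1⟩, rfl⟩ _ ⟨⟨⟨l2, k2⟩, h2⟩, rfl⟩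
  have h3 : ∀ i, (l : ι ⊕ κ → K) (Sum.inr i) = (k : κ → K) i := fun i =>
      congrFun (sub_eq_zero.1 (show pκ l - (k : κ → K) = 0 from h1)) i
  have h4 : ∀ i, (l2 : ι ⊕ κ → K) (Sum.inr i) = (k2 : κ → K) i := fun i =>
      congrFun (sub_eq_zero.1 (show pκ l2 - (k2 : κ → K) = 0 from h2)) i
  have e1 := hL l l.2 l2 l2.2
  have e2 := hL' k k.2 k2 k2.2
  rw [Fintype.sum_sum_type] at e1
  simp only [h3, h4, Sum.elim_inr, e2, add_zero, Sum.elim_inl] at e1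
  exact e1

theorem neutral_self_neg (w : ι → K) : Neutral (Sum.elim w (fun i => -w i)) := by
  let F : (ι → K) →ₗ[K] (ι ⊕ ι → K) :=
    (LinearEquiv.sumArrowLequivProdArrow ι ι K K).symm.toLinearMap ∘ₗ
      (LinearMap.id.prod LinearMap.id)
  have hF : Function.Injective F := by
    intro a b h
    have := (LinearEquiv.sumArrowLequivProdArrow ι ι K K).symm.injective h
    exact (Prod.ext_iff.1 this).1
  refine ⟨LinearMap.range F, ?_, ?_⟩
  · rintro _ ⟨x, rfl⟩ _ ⟨y, rfl⟩
    simp [F, Fintype.sum_sum_type]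
  · rw [LinearMap.finrank_range_of_inj hF, Fintype.card_sum, finrank_fintype_fun_eq_card]; omega

theorem Neutral.neg {w : ι → K} (h : Neutral w) : Neutral (fun i => -w i) := by
  obtain ⟨L, hL, hd⟩ := h
  refine ⟨L, fun x hx y hy => ?_, hd⟩
  simp [hL x hx y hy]

end Neutral

/-! ### Witt functions and their vanishing on neutral forms. -/

/-- Functions on a field that satisfy the defining relations of the Witt group of diagonal
forms. -/
structure IsWittFun {K A : Type*} [Field K] [AddCommGroup A] (φ : K → A) : Prop where
  zero : φ 0 = 0
  mul_sq : ∀ a b, b ≠ 0 → φ (a * b ^ 2) = φ a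
  add : ∀ a b, φ a + φ b = φ (a + b) + φ (a * b * (a + b))

theorem IsWittFun.neg {K A : Type*} [Field K] [AddCommGroup A] {φ : K → A} (h : IsWittFun φ)
    (a : K) : φ (-a) = -φ a := by
  have := h.add a (-a)
  simp only [add_neg_cancel, mul_zero, h.zero, add_zero] at this
  exact (neg_eq_of_add_eq_zero_right this).symm

section Lift

variable {K ι κ : Type*} [Field K] [Fintype ι] [Fintype κ]

theorem neutral_of_sum_eq_zero [Nonempty ι] {w : ι → K} (hc : Fintype.card ι ≤ 2)
    (h : ∑ i, w i = 0) : Neutral w := by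
  refine ⟨K ∙ (fun _ => 1 : ι → K), ?_, ?_⟩
  · intro x hx y hy
    obtain ⟨a, rfl⟩ := Submodule.mem_span_singleton.1 hx
    obtain ⟨b, rfl⟩ := Submodule.mem_span_singleton.1 hy
    simp [← Finset.sum_mul, h]
  · rw [finrank_span_singleton]
    · omega
    · intro h0
      obtain ⟨i⟩ := ‹Nonempty ι›
      exact one_ne_zero (congrFun h0 i)

theorem sum_split_pair {A : Type*} [AddCommMonoid A] [DecidableEq ι] (f : ι → A) {i j : ι}
    (hij : i ≠ j) : ∑ k, f k = f i + f j + ∑ k ∈ ({i, j} : Finset ι)ᶜ, f k := by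
  rw [← Finset.sum_add_sum_compl {i, j}, Finset.sum_pair hij]

/-- In the basis (1, 1), (b, -a) the form ⟨a, b⟩ becomes ⟨a + b, ab(a + b)⟩. -/
theorem neutral_merge [DecidableEq ι] {w : ι → K} (hw : ∀ k, w k ≠ 0) {i j : ι} (hij : i ≠ j)
    (hs : w i + w j ≠ 0) (h : Neutral w) :
    Neutral (fun k => if k = i then w i + w j else
      if k = j then w i * w j * (w i + w j) else w k) := by
  let T : (ι → K) →ₗ[K] (ι → K) :=
    { toFun := fun y k => if k = i then y i + w j * y j else
        if k = j then y i - w i * y j else y k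
      map_add' := by
        intro x y; funext k; simp only [Pi.add_apply]; split_ifs <;> ring
      map_smul' := by
        intro c y; funext k
        simp only [Pi.smul_apply, smul_eq_mul, RingHom.id_apply]; split_ifs <;> ring }
  refine neutral_of_isometry T (fun x y => ?_) (fun k => ?_) rfl h
  · rw [sum_split_pair _ hij, sum_split_pair (ι := ι) _ hij]
    congr 1
    · simp only [T, LinearMap.coe_mk, AddHom.coe_mk, if_true, if_neg hij.symm]; ring
    · refine Finset.sum_congr rfl fun k hk => ?_
      simp only [Finset.mem_compl, Finset.mem_insert, Finset.mem_singleton, not_or] at hk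
      simp [T, hk.1, hk.2]
  · split_ifs
    · exact hs
    · exact mul_ne_zero (mul_ne_zero (hw _) (hw _)) hs
    · exact hw k

theorem neutral_scale {w x : ι → K} (hw : ∀ k, w k ≠ 0) (hx : ∀ k, x k ≠ 0) (h : Neutral w) :
    Neutral (fun k => w k * x k ^ 2) := by
  let T : (ι → K) →ₗ[K] (ι → K) := LinearMap.pi fun k => x k • LinearMap.proj k
  refine neutral_of_isometry T (fun y z => ?_)
    (fun k => mul_ne_zero (hw k) (pow_ne_zero _ (hx k))) rfl h
  refine Finset.sum_congr rfl fun k _ => ?_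
  simp only [T, LinearMap.pi_apply, LinearMap.smul_apply, LinearMap.proj_apply, smul_eq_mul]
  ring

theorem neutral_remove_pair [DecidableEq ι] {w : ι → K} (hw : ∀ k, w k ≠ 0) {i j : ι}
    (hij : i ≠ j) (hs : w i + w j = 0) (h : Neutral w) :
    Neutral (fun k : {k // k ∉ ({i, j} : Finset ι)} => w k) := by
  let e := (Equiv.sumComm _ _).trans (Equiv.sumCompl fun k : ι => k ∈ ({i, j} : Finset ι))
  have h1 := (neutral_comp_equiv e hw).2 h
  have h2 : w ∘ e = Sum.elim (fun k : {k // k ∉ ({i, j} : Finset ι)} => w k)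
      (fun k : {k // k ∈ ({i, j} : Finset ι)} => w k) := by
    funext k; rcases k with k | k <;> rfl
  rw [h2] at h1
  have : Nonempty {k // k ∈ ({i, j} : Finset ι)} := ⟨⟨i, by simp⟩⟩
  refine h1.cancel (fun k => hw _) (neutral_of_sum_eq_zero ?_ ?_)
  · rw [Fintype.card_coe, Finset.card_pair hij]
  · rw [Finset.sum_coe_sort {i, j} w, Finset.sum_pair hij, hs]

/-- This replaces a presentation of the Witt group by generators and relations. After rescaling, an
isotropic vector is the indicator of a set `S` of coordinates, so the weights over `S` sum to zero.
Merging two entries of `S` puts their sum at `i` and takes `j` out of `S`, without changing the sum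
of `φ`. When two entries are opposite, they contribute nothing and are cancelled, which lowers the
dimension. Hence an induction on the dimension with an inner one on the size of `S`. -/
theorem IsWittFun.sum_eq_zero {A : Type*} [AddCommGroup A] {φ : K → A} (hφ : IsWittFun φ) :
    ∀ (n : ℕ) {ι : Type} [Fintype ι] (_ : Fintype.card ι = n) {w : ι → K} (_ : ∀ k, w k ≠ 0)
      (_ : Neutral w), ∑ k, φ (w k) = 0 := by
  intro n
  induction n using Nat.strong_induction_on with
  | _ n ih =>
  intro ι _ hn w hw h
  classical
  have key : ∀ (m : ℕ) (S : Finset ι), S.card = m → S.Nonempty → ∀ w : ι → K, (∀ k, w k ≠ 0) →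
      ∑ k ∈ S, w k = 0 → Neutral w → ∑ k, φ (w k) = 0 := by
    intro m
    induction m with
    | zero =>
      intro S hS hne
      exact absurd (Finset.card_eq_zero.1 hS) hne.ne_empty
    | succ m ihm =>
      intro S hS hne w hw h0 h
      obtain ⟨i, hi⟩ := hne
      have hj : ∃ j ∈ S, j ≠ i := by
        by_contra hcon
        push Not at hcon
        have : S = {i} := Finset.eq_singleton_iff_unique_mem.2 ⟨hi, hcon⟩
        rw [this, Finset.sum_singleton] at h0
        exact hw i h0
      obtain ⟨j, hj, hji⟩ := hj
      have hij : i ≠ j := hji.symm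
      by_cases hs : w i + w j = 0
      · have h1 := neutral_remove_pair hw hij hs h
        have h2 := ih _ (by
          rw [← hn]
          exact Fintype.card_subtype_lt (x := i) (by simp)) rfl (fun k => hw _) h1
        rw [sum_split_pair _ hij, eq_neg_of_add_eq_zero_left hs, hφ.neg, neg_add_cancel, zero_add,
          ← h2]
        exact Finset.sum_subtype _ (fun k => by simp) _
      · have h1 := neutral_merge hw hij hs h
        have h2 := ihm (S.erase j) (by rw [Finset.card_erase_of_mem hj, hS]; rfl)
          ⟨i, Finset.mem_erase.2 ⟨hij, hi⟩⟩ _ (fun k => ?_) ?_ h1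
        · rw [sum_split_pair _ hij] at h2 ⊢
          simp only [if_true, if_neg hij.symm] at h2
          rw [hφ.add, ← h2]
          congr 1
          refine Finset.sum_congr rfl fun k hk => ?_
          simp only [Finset.mem_compl, Finset.mem_insert, Finset.mem_singleton, not_or] at hk
          simp [hk.1, hk.2]
        · split_ifs
          · exact hs
          · exact mul_ne_zero (mul_ne_zero (hw _) (hw _)) hs
          · exact hw k
        · have hi' : i ∈ S.erase j := Finset.mem_erase.2 ⟨hij, hi⟩
          rw [← Finset.add_sum_erase _ _ hi']
          rw [← Finset.add_sum_erase _ _ hj, ← Finset.add_sum_erase _ _ hi'] at h0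
          rw [if_pos rfl, ← h0, ← add_assoc, add_comm (w i)]
          congr 1
          refine Finset.sum_congr rfl fun k hk => ?_
          simp only [Finset.mem_erase] at hk
          simp [hk.1, hk.2.1]
  rcases isEmpty_or_nonempty ι with he | hne
  · simp
  obtain ⟨L, hL, hd⟩ := h
  have hpos : 0 < finrank K L := by
    have : 0 < Fintype.card ι := Fintype.card_pos
    omega
  have := Module.nontrivial_of_finrank_pos hpos
  obtain ⟨x, hx⟩ := exists_ne (0 : L)
  have hx' : (x : ι → K) ≠ 0 := fun h => hx (Subtype.ext h)
  -- The scaling factor is the coordinate of the isotropic vector, with 1 in place of 0 to keep the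
  -- scaling invertible.
  let c : ι → K := fun k => if (x : ι → K) k = 0 then 1 else (x : ι → K) k
  have hc : ∀ k, c k ≠ 0 := by
    intro k; dsimp only [c]; split_ifs with hk
    · exact one_ne_zero
    · exact hk
  let S : Finset ι := Finset.univ.filter fun k => (x : ι → K) k ≠ 0
  have := key _ S rfl ?_ (fun k => w k * c k ^ 2)
    (fun k => mul_ne_zero (hw k) (pow_ne_zero _ (hc k))) ?_ (neutral_scale hw hc ⟨L, hL, hd⟩)
  · simpa only [hφ.mul_sq _ _ (hc _)] using this
  · by_contra hS
    rw [Finset.not_nonempty_iff_eq_empty, Finset.filter_eq_empty_iff] at hS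
    exact hx' (funext fun k => by simpa using hS (Finset.mem_univ k))
  · rw [← hL x x.2 x x.2, Finset.sum_filter]
    refine Finset.sum_congr rfl fun k _ => ?_
    by_cases hk : (x : ι → K) k = 0
    · simp [hk]
    · simp only [c, hk, ne_eq, not_false_eq_true, if_true, if_false]
      ring

end Lift

/-! ### The Witt group of a field and its universal property. -/

section WittGroup

variable {K : Type} [Field K]

theorem exists_equiv_of_map_univ_eq {α ι κ : Type*} [Fintype ι] [Fintype κ] {f : ι → α}
    {g : κ → α} (h : Finset.univ.val.map f = Finset.univ.val.map g) :
    ∃ e : ι ≃ κ, f = g ∘ e := by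
  classical
  have hcard : ∀ a, Nonempty ({i // f i = a} ≃ {k // g k = a}) := by
    intro a
    have := congrArg (Multiset.count a) h
    rw [Multiset.count_map, Multiset.count_map] at this
    refine ⟨Fintype.equivOfCardEq ?_⟩
    rw [Fintype.card_subtype, Fintype.card_subtype, Finset.card_def, Finset.card_def,
      Finset.filter_val, Finset.filter_val]
    simpa only [eq_comm] using this
  have E := fun a => (hcard a).some
  refine ⟨(Equiv.sigmaFiberEquiv f).symm.trans
    ((Equiv.sigmaCongrRight E).trans (Equiv.sigmaFiberEquiv g)), ?_⟩
  funext i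
  exact ((E (f i)) ⟨i, rfl⟩).2.symm

/-- A multiset of diagonal entries is neutral if the corresponding diagonal form is. -/
def NeutralM (A : Multiset Kˣ) : Prop :=
  ∃ (n : ℕ) (w : Fin n → Kˣ), A = Finset.univ.val.map w ∧ Neutral (fun i => (w i : K))

theorem neutralM_map {ι : Type*} [Fintype ι] (w : ι → Kˣ) :
    NeutralM (Finset.univ.val.map w) ↔ Neutral (fun i => (w i : K)) := by
  constructor
  · rintro ⟨n, w', h, hn⟩
    obtain ⟨e, rfl⟩ := exists_equiv_of_map_univ_eq h
    exact (neutral_comp_equiv (w := fun i => (w' i : K)) e fun i => (w' i).ne_zero).2 hn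
  · intro h
    let e := (Fintype.equivFin ι).symm
    refine ⟨Fintype.card ι, w ∘ e, ?_,
      (neutral_comp_equiv (w := fun i => (w i : K)) e fun i => (w i).ne_zero).2 h⟩
    rw [← Multiset.map_map, Multiset.map_univ_val_equiv]

theorem exists_eq_map_univ {α : Type*} (A : Multiset α) :
    ∃ (n : ℕ) (w : Fin n → α), A = Finset.univ.val.map w := by
  obtain ⟨l, rfl⟩ := Quotient.exists_rep A
  exact ⟨l.length, l.get, by simp⟩

theorem map_univ_sumElim {α ι κ : Type*} [Fintype ι] [Fintype κ] (f : ι → α) (g : κ → α) :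
    (Finset.univ.val.map f + Finset.univ.val.map g : Multiset α) =
      Finset.univ.val.map (Sum.elim f g) := by
  rw [← Finset.univ_disjSum_univ]
  simp [Finset.disjSum, Multiset.disjSum, Multiset.map_map, Function.comp_def]

theorem coe_sumElim {ι κ : Type*} (w : ι → Kˣ) (w' : κ → Kˣ) :
    (fun i => ((Sum.elim w w' i : Kˣ) : K)) =
      Sum.elim (fun i => (w i : K)) (fun i => (w' i : K)) := by
  funext i; rcases i with i | i <;> rfl

theorem neutralM_map_add_map {ι κ : Type*} [Fintype ι] [Fintype κ] (w : ι → Kˣ) (w' : κ → Kˣ) :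
    NeutralM (Finset.univ.val.map w + Finset.univ.val.map w') ↔
      Neutral (Sum.elim (fun i => (w i : K)) (fun i => (w' i : K))) := by
  rw [map_univ_sumElim, neutralM_map, coe_sumElim]

theorem NeutralM.add {A B : Multiset Kˣ} (hA : NeutralM A) (hB : NeutralM B) :
    NeutralM (A + B) := by
  obtain ⟨n, w, rfl, h⟩ := hA
  obtain ⟨m, w', rfl, h'⟩ := hB
  exact (neutralM_map_add_map w w').2 (h.sumElim h')

theorem NeutralM.cancel {A B : Multiset Kˣ} (h : NeutralM (A + B)) (hB : NeutralM B) :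
    NeutralM A := by
  obtain ⟨m, w', rfl, h'⟩ := hB
  obtain ⟨n, w, rfl⟩ := exists_eq_map_univ A
  exact (neutralM_map w).2 (((neutralM_map_add_map w w').1 h).cancel (fun k => (w' k).ne_zero) h')

theorem NeutralM.neg {A : Multiset Kˣ} (h : NeutralM A) : NeutralM (A.map (-·)) := by
  obtain ⟨n, w, rfl, h⟩ := h
  rw [Multiset.map_map, neutralM_map]
  simpa using h.neg

theorem neutralM_add_neg (A : Multiset Kˣ) : NeutralM (A + A.map (-·)) := by
  obtain ⟨n, w, rfl⟩ := exists_eq_map_univ A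
  rw [Multiset.map_map, neutralM_map_add_map]
  simpa using neutral_self_neg (fun i => (w i : K))

theorem map_neg_map_neg (A : Multiset Kˣ) : (A.map (-·)).map (-·) = A := by
  rw [Multiset.map_map]; simp

variable (K) in
/-- Two multisets of diagonal entries are Witt equivalent if the difference of the forms is
neutral. -/
def wittCon : AddCon (Multiset Kˣ) where
  r A B := NeutralM (A + B.map (-·))
  iseqv :=
    { refl := neutralM_add_neg
      symm := fun {A B} h => by
        have := h.neg
        rwa [Multiset.map_add, map_neg_map_neg, add_comm] at this
      trans := fun {A B C} h h' => by
        have h1 := h.add h'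
        have h2 : A + B.map (-·) + (B + C.map (-·)) =
            (A + C.map (-·)) + (B + B.map (-·)) := by abel
        rw [h2] at h1
        exact h1.cancel (neutralM_add_neg B) }
  add' := fun {A B C D} h h' => by
    have h1 := h.add h'
    have h2 : A + B.map (-·) + (C + D.map (-·)) = (A + C) + (B + D).map (-·) := by
      rw [Multiset.map_add]; abel
    rwa [h2] at h1

variable (K) in
/-- The Witt group of diagonal forms over a field. -/
def WittGroup : Type := (wittCon K).Quotient

instance : AddCommMonoid (WittGroup K) := inferInstanceAs (AddCommMonoid (wittCon K).Quotient)

/-- The class of a multiset of diagonal entries in the Witt group. -/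
def WittGroup.mk : Multiset Kˣ →+ WittGroup K := (wittCon K).mk'

theorem WittGroup.mk_eq_mk {A B : Multiset Kˣ} :
    WittGroup.mk A = WittGroup.mk B ↔ NeutralM (A + B.map (-·)) :=
  (wittCon K).eq

theorem WittGroup.mk_surjective : Function.Surjective (WittGroup.mk (K := K)) :=
  AddCon.mk'_surjective

/-- Negation in the Witt group. -/
def WittGroup.negHom : WittGroup K →+ WittGroup K :=
  AddCon.lift (wittCon K) (WittGroup.mk.comp (Multiset.mapAddMonoidHom (-·))) (by
    intro A B h
    rw [AddCon.ker_rel]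
    refine WittGroup.mk_eq_mk.2 ?_
    have := NeutralM.neg h
    rwa [Multiset.map_add] at this)

instance : Neg (WittGroup K) := ⟨WittGroup.negHom⟩

instance : AddCommGroup (WittGroup K) :=
  { (inferInstance : AddCommMonoid (WittGroup K)), (inferInstance : Neg (WittGroup K)) with
    zsmul := zsmulRec
    neg_add_cancel := by
      intro a
      obtain ⟨A, rfl⟩ := WittGroup.mk_surjective a
      change WittGroup.mk (A.map (-·)) + WittGroup.mk A = 0
      rw [← map_add, ← map_zero WittGroup.mk, WittGroup.mk_eq_mk]
      simpa [add_comm] using neutralM_add_neg A }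

open Classical in
/-- The class of a rank one form in the Witt group; the class of `0` is `0`. -/
noncomputable def WittGroup.cls (a : K) : WittGroup K :=
  if h : a = 0 then 0 else WittGroup.mk {Units.mk0 a h}

theorem WittGroup.sum_cls_units {ι : Type*} [Fintype ι] (w : ι → Kˣ) :
    ∑ i, WittGroup.cls (w i : K) = WittGroup.mk (Finset.univ.val.map w) := by
  have h : ∀ i, WittGroup.cls (w i : K) = WittGroup.mk {w i} := by
    intro i
    rw [WittGroup.cls, dif_neg (w i).ne_zero]
    congr 2
    ext; rfl
  simp_rw [h]
  rw [← map_sum]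
  congr 1
  have h1 := Multiset.map_map (fun a => ({a} : Multiset Kˣ)) w Finset.univ.val
  simp only [Function.comp_def] at h1
  rw [Finset.sum, ← h1, Multiset.sum_map_singleton]

theorem WittGroup.sum_cls_eq_iff {ι κ : Type*} [Fintype ι] [Fintype κ] {w : ι → K} {w' : κ → K}
    (hw : ∀ i, w i ≠ 0) (hw' : ∀ i, w' i ≠ 0) :
    ∑ i, WittGroup.cls (w i) = ∑ i, WittGroup.cls (w' i) ↔
      Neutral (Sum.elim w (fun i => -w' i)) := by
  have h1 := WittGroup.sum_cls_units (fun i => Units.mk0 (w i) (hw i))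
  have h2 := WittGroup.sum_cls_units (fun i => Units.mk0 (w' i) (hw' i))
  simp only [Units.val_mk0] at h1 h2
  rw [h1, h2, WittGroup.mk_eq_mk, Multiset.map_map, neutralM_map_add_map]
  simp

/-- The pairs with equal images under `P` and `P'` form the isotropic subspace. Its dimension is at
least `card ι + card κ - card σ`, which is at least half of the total; no injectivity is needed. -/
theorem neutral_of_maps_agree {ι κ σ : Type*} [Fintype ι] [Fintype κ] [Fintype σ] {w : ι → K}
    {w' : κ → K} (P : (ι → K) →ₗ[K] (σ → K)) (P' : (κ → K) →ₗ[K] (σ → K))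
    (G : LinearMap.BilinForm K (σ → K)) (h : ∀ x y, G (P x) (P y) = ∑ i, w i * x i * y i)
    (h' : ∀ x y, G (P' x) (P' y) = ∑ i, w' i * x i * y i)
    (hc : Fintype.card σ ≤ Fintype.card ι) (hc' : Fintype.card σ ≤ Fintype.card κ) :
    Neutral (Sum.elim w (fun i => -w' i)) := by
  let F : (ι ⊕ κ → K) →ₗ[K] (σ → K) :=
    P ∘ₗ LinearMap.funLeft K K Sum.inl - P' ∘ₗ LinearMap.funLeft K K Sum.inr
  refine ⟨LinearMap.ker F, ?_, ?_⟩
  · intro x hx y hy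
    have hx' : P (fun i => x (Sum.inl i)) = P' (fun i => x (Sum.inr i)) := sub_eq_zero.1 hx
    have hy' : P (fun i => y (Sum.inl i)) = P' (fun i => y (Sum.inr i)) := sub_eq_zero.1 hy
    have e1 := h (fun i => x (Sum.inl i)) (fun i => y (Sum.inl i))
    rw [hx', hy', h'] at e1
    rw [Fintype.sum_sum_type]
    simp only [Sum.elim_inl, Sum.elim_inr, neg_mul, Finset.sum_neg_distrib]
    rw [← e1, add_neg_cancel]
  · have h1 := LinearMap.finrank_range_add_finrank_ker F
    have h2 := Submodule.finrank_le (LinearMap.range F)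
    simp only [finrank_fintype_fun_eq_card, Fintype.card_sum] at h1 h2 ⊢
    omega

theorem WittGroup.isWittFun_cls : IsWittFun (WittGroup.cls (K := K)) := by
  have h0 : WittGroup.cls (0 : K) = 0 := dif_pos rfl
  have hneg : ∀ a : K, a ≠ 0 → WittGroup.cls a + WittGroup.cls (-a) = 0 := by
    intro a ha
    have := (WittGroup.sum_cls_eq_iff (ι := Fin 2) (κ := Fin 0) (w := ![a, -a])
      (w' := ![]) ?_ (fun i => i.elim0)).2 ?_
    · simpa using this
    · intro i; fin_cases i <;> simp [ha]
    · refine Neutral.sumElim (neutral_of_sum_eq_zero (by simp) (by simp)) ⟨⊤, ?_, by simp⟩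
      simp
  refine ⟨h0, fun a b hb => ?_, fun a b => ?_⟩
  · by_cases ha : a = 0
    · simp [ha]
    have := (WittGroup.sum_cls_eq_iff (ι := Fin 1) (κ := Fin 1) (w := ![a * b ^ 2])
      (w' := ![a]) ?_ ?_).2 ?_
    · simpa using this
    · intro i; simp [ha, hb]
    · intro i; simp [ha]
    · refine neutral_of_maps_agree (b • LinearMap.id) LinearMap.id
        (Matrix.toBilin' (Matrix.diagonal ![a])) ?_ ?_ le_rfl le_rfl
      · intro x y; simp [Matrix.toBilin'_apply]; ring
      · intro x y; simp [Matrix.toBilin'_apply]; left; ring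
  · by_cases ha : a = 0
    · simp [ha, h0]
    by_cases hb : b = 0
    · simp [hb, h0]
    by_cases hab : a + b = 0
    · rw [hab, mul_zero, h0, eq_neg_of_add_eq_zero_right hab, hneg a ha, add_zero]
    have := (WittGroup.sum_cls_eq_iff (ι := Fin 2) (κ := Fin 2) (w := ![a, b])
      (w' := ![a + b, a * b * (a + b)]) ?_ ?_).2 ?_
    · simpa using this
    · intro i; fin_cases i <;> simp [ha, hb]
    · intro i; fin_cases i <;> simp [ha, hb, hab]
    -- The columns (1, 1) and (b, -a) are those of the basis change in `neutral_merge`.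
    · refine neutral_of_maps_agree LinearMap.id (Matrix.toLin' !![1, b; 1, -a])
        (Matrix.toBilin' (Matrix.diagonal ![a, b])) ?_ ?_ le_rfl le_rfl
      · intro x y; simp [Matrix.toBilin'_apply]; ring
      · intro x y; simp [Matrix.toBilin'_apply, dotProduct]; ring

theorem IsWittFun.sum_eq_sum {A : Type*} [AddCommGroup A] {φ : K → A} (hφ : IsWittFun φ)
    {ι κ : Type} [Fintype ι] [Fintype κ] {w : ι → K} {w' : κ → K}
    (hw : ∀ i, w i ≠ 0) (hw' : ∀ i, w' i ≠ 0) (h : Neutral (Sum.elim w (fun i => -w' i))) :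
    ∑ i, φ (w i) = ∑ i, φ (w' i) := by
  have := hφ.sum_eq_zero _ rfl (fun k => ?_) h
  · rw [Fintype.sum_sum_type] at this
    simp only [Sum.elim_inl, Sum.elim_inr, hφ.neg, Finset.sum_neg_distrib] at this
    exact add_neg_eq_zero.1 this
  · rcases k with k | k
    · exact hw k
    · exact neg_ne_zero.2 (hw' k)

/-- A Witt function extends to the Witt group. -/
def WittGroup.lift {A : Type*} [AddCommGroup A] {φ : K → A} (hφ : IsWittFun φ) :
    WittGroup K →+ A :=
  AddCon.lift (wittCon K)
    (Multiset.sumAddMonoidHom.comp (Multiset.mapAddMonoidHom fun u : Kˣ => φ u)) (by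
      intro B C h
      obtain ⟨n, w, rfl⟩ := exists_eq_map_univ B
      obtain ⟨m, w', rfl⟩ := exists_eq_map_univ C
      have h1 : NeutralM (Finset.univ.val.map w + (Finset.univ.val.map w').map (-·)) := h
      rw [Multiset.map_map, neutralM_map_add_map] at h1
      rw [AddCon.ker_rel]
      have := hφ.sum_eq_sum (fun i => (w i).ne_zero) (fun i => (w' i).ne_zero) (by simpa using h1)
      simpa [Multiset.map_map, Finset.sum, Function.comp_def] using this)

theorem WittGroup.lift_cls {A : Type*} [AddCommGroup A] {φ : K → A} (hφ : IsWittFun φ) (a : K) :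
    WittGroup.lift hφ (WittGroup.cls a) = φ a := by
  unfold WittGroup.cls
  split_ifs with h
  · rw [map_zero, h, hφ.zero]
  · change ((({Units.mk0 a h} : Multiset Kˣ).map fun u : Kˣ => φ u)).sum = φ a
    simp

end WittGroup

/-! ### The filtration of the Witt group of `ℚ` by smooth integers. -/

/-- A nonzero integer all of whose prime factors are less than `p`. -/
def IsSmooth (p : ℕ) (v : ℤ) : Prop :=
  v ≠ 0 ∧ ∀ q : ℕ, q.Prime → (q : ℤ) ∣ v → q < p

section Smooth

variable {p : ℕ}

theorem IsSmooth.mul {v w : ℤ} (hv : IsSmooth p v) (hw : IsSmooth p w) : IsSmooth p (v * w) := by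
  refine ⟨mul_ne_zero hv.1 hw.1, fun q hq h => ?_⟩
  rcases (Nat.prime_iff_prime_int.1 hq).dvd_or_dvd h with h | h
  · exact hv.2 q hq h
  · exact hw.2 q hq h

theorem isSmooth_of_abs_lt {v : ℤ} (h0 : v ≠ 0) (h : |v| < p) : IsSmooth p v := by
  refine ⟨h0, fun q _ hd => ?_⟩
  have := Int.le_of_dvd (abs_pos.2 h0) ((dvd_abs _ _).2 hd)
  omega

theorem IsSmooth.of_dvd {v w : ℤ} (hw : IsSmooth p w) (h : v ∣ w) : IsSmooth p v :=
  ⟨fun h0 => hw.1 (by rw [h0] at h; exact zero_dvd_iff.1 h), fun q hq hd => hw.2 q hq (hd.trans h)⟩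

theorem IsSmooth.mono {q : ℕ} (h : p ≤ q) {v : ℤ} (hv : IsSmooth p v) : IsSmooth q v :=
  ⟨hv.1, fun r hr hd => (hv.2 r hr hd).trans_le h⟩

theorem IsSmooth.not_dvd [hp : Fact p.Prime] {v : ℤ} (hv : IsSmooth p v) : ¬ (p : ℤ) ∣ v :=
  fun h => lt_irrefl _ (hv.2 p hp.out h)

open WittGroup

variable (p) in
/-- The subgroup of the Witt group of `ℚ` generated by the classes of integers all of whose prime
factors are less than `p`. -/
def smoothSub : AddSubgroup (WittGroup ℚ) :=
  AddSubgroup.closure {x | ∃ v : ℤ, IsSmooth p v ∧ x = cls (v : ℚ)}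

theorem cls_mem_smoothSub {v : ℤ} (hv : IsSmooth p v) : cls (v : ℚ) ∈ smoothSub p :=
  AddSubgroup.subset_closure ⟨v, hv, rfl⟩

theorem smoothSub_mono {q : ℕ} (h : p ≤ q) : smoothSub p ≤ smoothSub q :=
  AddSubgroup.closure_mono fun _ ⟨v, hv, hx⟩ => ⟨v, hv.mono h, hx⟩

variable (p) in
/-- The class of a rational number in the quotient of the Witt group of `ℚ` by `smoothSub p`. -/
noncomputable def smoothCls (a : ℚ) : WittGroup ℚ ⧸ smoothSub p :=
  QuotientAddGroup.mk' (smoothSub p) (cls a)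

theorem isWittFun_smoothCls : IsWittFun (smoothCls p) where
  zero := by rw [smoothCls, isWittFun_cls.zero, map_zero]
  mul_sq a b hb := by rw [smoothCls, isWittFun_cls.mul_sq a b hb]; rfl
  add a b := by
    simp only [smoothCls]
    rw [← map_add, isWittFun_cls.add, map_add]

theorem smoothCls_eq_zero {v : ℤ} (hv : IsSmooth p v) : smoothCls p (v : ℚ) = 0 := by
  rw [smoothCls, QuotientAddGroup.mk'_apply, QuotientAddGroup.eq_zero_iff]
  exact cls_mem_smoothSub hv

/-- Apply the Witt relation to `p r c` and `p² c l`. The second term is smooth up to squares, and so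
is the product term, which equals `r l c (r + p l)` times a square; only the terms with a single
factor `p` survive. -/
theorem smoothCls_shift (hp : p ≠ 0) {c r l : ℤ} (hc : IsSmooth p c) (hr : IsSmooth p r)
    (hl : l = 0 ∨ IsSmooth p l) (hrl : IsSmooth p (r + p * l)) :
    smoothCls p (p * (r + p * l : ℤ) * c) = smoothCls p (p * r * c) := by
  rcases hl with rfl | hl
  · simp
  have hpq : (p : ℚ) ≠ 0 := Nat.cast_ne_zero.2 hp
  have hcq : (c : ℚ) ≠ 0 := Int.cast_ne_zero.2 hc.1
  have h := (isWittFun_smoothCls (p := p)).add (p * r * c) ((c * l : ℤ) * p ^ 2)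
  rw [isWittFun_smoothCls.mul_sq _ _ hpq, smoothCls_eq_zero (hc.mul hl), add_zero] at h
  have e1 : (p * r * c + (c * l : ℤ) * p ^ 2 : ℚ) = p * (r + p * l : ℤ) * c := by
    push_cast; ring
  have e2 : (p * r * c * ((c * l : ℤ) * p ^ 2) * (p * (r + p * l : ℤ) * c) : ℚ) =
      (r * l * c * (r + p * l) : ℤ) * (p ^ 2 * c) ^ 2 := by
    push_cast; ring
  rw [e1, e2, isWittFun_smoothCls.mul_sq _ _ (mul_ne_zero (pow_ne_zero _ hpq) hcq),
    smoothCls_eq_zero (((hr.mul hl).mul hc).mul hrl), add_zero] at h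
  exact h.symm

variable [hp : Fact p.Prime]

/-- Induction on the absolute value of `v`. A prime factor `q` of `v` is moved into the spare smooth
factor `c`, the cofactor is reduced modulo `p`, and `q` is moved back. For `|v| < p` at most one
shift by `p` is needed. -/
theorem smoothCls_mul_eq_val (n : ℕ) : ∀ (v c : ℤ), v.natAbs = n → IsSmooth p v → IsSmooth p c →
    smoothCls p (p * v * c) = smoothCls p (p * ((v : ZMod p).val : ℤ) * c) := by
  have hp0 : p ≠ 0 := hp.out.ne_zero
  have hp2 := hp.out.two_le
  induction n using Nat.strong_induction_on with
  | _ n ih =>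
  intro v c hn hv hc
  rcases lt_or_ge n p with hlt | hge
  · rcases lt_or_gt_of_ne hv.1 with hneg | hpos
    · have h1 : ((v : ZMod p).val : ℤ) = v + p * 1 := by
        rw [ZMod.val_intCast, ← Int.add_emod_right, Int.emod_eq_of_lt] <;> omega
      rw [h1, smoothCls_shift hp0 hc hv]
      · exact Or.inr (isSmooth_of_abs_lt one_ne_zero (by simp; omega))
      · exact isSmooth_of_abs_lt (by omega) (by rw [abs_of_nonneg] <;> omega)
    · have h1 : ((v : ZMod p).val : ℤ) = v := by
        rw [ZMod.val_intCast, Int.emod_eq_of_lt] <;> omega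
      rw [h1]
  · obtain ⟨q, hq, hqn⟩ := Nat.exists_prime_and_dvd (n := n) (by omega)
    have hqv : (q : ℤ) ∣ v := Int.natCast_dvd.2 (hn ▸ hqn)
    have hqs : IsSmooth p q := hv.of_dvd hqv
    have hqp : q < p := hv.2 q hq hqv
    obtain ⟨v', rfl⟩ := hqv
    have hv's : IsSmooth p v' := hv.of_dvd (dvd_mul_left _ _)
    have h1 := ih v'.natAbs (by
      rw [← hn, Int.natAbs_mul, Int.natAbs_natCast]
      have := Int.natAbs_pos.2 hv's.1
      nlinarith [hq.two_le]) v' (q * c) rfl hv's (hqs.mul hc)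
    set r' := (v' : ZMod p).val with hr'
    have hr'lt : r' < p := ZMod.val_lt _
    have hr'0 : r' ≠ 0 := by
      intro h0
      rw [hr', ZMod.val_eq_zero, ZMod.intCast_zmod_eq_zero_iff_dvd] at h0
      exact hv's.not_dvd h0
    have hval : (((q * v' : ℤ)) : ZMod p).val = (r' * q) % p := by
      have : (((q * v' : ℤ)) : ZMod p) = ((r' * q : ℕ) : ZMod p) := by
        push_cast
        rw [hr', ZMod.natCast_zmod_val, mul_comm]
      rw [this, ZMod.val_natCast]
    have hdm := Nat.mod_add_div (r' * q) p
    have hr's : IsSmooth p (r' : ℤ) :=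
      isSmooth_of_abs_lt (by exact_mod_cast hr'0) (by simpa using hr'lt)
    have hprod : ((r' * q : ℕ) : ℤ) = ((r' * q % p : ℕ) : ℤ) + p * ((r' * q / p : ℕ) : ℤ) := by
      exact_mod_cast hdm.symm
    have hrs : IsSmooth p ((r' * q % p : ℕ) : ℤ) := by
      refine isSmooth_of_abs_lt ?_ ?_
      · intro h0
        have : p ∣ r' * q := Nat.dvd_of_mod_eq_zero (by exact_mod_cast h0)
        exact (hr's.mul hqs).not_dvd (by exact_mod_cast this)
      · rw [Nat.abs_cast]; exact_mod_cast Nat.mod_lt _ hp.out.pos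
    -- Both `r'` and `q` are below `p`, so the quotient of their product by `p` is below `p`, hence
    -- zero or smooth.
    have hls : ((r' * q / p : ℕ) : ℤ) = 0 ∨ IsSmooth p ((r' * q / p : ℕ) : ℤ) := by
      by_cases h0 : ((r' * q / p : ℕ) : ℤ) = 0
      · exact Or.inl h0
      · refine Or.inr (isSmooth_of_abs_lt h0 ?_)
        rw [Nat.abs_cast]
        exact_mod_cast Nat.div_lt_of_lt_mul (by nlinarith)
    have h2 := smoothCls_shift hp0 hc hrs hls (by
      rw [← hprod]; push_cast; exact hr's.mul hqs)
    rw [← hprod] at h2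
    rw [hval]
    have e1 : (p * ((q * v' : ℤ) : ℚ) * c : ℚ) = p * v' * ((q * c : ℤ) : ℚ) := by push_cast; ring
    have e2 : (p * ((r' : ℤ) : ℚ) * ((q * c : ℤ) : ℚ) : ℚ) = p * (((r' * q : ℕ) : ℤ) : ℚ) * c := by
      push_cast; ring
    rw [e1, h1, e2, h2]

variable (p) in
/-- The section of the residue map: the class of `p` times a lift of a residue class. -/
noncomputable def smoothLift (u : ZMod p) : WittGroup ℚ ⧸ smoothSub p :=
  smoothCls p (p * (u.val : ℤ))

theorem smoothCls_mul_eq_smoothLift {v : ℤ} (hv : v = 0 ∨ IsSmooth p v) :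
    smoothCls p (p * v) = smoothLift p v := by
  rcases hv with rfl | hv
  · simp [smoothLift]
  · have := smoothCls_mul_eq_val (p := p) _ v 1 rfl hv
      (isSmooth_of_abs_lt one_ne_zero (by simpa using hp.out.one_lt))
    simpa [smoothLift] using this

theorem isWittFun_smoothLift : IsWittFun (smoothLift p) := by
  have hp0 : (p : ℚ) ≠ 0 := Nat.cast_ne_zero.2 hp.out.ne_zero
  have hz : smoothLift p 0 = 0 := by simp [smoothLift, isWittFun_smoothCls.zero]
  have hval : ∀ a : ZMod p, a ≠ 0 → IsSmooth p (a.val : ℤ) := fun a ha =>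
    isSmooth_of_abs_lt (by rw [Ne, Nat.cast_eq_zero, ZMod.val_eq_zero]; exact ha) (by
      rw [Nat.abs_cast]; exact_mod_cast ZMod.val_lt a)
  refine ⟨hz, fun a b hb => ?_, fun a b => ?_⟩
  · by_cases ha : a = 0
    · simp [ha]
    have h1 := smoothCls_mul_eq_smoothLift (p := p)
      (Or.inr ((hval a ha).mul ((hval b hb).mul (hval b hb))))
    have e1 : (p * ((a.val * (b.val * b.val) : ℤ) : ℚ) : ℚ) =
        p * (a.val : ℤ) * ((b.val : ℤ) : ℚ) ^ 2 := by push_cast; ring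
    rw [e1, isWittFun_smoothCls.mul_sq _ _ (by exact_mod_cast (hval b hb).1)] at h1
    have e2 : (((a.val * (b.val * b.val) : ℤ)) : ZMod p) = a * b ^ 2 := by
      push_cast
      rw [ZMod.natCast_zmod_val, ZMod.natCast_zmod_val]; ring
    rw [e2] at h1
    exact h1.symm
  · by_cases ha : a = 0
    · simp [ha, hz]
    by_cases hb : b = 0
    · simp [hb, hz]
    have hα := hval a ha
    -- Taking a positive representative for `a` and a negative one for `b` keeps the sum below `p`
    -- in absolute value, so it is zero or smooth as well.
    have hβ : IsSmooth p ((b.val : ℤ) - p) := by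
      have h1 : b.val < p := ZMod.val_lt b
      have h2 : b.val ≠ 0 := by simpa using hb
      refine isSmooth_of_abs_lt (by omega) ?_
      rw [abs_of_neg] <;> omega
    have hαβ : (a.val : ℤ) + ((b.val : ℤ) - p) = 0 ∨
        IsSmooth p ((a.val : ℤ) + ((b.val : ℤ) - p)) := by
      by_cases h0 : (a.val : ℤ) + ((b.val : ℤ) - p) = 0
      · exact Or.inl h0
      · refine Or.inr (isSmooth_of_abs_lt h0 ?_)
        have h1 : b.val < p := ZMod.val_lt b
        have h2 : a.val < p := ZMod.val_lt a
        have h3 : b.val ≠ 0 := by simpa using hb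
        have h4 : a.val ≠ 0 := by simpa using ha
        rw [abs_lt]; constructor <;> omega
    have hprod : (a.val : ℤ) * ((b.val : ℤ) - p) * ((a.val : ℤ) + ((b.val : ℤ) - p)) = 0 ∨
        IsSmooth p ((a.val : ℤ) * ((b.val : ℤ) - p) * ((a.val : ℤ) + ((b.val : ℤ) - p))) := by
      rcases hαβ with h | h
      · left; rw [h, mul_zero]
      · right; exact (hα.mul hβ).mul h
    have ca : (((a.val : ℤ)) : ZMod p) = a := by simp
    have cb : ((((b.val : ℤ) - p : ℤ)) : ZMod p) = b := by simp
    have r1 := smoothCls_mul_eq_smoothLift (p := p) (Or.inr hα)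
    have r2 := smoothCls_mul_eq_smoothLift (p := p) (Or.inr hβ)
    have r3 := smoothCls_mul_eq_smoothLift (p := p) hαβ
    have r4 := smoothCls_mul_eq_smoothLift (p := p) hprod
    rw [ca] at r1
    rw [cb] at r2
    have cab : (((a.val : ℤ) + ((b.val : ℤ) - p) : ℤ) : ZMod p) = a + b := by
      rw [Int.cast_add, ca, cb]
    rw [cab] at r3
    have cprod : (((a.val : ℤ) * ((b.val : ℤ) - p) * ((a.val : ℤ) + ((b.val : ℤ) - p)) : ℤ) :
        ZMod p) = a * b * (a + b) := by
      rw [Int.cast_mul, Int.cast_mul, ca, cb, cab]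
    rw [cprod] at r4
    rw [← r1, ← r2, isWittFun_smoothCls.add, ← r3, ← r4,
      ← isWittFun_smoothCls.mul_sq (p * (((a.val : ℤ) * ((b.val : ℤ) - p) *
        ((a.val : ℤ) + ((b.val : ℤ) - p)) : ℤ) : ℚ)) p hp0]
    congr 2
    · push_cast; ring
    · push_cast; ring

end Smooth

/-! ### Residues of rational numbers at a prime. -/

section Residue

variable {p : ℕ} [hp : Fact p.Prime] {A : Type*} [AddCommGroup A]

/-- The residue of an integer at `p`: the value of `φ` on the reduction of the unit part if the
valuation is odd, and zero otherwise. -/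
def intResidue (φ : ZMod p → A) (m : ℤ) : A :=
  if Odd (padicValInt p m) then φ ((m / (p : ℤ) ^ padicValInt p m : ℤ) : ZMod p) else 0

theorem padicValInt_pow_mul (e : ℕ) {u : ℤ} (hu : ¬ (p : ℤ) ∣ u) :
    padicValInt p ((p : ℤ) ^ e * u) = e := by
  have hu0 : u ≠ 0 := fun h => hu (h ▸ dvd_zero _)
  have hp0 : ((p : ℤ) ^ e) ≠ 0 := pow_ne_zero _ (Nat.cast_ne_zero.2 hp.out.ne_zero)
  rw [padicValInt.mul hp0 hu0, padicValInt.eq_zero_of_not_dvd hu, add_zero, padicValInt,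
    Int.natAbs_pow, Int.natAbs_natCast, padicValNat.prime_pow]

theorem intResidue_pow_mul (φ : ZMod p → A) (e : ℕ) {u : ℤ} (hu : ¬ (p : ℤ) ∣ u) :
    intResidue φ ((p : ℤ) ^ e * u) = if Odd e then φ (u : ZMod p) else 0 := by
  have hp0 : ((p : ℤ) ^ e) ≠ 0 := pow_ne_zero _ (Nat.cast_ne_zero.2 hp.out.ne_zero)
  rw [intResidue, padicValInt_pow_mul e hu, Int.mul_ediv_cancel_left _ hp0]

theorem exists_eq_pow_mul_not_dvd {m : ℤ} (hm : m ≠ 0) :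
    ∃ (e : ℕ) (u : ℤ), ¬ (p : ℤ) ∣ u ∧ m = (p : ℤ) ^ e * u := by
  have hf : FiniteMultiplicity (p : ℤ) m := by
    rw [Int.finiteMultiplicity_iff]
    exact ⟨by simpa using hp.out.ne_one, hm⟩
  obtain ⟨c, hc, hnd⟩ := hf.exists_eq_pow_mul_and_not_dvd
  exact ⟨_, c, hnd, hc⟩

theorem intResidue_zero (φ : ZMod p → A) : intResidue φ 0 = 0 := by
  simp [intResidue]

theorem not_dvd_mul_of_prime {a b : ℤ} (ha : ¬ (p : ℤ) ∣ a) (hb : ¬ (p : ℤ) ∣ b) :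
    ¬ (p : ℤ) ∣ a * b :=
  fun h => ((Nat.prime_iff_prime_int.1 hp.out).dvd_or_dvd h).elim ha hb

theorem cast_ne_zero_of_not_dvd {a : ℤ} (ha : ¬ (p : ℤ) ∣ a) : (a : ZMod p) ≠ 0 :=
  fun h => ha ((ZMod.intCast_zmod_eq_zero_iff_dvd a p).1 h)

theorem intResidue_mul_sq {φ : ZMod p → A} (hφ : IsWittFun φ) (m : ℤ) {b : ℤ} (hb : b ≠ 0) :
    intResidue φ (m * b ^ 2) = intResidue φ m := by
  by_cases hm : m = 0
  · simp [hm]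
  obtain ⟨e, u, hu, rfl⟩ := exists_eq_pow_mul_not_dvd (p := p) hm
  obtain ⟨f, v, hv, rfl⟩ := exists_eq_pow_mul_not_dvd (p := p) hb
  have h1 : (p : ℤ) ^ e * u * ((p : ℤ) ^ f * v) ^ 2 = (p : ℤ) ^ (e + 2 * f) * (u * (v * v)) := by
    ring
  rw [h1, intResidue_pow_mul φ _ (not_dvd_mul_of_prime hu (not_dvd_mul_of_prime hv hv)),
    intResidue_pow_mul φ _ hu]
  have h2 : Odd (e + 2 * f) ↔ Odd e := by
    rw [Nat.odd_add]; simp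
  simp only [h2]
  push_cast
  rw [← pow_two, hφ.mul_sq _ _ (cast_ne_zero_of_not_dvd hv)]

/-- The term of smaller valuation dominates: the sum has valuation `i` and unit part congruent to
`u`, so the product term has unit part `v` times a square and valuation of the parity of `j`. -/
theorem intResidue_add_of_lt {φ : ZMod p → A} (hφ : IsWittFun φ) {i j : ℕ} (hij : i < j)
    {u v : ℤ} (hu : ¬ (p : ℤ) ∣ u) (hv : ¬ (p : ℤ) ∣ v) :
    intResidue φ ((p : ℤ) ^ i * u) + intResidue φ ((p : ℤ) ^ j * v) =
      intResidue φ ((p : ℤ) ^ i * u + (p : ℤ) ^ j * v) +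
        intResidue φ ((p : ℤ) ^ i * u * ((p : ℤ) ^ j * v) *
          ((p : ℤ) ^ i * u + (p : ℤ) ^ j * v)) := by
  obtain ⟨k, rfl⟩ := Nat.exists_eq_add_of_lt hij
  set w : ℤ := u + p * ((p : ℤ) ^ k * v) with hw
  have hwn : ¬ (p : ℤ) ∣ w := fun h => hu ((Int.dvd_add_left (dvd_mul_right _ _)).1 h)
  have h1 : (p : ℤ) ^ i * u + (p : ℤ) ^ (i + k + 1) * v = (p : ℤ) ^ i * w := by rw [hw]; ring
  have h2 : (p : ℤ) ^ i * u * ((p : ℤ) ^ (i + k + 1) * v) * ((p : ℤ) ^ i * w) =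
      (p : ℤ) ^ (i + k + 1 + 2 * i) * (u * v * w) := by ring
  have hcw : (w : ZMod p) = u := by rw [hw]; push_cast; simp
  rw [h1, h2, intResidue_pow_mul φ _ hu, intResidue_pow_mul φ _ hv, intResidue_pow_mul φ _ hwn,
    intResidue_pow_mul φ _ (not_dvd_mul_of_prime (not_dvd_mul_of_prime hu hv) hwn)]
  have h3 : Odd (i + k + 1 + 2 * i) ↔ Odd (i + k + 1) := by
    rw [Nat.odd_add]; simp
  have h4 : ((u * v * w : ℤ) : ZMod p) = v * (u : ZMod p) ^ 2 := by
    push_cast; rw [hcw]; ring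
  simp only [h3, h4, hφ.mul_sq _ _ (cast_ne_zero_of_not_dvd hu), hcw]

theorem intResidue_add {φ : ZMod p → A} (hφ : IsWittFun φ) (a b : ℤ) :
    intResidue φ a + intResidue φ b = intResidue φ (a + b) + intResidue φ (a * b * (a + b)) := by
  by_cases ha : a = 0
  · simp [ha, intResidue_zero]
  by_cases hb : b = 0
  · simp [hb, intResidue_zero]
  obtain ⟨i, u, hu, rfl⟩ := exists_eq_pow_mul_not_dvd (p := p) ha
  obtain ⟨j, v, hv, rfl⟩ := exists_eq_pow_mul_not_dvd (p := p) hb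
  rcases lt_trichotomy i j with hij | rfl | hij
  · exact intResidue_add_of_lt hφ hij hu hv
  · by_cases hc : u + v = 0
    · have h1 : (p : ℤ) ^ i * u + (p : ℤ) ^ i * v = 0 := by rw [← mul_add, hc, mul_zero]
      rw [h1, mul_zero, intResidue_zero, intResidue_pow_mul φ _ hu, intResidue_pow_mul φ _ hv,
        eq_neg_of_add_eq_zero_right hc, Int.cast_neg, hφ.neg]
      split_ifs <;> simp
    · obtain ⟨k, w, hw, hwe⟩ := exists_eq_pow_mul_not_dvd (p := p) hc
      have h1 : (p : ℤ) ^ i * u + (p : ℤ) ^ i * v = (p : ℤ) ^ (i + k) * w := by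
        rw [← mul_add, hwe]; ring
      have h2 : (p : ℤ) ^ i * u * ((p : ℤ) ^ i * v) * ((p : ℤ) ^ (i + k) * w) =
          (p : ℤ) ^ (i + k + 2 * i) * (u * v * w) := by ring
      rw [h1, h2, intResidue_pow_mul φ _ hu, intResidue_pow_mul φ _ hv,
        intResidue_pow_mul φ _ hw,
        intResidue_pow_mul φ _ (not_dvd_mul_of_prime (not_dvd_mul_of_prime hu hv) hw)]
      have h3 : Odd (i + k + 2 * i) ↔ Odd (i + k) := by
        rw [Nat.odd_add]; simp
      simp only [h3]
      rcases Nat.eq_zero_or_pos k with rfl | hk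
      · rw [pow_zero, one_mul] at hwe
        subst hwe
        by_cases ho : Odd i
        · simp only [add_zero, ho, if_true]
          push_cast
          exact hφ.add _ _
        · simp [ho]
      -- Here the units cancel modulo `p`, so the two residues on the left are opposite. On the
      -- right the product term has unit part `-w u²` and a valuation of the same parity as that of
      -- the sum, so these cancel too.
      · have hcz : (v : ZMod p) = -u := by
          have := congrArg (Int.cast : ℤ → ZMod p) hwe
          push_cast at this
          rw [CharP.cast_eq_zero, zero_pow hk.ne', zero_mul] at this
          exact eq_neg_of_add_eq_zero_right this
        have h4 : ((u * v * w : ℤ) : ZMod p) = -w * (u : ZMod p) ^ 2 := by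
          push_cast; rw [hcz]; ring
        simp only [hcz, h4, hφ.mul_sq _ _ (cast_ne_zero_of_not_dvd hu), hφ.neg]
        split_ifs <;> simp
  · rw [add_comm, intResidue_add_of_lt hφ hij hv hu, add_comm ((p : ℤ) ^ j * v),
      mul_comm ((p : ℤ) ^ j * v) ((p : ℤ) ^ i * u)]

/-- The residue of a rational number at `p`. -/
def ratResidue (φ : ZMod p → A) (a : ℚ) : A := intResidue φ (a.num * a.den)

/-- The residue may be computed from any integer in the square class, which permits common
denominators and reduces the Witt relations to integers. -/
theorem ratResidue_eq {φ : ZMod p → A} (hφ : IsWittFun φ) {a : ℚ} {m N : ℤ} (hN : N ≠ 0)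
    (h : (m : ℚ) = a * N ^ 2) : ratResidue φ a = intResidue φ m := by
  have hd : (a.den : ℤ) ≠ 0 := Nat.cast_ne_zero.2 a.den_nz
  have h1 : a.num * a.den * N ^ 2 = m * (a.den : ℤ) ^ 2 := by
    have h2 : (a : ℚ) * a.den = a.num := Rat.mul_den_eq_num a
    have : ((a.num * a.den * N ^ 2 : ℤ) : ℚ) = ((m * (a.den : ℤ) ^ 2 : ℤ) : ℚ) := by
      push_cast
      rw [h, ← h2]; ring
    exact_mod_cast this
  rw [ratResidue, ← intResidue_mul_sq hφ _ hN, h1, intResidue_mul_sq hφ _ hd]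

theorem ratResidue_intCast (φ : ZMod p → A) (m : ℤ) :
    ratResidue φ (m : ℚ) = intResidue φ m := by
  simp [ratResidue]

theorem isWittFun_ratResidue {φ : ZMod p → A} (hφ : IsWittFun φ) : IsWittFun (ratResidue φ) := by
  have hden : ∀ a : ℚ, (a.den : ℤ) ≠ 0 := fun a => Nat.cast_ne_zero.2 a.den_nz
  have hn : ∀ a : ℚ, (a.num : ℚ) = a * a.den := fun a => (Rat.mul_den_eq_num a).symm
  refine ⟨?_, fun a b hb => ?_, fun a b => ?_⟩
  · simp [ratResidue, intResidue_zero]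
  · rw [ratResidue_eq hφ (a := a * b ^ 2) (m := a.num * a.den * b.num ^ 2) (N := a.den * b.den)
      (mul_ne_zero (hden a) (hden b)), intResidue_mul_sq hφ _ (Rat.num_ne_zero.2 hb)]
    · rfl
    · push_cast; rw [hn a, hn b]; ring
  · have e1 : (a.num * a.den * (b.den : ℤ) ^ 2 : ℤ) = (a * ((a.den * b.den : ℤ) : ℚ) ^ 2 : ℚ) := by
      push_cast; rw [hn a]; ring
    have e2 : (b.num * b.den * (a.den : ℤ) ^ 2 : ℤ) = (b * ((a.den * b.den : ℤ) : ℚ) ^ 2 : ℚ) := by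
      push_cast; rw [hn b]; ring
    have hN := mul_ne_zero (hden a) (hden b)
    rw [ratResidue_eq hφ hN e1, ratResidue_eq hφ hN e2, intResidue_add hφ,
      ratResidue_eq hφ (a := a + b) (m := a.num * a.den * (b.den : ℤ) ^ 2 +
        b.num * b.den * (a.den : ℤ) ^ 2) hN (by rw [Int.cast_add, e1, e2]; ring),
      ratResidue_eq hφ (a := a * b * (a + b)) (m := a.num * a.den * (b.den : ℤ) ^ 2 *
        (b.num * b.den * (a.den : ℤ) ^ 2) * (a.num * a.den * (b.den : ℤ) ^ 2 +
        b.num * b.den * (a.den : ℤ) ^ 2)) (N := (a.den * b.den) ^ 3) (pow_ne_zero _ hN) (by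
          rw [Int.cast_mul, Int.cast_mul, Int.cast_add, e1, e2]; push_cast; ring)]

end Residue

/-! ### Descent through the filtration to multiples of ⟨1⟩. -/

section Descent

open WittGroup

variable (p : ℕ) [hp : Fact p.Prime]

/-- The residue homomorphism at `p` from the Witt group of `ℚ`. -/
noncomputable def wittResidue : WittGroup ℚ →+ WittGroup ℚ ⧸ smoothSub p :=
  WittGroup.lift (isWittFun_ratResidue (isWittFun_smoothLift (p := p)))

variable {p}

/-- It suffices to compare on a generator `p ^ e * u` with `u` smooth. For even `e` both sides
vanish; for odd `e` both are the class of `p u`, which depends only on `u` modulo `p`. -/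
theorem wittResidue_eq_mk {x : WittGroup ℚ} (hx : x ∈ smoothSub (p + 1)) :
    wittResidue p x = QuotientAddGroup.mk' (smoothSub p) x := by
  induction hx using AddSubgroup.closure_induction with
  | zero => rw [map_zero, map_zero]
  | add a b _ _ ha hb => rw [map_add, map_add, ha, hb]
  | neg a _ ha => rw [map_neg, map_neg, ha]
  | mem x hx =>
    obtain ⟨v, hv, rfl⟩ := hx
    obtain ⟨e, u, hu, rfl⟩ := exists_eq_pow_mul_not_dvd (p := p) hv.1
    have hus : IsSmooth p u := by
      refine ⟨fun h => hu (h ▸ dvd_zero _), fun q hq hd => ?_⟩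
      have h1 := hv.2 q hq (hd.mul_left _)
      have h2 : q ≠ p := fun h => hu (h ▸ hd)
      omega
    rw [wittResidue, lift_cls, ratResidue_intCast, intResidue_pow_mul _ _ hu]
    have hp0 : (p : ℚ) ≠ 0 := Nat.cast_ne_zero.2 hp.out.ne_zero
    change _ = smoothCls p _
    split_ifs with he
    · obtain ⟨k, rfl⟩ := he
      have h1 : (((p : ℤ) ^ (2 * k + 1) * u : ℤ) : ℚ) = p * u * ((p : ℚ) ^ k) ^ 2 := by
        push_cast; ring
      rw [h1, isWittFun_smoothCls.mul_sq _ _ (pow_ne_zero _ hp0),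
        smoothCls_mul_eq_smoothLift (Or.inr hus)]
    · obtain ⟨k, rfl⟩ := Nat.not_odd_iff_even.1 he
      have h1 : (((p : ℤ) ^ (k + k) * u : ℤ) : ℚ) = u * ((p : ℚ) ^ k) ^ 2 := by
        push_cast; ring
      rw [h1, isWittFun_smoothCls.mul_sq _ _ (pow_ne_zero _ hp0), smoothCls_eq_zero hus]

theorem mem_smoothSub_of_wittResidue_eq_zero {x : WittGroup ℚ} (hx : x ∈ smoothSub (p + 1))
    (h : wittResidue p x = 0) : x ∈ smoothSub p := by
  rw [wittResidue_eq_mk hx, QuotientAddGroup.mk'_apply, QuotientAddGroup.eq_zero_iff] at h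
  exact h

theorem smoothSub_succ_le {n : ℕ} (hn : ¬ n.Prime) : smoothSub (n + 1) ≤ smoothSub n := by
  refine AddSubgroup.closure_mono ?_
  rintro _ ⟨v, hv, rfl⟩
  refine ⟨v, ⟨hv.1, fun q hq hd => ?_⟩, rfl⟩
  have h1 := hv.2 q hq hd
  have h2 : q ≠ n := fun h => hn (h ▸ hq)
  omega

theorem exists_mem_smoothSub (x : WittGroup ℚ) : ∃ N, x ∈ smoothSub N := by
  obtain ⟨B, rfl⟩ := mk_surjective x
  obtain ⟨n, w, rfl⟩ := exists_eq_map_univ B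
  rw [← sum_cls_units]
  have h : ∀ a : ℚ, ∃ N, cls a ∈ smoothSub N := by
    intro a
    by_cases ha : a = 0
    · exact ⟨0, by rw [ha, isWittFun_cls.zero]; exact zero_mem _⟩
    refine ⟨(a.num * a.den).natAbs + 1, ?_⟩
    have h1 : cls a = cls ((a.num * a.den : ℤ) : ℚ) := by
      rw [← isWittFun_cls.mul_sq a a.den (Nat.cast_ne_zero.2 a.den_nz)]
      congr 1
      push_cast
      rw [← Rat.mul_den_eq_num a]; ring
    rw [h1]
    refine cls_mem_smoothSub (isSmooth_of_abs_lt ?_ ?_)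
    · exact mul_ne_zero (Rat.num_ne_zero.2 ha) (Nat.cast_ne_zero.2 a.den_nz)
    · push_cast; omega
  choose N hN using fun i => h (w i)
  refine ⟨∑ i, N i, sum_mem fun i _ => ?_⟩
  exact smoothSub_mono (Finset.single_le_sum (fun _ _ => Nat.zero_le _) (Finset.mem_univ i)) (hN i)

/-- Every class lies in some `smoothSub N`, and vanishing residues let it pass each prime on the way
down to `smoothSub 0`, where the only generators are the classes of 1 and -1. -/
theorem exists_eq_zsmul_of_wittResidue_eq_zero {x : WittGroup ℚ}
    (h : ∀ (p : ℕ) [Fact p.Prime], wittResidue p x = 0) : ∃ s : ℤ, x = s • cls (1 : ℚ) := by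
  have hdown : ∀ N, x ∈ smoothSub N → x ∈ smoothSub 0 := by
    intro N
    induction N with
    | zero => exact id
    | succ n ih =>
      intro hx
      by_cases hn : n.Prime
      · have : Fact n.Prime := ⟨hn⟩
        exact ih (mem_smoothSub_of_wittResidue_eq_zero hx (h n))
      · exact ih (smoothSub_succ_le hn hx)
  obtain ⟨N, hN⟩ := exists_mem_smoothSub x
  have hle : smoothSub 0 ≤ AddSubgroup.zmultiples (cls (1 : ℚ)) := by
    refine (AddSubgroup.closure_le _).2 ?_
    rintro _ ⟨v, hv, rfl⟩
    have hu : v.natAbs = 1 := by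
      by_contra hne
      obtain ⟨q, hq, hd⟩ := Nat.exists_prime_and_dvd hne
      exact absurd (hv.2 q hq (Int.natCast_dvd.2 hd)) (Nat.not_lt_zero _)
    rcases Int.natAbs_eq v with h1 | h1
    · rw [h1, hu]; simp
    · rw [h1, hu]
      have : cls (-1 : ℚ) = -cls 1 := isWittFun_cls.neg 1
      simp [this]
  obtain ⟨s, hs⟩ := AddSubgroup.mem_zmultiples_iff.1 (hle (hdown N hN))
  exact ⟨s, hs.symm⟩

end Descent

/-! ### Orthogonal families in lattices. -/

/-- Symmetric unimodular forms on modules over `ℤ`. -/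
structure IsUnimodularForm {M : Type*} [AddCommGroup M]
    (b : LinearMap.BilinForm ℤ M) : Prop where
  symm : ∀ x y, b x y = b y x
  bij : Function.Bijective b

section Lattice

variable {M : Type} [AddCommGroup M]

theorem finrank_ker_add_one [Module.Free ℤ M] [Module.Finite ℤ M] {f : M →ₗ[ℤ] ℤ}
    (hf : f ≠ 0) : finrank ℤ (LinearMap.ker f) + 1 = finrank ℤ M := by
  have h1 := Submodule.finrank_quotient_add_finrank (LinearMap.ker f)
  rw [f.quotKerEquivRange.finrank_eq] at h1
  have h2 : finrank ℤ (LinearMap.range f) ≤ 1 := by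
    simpa using Submodule.finrank_le (LinearMap.range f)
  have h3 : finrank ℤ (LinearMap.range f) ≠ 0 := by
    intro h
    exact hf (LinearMap.range_eq_bot.1 (Submodule.finrank_eq_zero.1 h))
  omega

/-- The functional `b m` divided by `p` is again integral, and by surjectivity of `b` it is
represented by a vector. -/
theorem exists_eq_smul_of_dvd {b : LinearMap.BilinForm ℤ M} (hb : Function.Bijective b) (p : ℤ)
    {m : M} (h : ∀ m', p ∣ b m m') : ∃ m₀, m = p • m₀ := by
  let φ : M →ₗ[ℤ] ℤ :=
    { toFun := fun m' => b m m' / p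
      map_add' := fun x y => by rw [map_add, Int.add_ediv_of_dvd_left (h x)]
      map_smul' := fun c x => by
        rw [map_smul, smul_eq_mul, Int.mul_ediv_assoc _ (h x)]; rfl }
  obtain ⟨m₀, hm₀⟩ := hb.2 φ
  refine ⟨m₀, hb.1 ?_⟩
  ext m'
  rw [map_smul, hm₀]
  exact (Int.mul_ediv_cancel' (h m')).symm

/-- Diagonalization of a symmetric form over `ℤ`, with diagonal entries not divisible by `p`, if
`p ≠ 2` is zero or prime and the form is nondegenerate modulo `p`. -/
theorem exists_orthogonal_family {p : ℤ} (hp : ∀ a b, p ∣ a * b → p ∣ a ∨ p ∣ b) (hp2 : ¬ p ∣ 2) :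
    ∀ (n : ℕ) {M : Type} [AddCommGroup M] [Module.Free ℤ M] [Module.Finite ℤ M]
      (b : LinearMap.BilinForm ℤ M) (_ : ∀ x y, b x y = b y x) (_ : finrank ℤ M = n)
      (_ : ∀ m, (∀ m', p ∣ b m m') → ∃ m₀, m = p • m₀),
      ∃ v : Fin n → M, (∀ i j, i ≠ j → b (v i) (v j) = 0) ∧ ∀ i, ¬ p ∣ b (v i) (v i) := by
  intro n
  induction n with
  | zero => intro M _ _ _ b _ _ _; exact ⟨fun i => i.elim0, fun i => i.elim0, fun i => i.elim0⟩
  | succ n ih =>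
    intro M _ _ _ b hs hn hnd
    -- If all squares were divisible by `p`, so would be all values, by polarization and `p ∤ 2`;
    -- then a basis vector would be a multiple of `p`, forcing `p ∣ 1`.
    have hx : ∃ x, ¬ p ∣ b x x := by
      by_contra hcon
      push Not at hcon
      have hall : ∀ x y, p ∣ b x y := by
        intro x y
        have h1 := hcon (x + y)
        have h2 : b (x + y) (x + y) = b x x + b y y + 2 * b x y := by
          simp only [map_add, LinearMap.add_apply, hs y x]; ring
        rw [h2, Int.dvd_add_right (dvd_add (hcon x) (hcon y))] at h1
        exact (hp _ _ h1).resolve_left hp2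
      let B := Module.finBasisOfFinrankEq ℤ M hn
      obtain ⟨m₀, hm₀⟩ := hnd (B 0) fun m' => hall _ _
      have h3 := congrArg (fun m => B.repr m 0) hm₀
      simp only [Basis.repr_self, Finsupp.single_eq_same, map_smul, Finsupp.smul_apply,
        smul_eq_mul] at h3
      exact hp2 ((Dvd.intro _ h3.symm).trans (one_dvd 2))
    obtain ⟨x, hx⟩ := hx
    have hx0 : b x ≠ 0 := fun h => hx (by rw [h]; simp)
    have hrank : finrank ℤ (LinearMap.ker (b x)) = n := by
      have := finrank_ker_add_one hx0; omega
    obtain ⟨v, hv, hvp⟩ := ih (M := LinearMap.ker (b x)) (b.restrict (LinearMap.ker (b x)))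
      (fun y z => hs _ _) hrank (by
        rintro ⟨m, hm⟩ h
        have hm' : b x m = 0 := hm
        have key : ∀ m'', p ∣ b m m'' := by
          intro m''
          -- Multiplying by `b x x`, which is prime to `p`, projects `m''` to the complement of `x`
          -- without denominators.
          have ht : b x (b x x • m'' - b x m'' • x) = 0 := by
            simp only [map_sub, map_smul, smul_eq_mul]; ring
          have h1 : p ∣ b m (b x x • m'' - b x m'' • x) := h ⟨_, ht⟩
          simp only [map_sub, map_smul, smul_eq_mul, hs m x, hm', mul_zero, sub_zero] at h1
          exact (hp _ _ h1).resolve_left hx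
        obtain ⟨m₀, rfl⟩ := hnd m key
        by_cases h0 : p = 0
        · exact ⟨0, by ext; simp [h0]⟩
        · rw [map_smul, smul_eq_mul] at hm'
          exact ⟨⟨m₀, (mul_eq_zero.1 hm').resolve_left h0⟩, rfl⟩)
    refine ⟨Fin.cons x (fun i => (v i : M)), ?_, ?_⟩
    · intro i j
      refine Fin.cases (fun hij => ?_) (fun i hij => ?_) i
      · revert hij
        refine Fin.cases (fun h => absurd rfl h) (fun j _ => ?_) j
        simp
      · revert hij
        refine Fin.cases (fun _ => ?_) (fun j hij => ?_) j
        · rw [hs]; simp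
        · simpa using hv i j (fun h => hij (by rw [h]))
    · intro i
      refine Fin.cases ?_ (fun i => ?_) i
      · simpa using hx
      · simpa using hvp i

theorem gram_sum {ι : Type*} [Fintype ι] {b : LinearMap.BilinForm ℤ M} {v : ι → M}
    (hv : ∀ i j, i ≠ j → b (v i) (v j) = 0) (c d : ι → ℤ) :
    b (∑ i, c i • v i) (∑ i, d i • v i) = ∑ i, b (v i) (v i) * c i * d i := by
  classical
  simp only [map_sum, LinearMap.sum_apply, map_smul, LinearMap.smul_apply, smul_eq_mul]
  refine Finset.sum_congr rfl fun i _ => ?_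
  rw [Finset.sum_eq_single i]
  · ring
  · intro j _ hj; rw [hv j i hj]; simp
  · simp

/-- Up to transposition, the Gram matrix is the matrix of the isomorphism `b` onto the dual in the
dual basis. -/
theorem isUnit_det_gram {b : LinearMap.BilinForm ℤ M} (hb : Function.Bijective b) {ι : Type*}
    [Fintype ι] [DecidableEq ι] (B : Basis ι ℤ M) :
    IsUnit (Matrix.of fun i j => b (B i) (B j)).det := by
  have h1 := LinearEquiv.isUnit_det (LinearEquiv.ofBijective b hb) B B.dualBasis
  rw [← Matrix.det_transpose] at h1
  have h2 : (Matrix.of fun i j => b (B i) (B j)) = (LinearMap.toMatrix B B.dualBasis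
      (LinearEquiv.ofBijective b hb : M →ₗ[ℤ] Module.Dual ℤ M)).transpose := by
    ext i j
    rw [Matrix.transpose_apply, LinearMap.toMatrix_apply, Basis.dualBasis_repr]
    rfl
  rw [h2]
  exact h1

theorem gram_eq_mul (b : LinearMap.BilinForm ℤ M) {ι κ : Type*} [Fintype ι] [DecidableEq ι]
    (B : Basis ι ℤ M) (v : κ → M) :
    (Matrix.of fun i j => b (v i) (v j)) =
      (B.toMatrix v).transpose * (Matrix.of fun i j => b (B i) (B j)) * B.toMatrix v := by
  ext i j
  rw [Matrix.of_apply]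
  conv_lhs => rw [← B.sum_repr (v i), ← B.sum_repr (v j)]
  simp only [Matrix.mul_apply, map_sum, LinearMap.sum_apply, map_smul, LinearMap.smul_apply,
    smul_eq_mul, Matrix.of_apply, Matrix.transpose_apply, Basis.toMatrix_apply]
  refine Finset.sum_congr rfl fun k _ => ?_
  rw [Finset.mul_sum, Finset.sum_mul]
  exact Finset.sum_congr rfl fun l _ => by ring

theorem prod_eq_det_mul_sq {b : LinearMap.BilinForm ℤ M} {ι : Type*} [Fintype ι] [DecidableEq ι]
    (B : Basis ι ℤ M) {v : ι → M} (hv : ∀ i j, i ≠ j → b (v i) (v j) = 0) :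
    ∏ i, b (v i) (v i) =
      (Matrix.of fun i j => b (B i) (B j)).det * (B.toMatrix v).det ^ 2 := by
  have h1 : (Matrix.of fun i j => b (v i) (v j)) = Matrix.diagonal fun i => b (v i) (v i) := by
    ext i j
    by_cases hij : i = j
    · subst hij; simp
    · simp [hij, hv i j hij]
  rw [← Matrix.det_diagonal, ← h1, gram_eq_mul b B v, Matrix.det_mul, Matrix.det_mul,
    Matrix.det_transpose]
  ring

variable [Module.Free ℤ M] [Module.Finite ℤ M]

/-- Two orthogonal families of full size in a lattice give Witt equivalent diagonal forms. -/
theorem neutral_of_orthogonal_families {b : LinearMap.BilinForm ℤ M} {ι κ : Type} [Fintype ι]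
    [Fintype κ] {v : ι → M} {v' : κ → M} (hv : ∀ i j, i ≠ j → b (v i) (v j) = 0)
    (hv' : ∀ i j, i ≠ j → b (v' i) (v' j) = 0) (hc : finrank ℤ M ≤ Fintype.card ι)
    (hc' : finrank ℤ M ≤ Fintype.card κ) :
    Neutral (Sum.elim (fun i => (b (v i) (v i) : ℚ)) (fun i => -(b (v' i) (v' i) : ℚ))) := by
  classical
  let B := Module.finBasis ℤ M
  let r : M → (Fin (finrank ℤ M) → ℚ) := fun m i => (B.repr m i : ℚ)
  let G : LinearMap.BilinForm ℚ (Fin (finrank ℤ M) → ℚ) :=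
    Matrix.toBilin' (Matrix.of fun i j => (b (B i) (B j) : ℚ))
  have hG : ∀ m m', G (r m) (r m') = (b m m' : ℚ) := by
    intro m m'
    rw [Matrix.toBilin'_apply]
    conv_rhs => rw [← B.sum_repr m, ← B.sum_repr m']
    simp only [map_sum, LinearMap.sum_apply, map_smul, LinearMap.smul_apply, smul_eq_mul,
      Int.cast_sum, Int.cast_mul, Matrix.of_apply, r]
    rw [Finset.sum_comm]
    refine Finset.sum_congr rfl fun i _ => ?_
    rw [Finset.mul_sum]
    exact Finset.sum_congr rfl fun j _ => by ring
  have hmain : ∀ {σ : Type} [Fintype σ] (u : σ → M), (∀ i j, i ≠ j → b (u i) (u j) = 0) →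
      ∀ x y : σ → ℚ, G (Fintype.linearCombination ℚ (fun k => r (u k)) x)
        (Fintype.linearCombination ℚ (fun k => r (u k)) y) =
        ∑ i, (b (u i) (u i) : ℚ) * x i * y i := by
    intro σ _ u hu x y
    simp only [Fintype.linearCombination_apply, map_sum, LinearMap.sum_apply, map_smul,
      LinearMap.smul_apply, smul_eq_mul, hG]
    refine Finset.sum_congr rfl fun i _ => ?_
    rw [Finset.sum_eq_single i]
    · ring
    · intro j _ hj; rw [hu j i hj]; simp
    · simp
  exact neutral_of_maps_agree _ _ G (hmain v hv) (hmain v' hv') (by simpa using hc)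
    (by simpa using hc')

theorem IsWittFun.sum_orthogonal_eq {A : Type*} [AddCommGroup A] {φ : ℚ → A} (hφ : IsWittFun φ)
    {b : LinearMap.BilinForm ℤ M} {ι κ : Type} [Fintype ι]
    [Fintype κ] {v : ι → M} {v' : κ → M} (hv : ∀ i j, i ≠ j → b (v i) (v j) = 0)
    (hv' : ∀ i j, i ≠ j → b (v' i) (v' j) = 0) (h0 : ∀ i, b (v i) (v i) ≠ 0)
    (h0' : ∀ i, b (v' i) (v' i) ≠ 0) (hc : finrank ℤ M ≤ Fintype.card ι)
    (hc' : finrank ℤ M ≤ Fintype.card κ) :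
    ∑ i, φ (b (v i) (v i) : ℚ) = ∑ i, φ (b (v' i) (v' i) : ℚ) :=
  hφ.sum_eq_sum (fun i => Int.cast_ne_zero.2 (h0 i)) (fun i => Int.cast_ne_zero.2 (h0' i))
    (neutral_of_orthogonal_families hv hv' hc hc')

/-- An orthogonal family of full size and nonzero values spans up to finite index. -/
theorem exists_smul_eq_sum {b : LinearMap.BilinForm ℤ M} {n : ℕ} (hn : finrank ℤ M = n)
    {v : Fin n → M} (hv : ∀ i j, i ≠ j → b (v i) (v j) = 0) (h0 : ∀ i, b (v i) (v i) ≠ 0) (y : M) :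
    ∃ (k : ℤ) (c : Fin n → ℤ), k ≠ 0 ∧ k • y = ∑ i, c i • v i := by
  let B := Module.finBasisOfFinrankEq ℤ M hn
  have hdet : (B.toMatrix v).det ≠ 0 := by
    intro h
    have h1 := prod_eq_det_mul_sq B hv
    rw [h, zero_pow two_ne_zero, mul_zero, Finset.prod_eq_zero_iff] at h1
    obtain ⟨i, _, hi⟩ := h1
    exact h0 i hi
  -- Cramer's rule: the determinant clears the denominators.
  refine ⟨(B.toMatrix v).det, (B.toMatrix v).adjugate.mulVec (B.repr y), hdet, ?_⟩
  apply B.repr.injective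
  ext i
  have h2 := congrFun (congrArg (fun N => N.mulVec (B.repr y))
    (Matrix.mul_adjugate (B.toMatrix v))) i
  simp only [← Matrix.mulVec_mulVec, Matrix.smul_mulVec, Matrix.one_mulVec] at h2
  rw [map_smul, map_sum, Finsupp.smul_apply, Finsupp.finsetSum_apply]
  refine h2.symm.trans ?_
  rw [Matrix.mulVec, dotProduct]
  refine Finset.sum_congr rfl fun j _ => ?_
  rw [map_smul, Finsupp.smul_apply, Basis.toMatrix_apply, smul_eq_mul, mul_comm]

theorem exists_pos_of_pos {b : LinearMap.BilinForm ℤ M} {n : ℕ} (hn : finrank ℤ M = n)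
    {v : Fin n → M} (hv : ∀ i j, i ≠ j → b (v i) (v j) = 0) (h0 : ∀ i, b (v i) (v i) ≠ 0) {y : M}
    (hy : 0 < b y y) : ∃ i, 0 < b (v i) (v i) := by
  by_contra hcon
  push Not at hcon
  obtain ⟨k, c, hk, hkc⟩ := exists_smul_eq_sum hn hv h0 y
  have h1 : b (k • y) (k • y) = k * k * b y y := by simp; ring
  rw [hkc, gram_sum hv] at h1
  have h2 : ∑ i, b (v i) (v i) * c i * c i ≤ 0 :=
    Finset.sum_nonpos fun i _ => by nlinarith [hcon i, mul_self_nonneg (c i)]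
  have h3 : 0 < k * k * b y y := mul_pos (mul_self_pos.2 hk) hy
  omega

theorem exists_neg_of_neg {b : LinearMap.BilinForm ℤ M} {n : ℕ} (hn : finrank ℤ M = n)
    {v : Fin n → M} (hv : ∀ i j, i ≠ j → b (v i) (v j) = 0) (h0 : ∀ i, b (v i) (v i) ≠ 0) {y : M}
    (hy : b y y < 0) : ∃ i, b (v i) (v i) < 0 := by
  have := exists_pos_of_pos (b := -b) hn (v := v) (fun i j h => by simp [hv i j h])
    (fun i => by simpa using h0 i) (y := y) (by simpa using hy)
  simpa using this

end Lattice

/-! ### Witt classes of unimodular forms, and zeros of indefinite ones. -/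

section Isotropy

open WittGroup

/-- The sign of a rational number as an integer. -/
def ratSign (a : ℚ) : ℤ := SignType.sign a

theorem ratSign_of_pos {a : ℚ} (h : 0 < a) : ratSign a = 1 := by simp [ratSign, h]

theorem ratSign_of_neg {a : ℚ} (h : a < 0) : ratSign a = -1 := by simp [ratSign, h]

theorem ratSign_zero : ratSign 0 = 0 := by simp [ratSign]

theorem isWittFun_ratSign : IsWittFun ratSign where
  zero := ratSign_zero
  mul_sq a b hb := by
    have hb2 : (0 : ℚ) < b ^ 2 := by positivity
    simp [ratSign, sign_mul, sign_pos hb2]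
  add a b := by
    have hm : ∀ x y : ℚ, ratSign (x * y) = ratSign x * ratSign y := by
      intro x y; simp [ratSign, sign_mul]
    rw [hm, hm]
    rcases lt_trichotomy a 0 with ha | rfl | ha <;> rcases lt_trichotomy b 0 with hb | rfl | hb
    · rw [ratSign_of_neg ha, ratSign_of_neg hb, ratSign_of_neg (add_neg ha hb)]; rfl
    · simp [ratSign_zero]
    · rw [ratSign_of_neg ha, ratSign_of_pos hb]; ring
    · simp [ratSign_zero]
    · simp [ratSign_zero]
    · simp [ratSign_zero]
    · rw [ratSign_of_pos ha, ratSign_of_neg hb]; ring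
    · simp [ratSign_zero]
    · rw [ratSign_of_pos ha, ratSign_of_pos hb, ratSign_of_pos (add_pos ha hb)]; rfl

theorem two_nsmul_eq_zero_of_isWittFun {A : Type*} [AddCommGroup A] {φ : ZMod 2 → A}
    (hφ : IsWittFun φ) : φ 1 + φ 1 = 0 := by
  have h := hφ.add 1 1
  rw [show (1 : ZMod 2) + 1 = 0 from rfl, mul_zero, hφ.zero, add_zero] at h
  exact h

theorem intResidue_two {A : Type*} [AddCommGroup A] {φ : ZMod 2 → A} (hφ : IsWittFun φ) {m : ℤ}
    (hm : m ≠ 0) : intResidue φ m = padicValInt 2 m • φ 1 := by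
  have h2 := two_nsmul_eq_zero_of_isWittFun hφ
  have hf : Fact (Nat.Prime 2) := ⟨Nat.prime_two⟩
  obtain ⟨e, u, hu, rfl⟩ := exists_eq_pow_mul_not_dvd (p := 2) hm
  rw [intResidue_pow_mul φ _ hu, padicValInt_pow_mul e hu]
  have hu1 : (u : ZMod 2) = 1 :=
    Fin.eq_one_of_ne_zero (u : ZMod 2) (cast_ne_zero_of_not_dvd hu)
  rw [hu1]
  split_ifs with he
  · obtain ⟨k, rfl⟩ := he
    rw [add_smul, mul_comm, mul_smul, two_smul, h2, smul_zero, one_smul, zero_add]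
  · obtain ⟨k, rfl⟩ := Nat.not_odd_iff_even.1 he
    rw [← two_mul, mul_comm, mul_smul, two_smul, h2, smul_zero]

/-- The only nonzero residue class is 1 and `φ 1` has order dividing 2, so the sum is the valuation
of the product times `φ 1`; for a unit times a square this valuation is even. -/
theorem sum_intResidue_two {A : Type*} [AddCommGroup A] {φ : ZMod 2 → A} (hφ : IsWittFun φ)
    {ι : Type*} [Fintype ι] {d : ι → ℤ} (hd : ∀ i, d i ≠ 0) {u t : ℤ} (hu : IsUnit u)
    (h : ∏ i, d i = u * t ^ 2) : ∑ i, intResidue φ (d i) = 0 := by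
  classical
  have hf : Fact (Nat.Prime 2) := ⟨Nat.prime_two⟩
  have h2 := two_nsmul_eq_zero_of_isWittFun hφ
  have hval : ∀ s : Finset ι, padicValInt 2 (∏ i ∈ s, d i) = ∑ i ∈ s, padicValInt 2 (d i) := by
    intro s
    induction s using Finset.induction_on with
    | empty => simp
    | insert i s hi ih =>
      rw [Finset.prod_insert hi, Finset.sum_insert hi,
        padicValInt.mul (hd i) (Finset.prod_ne_zero_iff.2 fun j _ => hd j), ih]
  have ht : t ≠ 0 := by
    rintro rfl
    rw [zero_pow two_ne_zero, mul_zero, Finset.prod_eq_zero_iff] at h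
    obtain ⟨i, _, hi⟩ := h
    exact hd i hi
  have hpv : padicValInt 2 (∏ i, d i) = padicValInt 2 t * 2 := by
    rw [h, padicValInt.mul hu.ne_zero (pow_ne_zero _ ht), pow_two, padicValInt.mul ht ht]
    have : padicValInt 2 u = 0 := by
      rcases Int.isUnit_iff.1 hu with rfl | rfl <;> simp [padicValInt]
    omega
  rw [Finset.sum_congr rfl fun i _ => intResidue_two hφ (hd i), ← Finset.sum_smul, ← hval, hpv,
    mul_smul, two_smul, h2, smul_zero]

variable {M : Type} [AddCommGroup M] [Module.Free ℤ M] [Module.Finite ℤ M]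

theorem exists_orthogonal_family_of_prime {b : LinearMap.BilinForm ℤ M} (hb : IsUnimodularForm b)
    {p : ℕ} (hp : p.Prime) (hp2 : p ≠ 2) :
    ∃ v : Fin (finrank ℤ M) → M, (∀ i j, i ≠ j → b (v i) (v j) = 0) ∧
      ∀ i, ¬ (p : ℤ) ∣ b (v i) (v i) := by
  refine exists_orthogonal_family (fun a b h => (Nat.prime_iff_prime_int.1 hp).dvd_or_dvd h)
    (fun h => hp2 ?_) _ b hb.symm rfl fun m hm => exists_eq_smul_of_dvd hb.bij _ hm
  exact (Nat.prime_dvd_prime_iff_eq hp Nat.prime_two).1 (by exact_mod_cast h)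

theorem sum_cls_eq_of_unimodular {b : LinearMap.BilinForm ℤ M} (hb : IsUnimodularForm b)
    {v : Fin (finrank ℤ M) → M} (hv : ∀ i j, i ≠ j → b (v i) (v j) = 0)
    (h0 : ∀ i, b (v i) (v i) ≠ 0) :
    ∑ i, cls (b (v i) (v i) : ℚ) = (∑ i, ratSign (b (v i) (v i))) • cls (1 : ℚ) := by
  have hres : ∀ (p : ℕ) [Fact p.Prime], wittResidue p (∑ i, cls (b (v i) (v i) : ℚ)) = 0 := by
    intro p hp
    simp only [map_sum, wittResidue, lift_cls]
    by_cases hp2 : p = 2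
    · subst hp2
      simp only [ratResidue_intCast]
      let B := Module.finBasis ℤ M
      exact sum_intResidue_two isWittFun_smoothLift h0 (isUnit_det_gram hb.bij B)
        (prod_eq_det_mul_sq B hv)
    -- The Witt class does not depend on the orthogonal family, so the residue at an odd prime may
    -- be computed from a family with values prime to `p`.
    · obtain ⟨v', hv', hvp⟩ := exists_orthogonal_family_of_prime hb hp.out hp2
      rw [(isWittFun_ratResidue isWittFun_smoothLift).sum_orthogonal_eq hv hv' h0
        (fun i h => hvp i (h ▸ dvd_zero _)) (by simp) (by simp)]
      refine Finset.sum_eq_zero fun i _ => ?_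
      have := intResidue_pow_mul (smoothLift p) 0 (hvp i)
      rw [pow_zero, one_mul] at this
      rw [ratResidue_intCast, this]
      simp
  obtain ⟨s, hs⟩ := exists_eq_zsmul_of_wittResidue_eq_zero hres
  have h1 := congrArg (WittGroup.lift isWittFun_ratSign) hs
  rw [map_sum, map_zsmul, lift_cls, ratSign_of_pos one_pos] at h1
  simp only [lift_cls] at h1
  rw [hs, h1]
  simp

/-- An indefinite unimodular form over `ℤ` represents zero. -/
theorem exists_isotropic {b : LinearMap.BilinForm ℤ M} (hb : IsUnimodularForm b) {x y : M}
    (hx : 0 < b x x) (hy : b y y < 0) : ∃ z, z ≠ 0 ∧ b z z = 0 := by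
  -- Any odd prime would do; only the nonvanishing of the values is used.
  obtain ⟨v, hv, hvp⟩ := exists_orthogonal_family_of_prime hb Nat.prime_three (by norm_num)
  have h0 : ∀ i, b (v i) (v i) ≠ 0 := fun i h => hvp i (h ▸ dvd_zero _)
  have hcls := sum_cls_eq_of_unimodular hb hv h0
  set s := ∑ i, ratSign (b (v i) (v i)) with hs
  have hle : ∀ a : ℚ, ratSign a ≤ 1 ∧ -1 ≤ ratSign a := by
    intro a
    rcases lt_trichotomy a 0 with h | rfl | h
    · simp [ratSign_of_neg h]
    · simp [ratSign_zero]
    · simp [ratSign_of_pos h]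
  obtain ⟨i, hi⟩ := exists_pos_of_pos rfl hv h0 hx
  obtain ⟨j, hj⟩ := exists_neg_of_neg rfl hv h0 hy
  have hs1 : s < finrank ℤ M := by
    have : s < ∑ i : Fin (finrank ℤ M), (1 : ℤ) :=
      Finset.sum_lt_sum (fun k _ => (hle _).1) ⟨j, Finset.mem_univ _, by
        rw [ratSign_of_neg (by exact_mod_cast hj)]; norm_num⟩
    simpa using this
  have hs2 : -(finrank ℤ M : ℤ) < s := by
    have : ∑ i : Fin (finrank ℤ M), (-1 : ℤ) < s :=
      Finset.sum_lt_sum (fun k _ => (hle _).2) ⟨i, Finset.mem_univ _, by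
        rw [ratSign_of_pos (by exact_mod_cast hi)]; norm_num⟩
    simpa using this
  -- The multiple of ⟨1⟩ is written as a diagonal form of dimension `|s|` with all entries equal to
  -- the sign of `s`.
  obtain ⟨ε, hε, hεs⟩ : ∃ ε : ℚ, ε ≠ 0 ∧ s • cls (1 : ℚ) = ∑ _k : Fin s.natAbs, cls ε := by
    rcases Int.natAbs_eq s with h | h
    · exact ⟨1, one_ne_zero, by
        rw [Finset.sum_const, Finset.card_univ, Fintype.card_fin]
        conv_lhs => rw [h]
        exact natCast_zsmul _ _⟩
    · refine ⟨-1, by norm_num, ?_⟩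
      rw [Finset.sum_const, Finset.card_univ, Fintype.card_fin, isWittFun_cls.neg]
      conv_lhs => rw [h]
      rw [neg_smul, natCast_zsmul, smul_neg]
  rw [hεs] at hcls
  obtain ⟨L, hL, hd⟩ := (sum_cls_eq_iff (fun i => Int.cast_ne_zero.2 (h0 i))
    (fun _ => hε)).1 hcls
  let g : L →ₗ[ℚ] (Fin s.natAbs → ℚ) := LinearMap.funLeft ℚ ℚ Sum.inr ∘ₗ L.subtype
  -- The dimension of `L` is at least half of `rank + |s|`, which exceeds `|s|`; so some nonzero
  -- vector of `L` vanishes on the `|s|` auxiliary coordinates and is isotropic for the given form.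
  have hker : 0 < finrank ℚ (LinearMap.ker g) := by
    have h1 := LinearMap.finrank_range_add_finrank_ker g
    have h2 := Submodule.finrank_le (LinearMap.range g)
    simp only [finrank_fintype_fun_eq_card, Fintype.card_sum, Fintype.card_fin] at h1 h2 hd
    omega
  have := Module.nontrivial_of_finrank_pos hker
  obtain ⟨⟨⟨l, hl⟩, hlk⟩, hlne⟩ := exists_ne (0 : LinearMap.ker g)
  have hlr : ∀ k, l (Sum.inr k) = 0 := fun k => congrFun (show g ⟨l, hl⟩ = 0 from hlk) k
  have hl0 : ∃ i, l (Sum.inl i) ≠ 0 := by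
    by_contra hcon
    push Not at hcon
    apply hlne
    apply Subtype.ext
    apply Subtype.ext
    funext k
    rcases k with k | k
    · exact hcon k
    · exact hlr k
  have hiso := hL l hl l hl
  rw [Fintype.sum_sum_type] at hiso
  simp only [hlr, mul_zero, Finset.sum_const_zero, add_zero, Sum.elim_inl] at hiso
  obtain ⟨⟨N, hN⟩, hNl⟩ := IsLocalization.exist_integer_multiples (nonZeroDivisors ℤ) Finset.univ
    (fun i => l (Sum.inl i))
  choose c hc using fun i => hNl i (Finset.mem_univ i)
  have hN0 : N ≠ 0 := nonZeroDivisors.ne_zero hN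
  have hc' : ∀ i, (c i : ℚ) = N * l (Sum.inl i) := by
    intro i
    have := hc i
    simpa using this
  obtain ⟨i, hi⟩ := hl0
  have hci : c i ≠ 0 := by
    intro h
    have := hc' i
    rw [h, Int.cast_zero] at this
    exact (mul_ne_zero (Int.cast_ne_zero.2 hN0) hi) this.symm
  refine ⟨∑ i, c i • v i, ?_, ?_⟩
  · intro h
    have h1 := gram_sum hv c (Pi.single i 1)
    rw [h, map_zero, LinearMap.zero_apply, Finset.sum_eq_single i] at h1
    · simp only [Pi.single_eq_same, mul_one] at h1
      exact mul_ne_zero (h0 i) hci h1.symm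
    · intro k _ hk; simp [hk]
    · simp
  · rw [gram_sum hv]
    have : ((∑ i, b (v i) (v i) * c i * c i : ℤ) : ℚ) = 0 := by
      push_cast
      simp only [hc']
      rw [← mul_zero ((N : ℚ) ^ 2), ← hiso, Finset.mul_sum]
      exact Finset.sum_congr rfl fun i _ => by ring
    exact_mod_cast this

end Isotropy

/-! ### Classification of indefinite odd unimodular forms. -/

section Odd

variable {M : Type} [AddCommGroup M]

/-- Dividing an isotropic `z` by the generator of the ideal of its values `b z m` gives an isotropic
vector that takes the value 1. -/
theorem exists_isotropic_pair [Module.Free ℤ M] [Module.Finite ℤ M] {b : LinearMap.BilinForm ℤ M}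
    (hb : IsUnimodularForm b) {x y : M} (hx : 0 < b x x) (hy : b y y < 0) :
    ∃ x y, b x x = 0 ∧ b x y = 1 := by
  obtain ⟨z, hz, hzz⟩ := exists_isotropic hb hx hy
  let g := Submodule.IsPrincipal.generator (LinearMap.range (b z))
  have hg : ∀ m, g ∣ b z m := fun m =>
    (Submodule.IsPrincipal.mem_iff_generator_dvd _).1 ⟨m, rfl⟩
  obtain ⟨x', hx'⟩ := exists_eq_smul_of_dvd hb.bij g hg
  have hg0 : g ≠ 0 := by
    intro h; rw [h, zero_smul] at hx'; exact hz hx'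
  obtain ⟨m₀, hm₀⟩ := Submodule.IsPrincipal.generator_mem (LinearMap.range (b z))
  refine ⟨x', m₀, ?_, ?_⟩
  · rw [hx'] at hzz
    simpa [hg0] using hzz
  · have h1 : b z m₀ = g := hm₀
    rw [hx', map_smul, LinearMap.smul_apply, smul_eq_mul] at h1
    exact mul_left_cancel₀ hg0 (h1.trans (mul_one g).symm)

theorem exists_isotropic_pair_odd [Module.Free ℤ M] [Module.Finite ℤ M]
    {b : LinearMap.BilinForm ℤ M}
    (hb : IsUnimodularForm b) {x y z : M} (hx : 0 < b x x) (hy : b y y < 0) (hz : Odd (b z z)) :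
    ∃ u v, b u u = 1 ∧ b v v = -1 ∧ b u v = 0 := by
  obtain ⟨x, y, hxx, hxy⟩ := exists_isotropic_pair hb hx hy
  have hyx : b y x = 1 := by rw [hb.symm, hxy]
  obtain ⟨w, hxw, hw⟩ : ∃ w, b x w = 1 ∧ Odd (b w w) := by
    by_cases ho : Odd (b y y)
    · exact ⟨y, hxy, ho⟩
    · rw [Int.not_odd_iff_even] at ho
      -- When `y` has even square, adding a multiple of it to `z` corrects the pairing with `x` and
      -- keeps the square odd.
      refine ⟨z + (1 - b x z) • y, ?_, ?_⟩
      · simp [hxy]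
      · have : b (z + (1 - b x z) • y) (z + (1 - b x z) • y) =
            b z z + (2 * ((1 - b x z) * b z y) + (1 - b x z) ^ 2 * b y y) := by
          simp only [map_add, map_smul, LinearMap.add_apply, LinearMap.smul_apply, smul_eq_mul,
            hb.symm y z]
          ring
        rw [this]
        exact hz.add_even ((even_two_mul _).add (ho.mul_left _))
  have hwx : b w x = 1 := by rw [hb.symm, hxw]
  obtain ⟨k, hk⟩ := hw
  -- With `w² = 2k + 1` and `x w = 1`, subtracting `k x` lowers the square to 1, and subtracting one
  -- more `x` lowers it to -1.
  refine ⟨w - k • x, w - k • x - x, ?_, ?_, ?_⟩ <;>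
  · simp only [map_sub, map_smul, LinearMap.sub_apply, LinearMap.smul_apply, smul_eq_mul, hxx,
      hxw, hwx, hk]
    ring

/-- Splitting off a vector of square `±1` from a unimodular form. -/
theorem IsUnimodularForm.restrict_ker {b : LinearMap.BilinForm ℤ M} (hb : IsUnimodularForm b)
    {e : M} (he : b e e * b e e = 1) :
    IsUnimodularForm (b.restrict (LinearMap.ker (b e))) := by
  -- The orthogonal projection along `e` is integral because `b e e` is its own inverse.
  let π : M →ₗ[ℤ] LinearMap.ker (b e) :=
    LinearMap.codRestrict (LinearMap.ker (b e))
      (LinearMap.id - (b e e) • (b e).smulRight e) (by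
        intro m
        rw [LinearMap.mem_ker]
        simp only [LinearMap.sub_apply, LinearMap.id_apply, LinearMap.smul_apply,
          LinearMap.smulRight_apply, map_sub, map_smul, smul_eq_mul]
        linear_combination (-(b e m)) * he)
  have hπ : ∀ m, (π m : M) = m - (b e e * b e m) • e := by
    intro m
    simp [π, mul_smul, smul_comm (b e e) (b e m) e]
  have hbn : ∀ n ∈ LinearMap.ker (b e), ∀ m, b n (π m) = b n m := by
    intro n hn m
    have : b e n = 0 := hn
    rw [hπ, map_sub, map_smul, hb.symm n e, this, smul_zero, sub_zero]
  refine ⟨fun x y => hb.symm _ _, ?_, ?_⟩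
  · refine (injective_iff_map_eq_zero _).2 ?_
    rintro ⟨n, hn⟩ h
    apply Subtype.ext
    apply hb.bij.1
    rw [Submodule.coe_zero, map_zero]
    ext m
    rw [← hbn n hn m]
    exact LinearMap.congr_fun h (π m)
  · intro φ
    obtain ⟨m₀, hm₀⟩ := hb.bij.2 (φ ∘ₗ π)
    refine ⟨π m₀, ?_⟩
    ext n
    have hn : b e n = 0 := n.2
    have h1 : b (π m₀) n = b m₀ n := by
      rw [hb.symm, hbn n n.2, hb.symm]
    have h2 : π n = n := by
      apply Subtype.ext
      rw [hπ, hn, mul_zero, zero_smul, sub_zero]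
    change b (π m₀) n = φ n
    rw [h1, hm₀, LinearMap.comp_apply, h2]

/-- An indefinite odd unimodular form over `ℤ` is diagonalizable. -/
theorem exists_diagonal_basis : ∀ (n : ℕ) {M : Type} [AddCommGroup M] [Module.Free ℤ M]
    [Module.Finite ℤ M] {b : LinearMap.BilinForm ℤ M} (_ : IsUnimodularForm b)
    (_ : finrank ℤ M = n)
    (_ : n ≤ 1 ∨ ((∃ x, Odd (b x x)) ∧ (∃ x, 0 < b x x) ∧ ∃ x, b x x < 0)),
    ∃ B : Basis (Fin n) ℤ M, (∀ i j, i ≠ j → b (B i) (B j) = 0) ∧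
      ∀ i, b (B i) (B i) = 1 ∨ b (B i) (B i) = -1 := by
  intro n
  induction n with
  | zero =>
    intro M _ _ _ b _ hn _
    exact ⟨Module.finBasisOfFinrankEq ℤ M hn, fun i => i.elim0, fun i => i.elim0⟩
  | succ n ih =>
    intro M _ _ _ b hb hn hor
    rcases Nat.eq_zero_or_pos n with rfl | hn0
    · let B := Module.finBasisOfFinrankEq ℤ M hn
      refine ⟨B, fun i j h => absurd ((Fin.eq_zero i).trans (Fin.eq_zero j).symm) h, fun i => ?_⟩
      have h1 := isUnit_det_gram hb.bij B
      rw [Matrix.det_fin_one, Matrix.of_apply] at h1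
      rw [Fin.eq_zero i]
      exact Int.isUnit_iff.1 h1
    obtain ⟨⟨z, hz⟩, ⟨x, hx⟩, ⟨y, hy⟩⟩ := hor.resolve_left (by omega)
    obtain ⟨u, v, huu, hvv, huv⟩ := exists_isotropic_pair_odd hb hx hy hz
    have hvu : b v u = 0 := by rw [hb.symm, huv]
    have hrank : ∀ e, b e e * b e e = 1 → finrank ℤ (LinearMap.ker (b e)) = n := by
      intro e he
      have h0 : b e ≠ 0 := fun h => by rw [h] at he; simp at he
      have := finrank_ker_add_one h0
      omega
    -- The vector split off must leave an odd indefinite complement once the rank left is at least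
    -- 2. A vector `w` of nonzero square orthogonal to `u` and `v` decides which one goes: the one
    -- kept is odd and has the sign opposite to that of `w`.
    have key : ∃ e, b e e * b e e = 1 ∧ (n ≤ 1 ∨ ((∃ x ∈ LinearMap.ker (b e), Odd (b x x)) ∧
        (∃ x ∈ LinearMap.ker (b e), 0 < b x x) ∧ ∃ x ∈ LinearMap.ker (b e), b x x < 0)) := by
      by_cases hn1 : n ≤ 1
      · exact ⟨u, by rw [huu]; rfl, Or.inl hn1⟩
      -- Otherwise the form vanishes identically on the nonzero complement of `u` and `v`, by
      -- polarization, and a vector there would lie in the radical.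
      have hw : ∃ w, b u w = 0 ∧ b v w = 0 ∧ b w w ≠ 0 := by
        by_contra hcon
        push Not at hcon
        have hpol : ∀ f g, b u f = 0 → b v f = 0 → b u g = 0 → b v g = 0 → b f g = 0 := by
          intro f g huf hvf hug hvg
          have h1 := hcon (f + g) (by rw [map_add, huf, hug, add_zero])
            (by rw [map_add, hvf, hvg, add_zero])
          have h2 := hcon f huf hvf
          have h3 := hcon g hug hvg
          simp only [map_add, LinearMap.add_apply, h2, h3, hb.symm g f] at h1
          omega
        have hur := hrank u (by rw [huu]; rfl)
        let vN : LinearMap.ker (b u) := ⟨v, huv⟩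
        have hv0 : (b.restrict (LinearMap.ker (b u))) vN ≠ 0 := by
          intro h
          have : b v v = 0 := LinearMap.congr_fun h vN
          omega
        have h3 := finrank_ker_add_one hv0
        have hpos : 0 < finrank ℤ (LinearMap.ker ((b.restrict (LinearMap.ker (b u))) vN)) := by
          omega
        have := Module.nontrivial_of_finrank_pos hpos
        obtain ⟨⟨⟨f, hf⟩, hf'⟩, hfne⟩ :=
          exists_ne (0 : LinearMap.ker ((b.restrict (LinearMap.ker (b u))) vN))
        have huf : b u f = 0 := hf
        have hvf : b v f = 0 := hf'
        apply hfne
        apply Subtype.ext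
        apply Subtype.ext
        apply hb.bij.1
        change b f = b 0
        rw [map_zero]
        ext m
        have h4 := hpol f (m - b u m • u + b v m • v) huf hvf
          (by simp [huu, huv]) (by simp [hvv, hvu])
        simpa [hb.symm f u, hb.symm f v, huf, hvf] using h4
      obtain ⟨w, huw, hvw, hw⟩ := hw
      rcases lt_or_gt_of_ne hw with hw | hw
      · exact ⟨v, by rw [hvv]; rfl, Or.inr ⟨⟨u, hvu, by rw [huu]; exact odd_one⟩,
          ⟨u, hvu, by rw [huu]; exact one_pos⟩, ⟨w, hvw, hw⟩⟩⟩
      · exact ⟨u, by rw [huu]; rfl, Or.inr ⟨⟨v, huv, by rw [hvv]; decide⟩,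
          ⟨w, huw, hw⟩, ⟨v, huv, by rw [hvv]; norm_num⟩⟩⟩
    obtain ⟨e, he, hor'⟩ := key
    obtain ⟨B, hB, hB1⟩ := ih (M := LinearMap.ker (b e)) (hb.restrict_ker he) (hrank e he) (by
      refine hor'.imp id ?_
      rintro ⟨⟨x1, h1, h1'⟩, ⟨x2, h2, h2'⟩, ⟨x3, h3, h3'⟩⟩
      exact ⟨⟨⟨x1, h1⟩, h1'⟩, ⟨⟨x2, h2⟩, h2'⟩, ⟨⟨x3, h3⟩, h3'⟩⟩)
    have hee : b e e = 1 ∨ b e e = -1 := Int.isUnit_iff.1 (IsUnit.of_mul_eq_one _ he)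
    let B' := Basis.mkFinCons e B (fun c x hx h => by
        have hx' : b e x = 0 := hx
        have h1 := congrArg (b e) h
        rw [map_add, map_smul, hx', add_zero, map_zero, smul_eq_mul] at h1
        rcases hee with h2 | h2 <;> rw [h2] at h1 <;> omega)
      (fun z => ⟨-(b e e * b e z), by
        rw [LinearMap.mem_ker, map_add, map_smul, smul_eq_mul]
        linear_combination (-(b e z)) * he⟩)
    have hB' : (B' : Fin (n + 1) → M) = Fin.cons e (fun i => (B i : M)) := by
      rw [Basis.coe_mkFinCons]; rfl
    refine ⟨B', ?_, ?_⟩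
    · rw [hB']
      intro i j
      refine Fin.cases (fun hij => ?_) (fun i hij => ?_) i
      · revert hij
        refine Fin.cases (fun h => absurd rfl h) (fun j _ => ?_) j
        simp
      · revert hij
        refine Fin.cases (fun _ => ?_) (fun j hij => ?_) j
        · rw [hb.symm]; simp
        · simpa using hB i j (fun h => hij (by rw [h]))
    · rw [hB']
      intro i
      refine Fin.cases ?_ (fun i => ?_) i
      · simpa using hee
      · simpa using hB1 i

theorem exists_perm_of_sum_eq {ι : Type*} [Fintype ι] {ε ε' : ι → ℤ}
    (h : ∀ i, ε i = 1 ∨ ε i = -1) (h' : ∀ i, ε' i = 1 ∨ ε' i = -1)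
    (hs : ∑ i, ε i = ∑ i, ε' i) : ∃ σ : Equiv.Perm ι, ∀ i, ε i = ε' (σ i) := by
  classical
  have hcard : ∀ δ : ι → ℤ, (∀ i, δ i = 1 ∨ δ i = -1) →
      ∑ i, δ i = 2 * (Fintype.card {i // δ i = 1} : ℤ) - Fintype.card ι := by
    intro δ hδ
    have : ∀ i, δ i = 2 * (if δ i = 1 then 1 else 0) - 1 := by
      intro i
      rcases hδ i with h | h <;> rw [h] <;> norm_num
    rw [Finset.sum_congr rfl fun i _ => this i, Finset.sum_sub_distrib, ← Finset.mul_sum,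
      Fintype.card_subtype]
    simp
  have h1 := hcard ε h
  have h2 := hcard ε' h'
  have h3 : Fintype.card {i // ε i = 1} = Fintype.card {i // ε' i = 1} := by omega
  have h4 : Fintype.card {i // ¬ ε i = 1} = Fintype.card {i // ¬ ε' i = 1} := by
    rw [Fintype.card_subtype_compl, Fintype.card_subtype_compl, h3]
  let e1 := Fintype.equivOfCardEq h3
  let e2 := Fintype.equivOfCardEq h4
  refine ⟨Equiv.subtypeCongr e1 e2, fun i => ?_⟩
  by_cases hi : ε i = 1
  · have : Equiv.subtypeCongr e1 e2 i = e1 ⟨i, hi⟩ := by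
      simp [Equiv.subtypeCongr, Equiv.sumCompl_symm_apply_of_pos, hi]
    rw [this, hi, (e1 ⟨i, hi⟩).2]
  · have : Equiv.subtypeCongr e1 e2 i = e2 ⟨i, hi⟩ := by
      simp [Equiv.subtypeCongr, Equiv.sumCompl_symm_apply_of_neg, hi]
    rw [this, (h i).resolve_left hi, (h' _).resolve_left (e2 ⟨i, hi⟩).2]

/-- Indefinite odd unimodular forms with equal rank and signature are isometric. -/
theorem exists_isometry_of_odd {M' : Type} [AddCommGroup M'] [Module.Free ℤ M]
    [Module.Finite ℤ M] [Module.Free ℤ M'] [Module.Finite ℤ M'] {b : LinearMap.BilinForm ℤ M}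
    {b' : LinearMap.BilinForm ℤ M'} (hb : IsUnimodularForm b) (hb' : IsUnimodularForm b') {n : ℕ}
    (hn : finrank ℤ M = n) (hn' : finrank ℤ M' = n)
    (ho : (∃ x, Odd (b x x)) ∧ (∃ x, 0 < b x x) ∧ ∃ x, b x x < 0)
    (ho' : (∃ x, Odd (b' x x)) ∧ (∃ x, 0 < b' x x) ∧ ∃ x, b' x x < 0)
    {v : Fin n → M} {v' : Fin n → M'} (hv : ∀ i j, i ≠ j → b (v i) (v j) = 0)
    (hv' : ∀ i j, i ≠ j → b' (v' i) (v' j) = 0) (h0 : ∀ i, b (v i) (v i) ≠ 0)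
    (h0' : ∀ i, b' (v' i) (v' i) ≠ 0)
    (hs : ∑ i, ratSign (b (v i) (v i)) = ∑ i, ratSign (b' (v' i) (v' i))) :
    ∃ T : M ≃ₗ[ℤ] M', ∀ x y, b' (T x) (T y) = b x y := by
  obtain ⟨B, hB, hB1⟩ := exists_diagonal_basis n hb hn (Or.inr ho)
  obtain ⟨B', hB', hB1'⟩ := exists_diagonal_basis n hb' hn' (Or.inr ho')
  have hsign : ∀ a : ℤ, a = 1 ∨ a = -1 → a ≠ 0 ∧ ratSign a = a := by
    rintro a (rfl | rfl)
    · exact ⟨one_ne_zero, ratSign_of_pos (by norm_num)⟩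
    · exact ⟨by norm_num, ratSign_of_neg (by norm_num)⟩
  have h1 := isWittFun_ratSign.sum_orthogonal_eq hB hv (fun i => (hsign _ (hB1 i)).1) h0
    (by simp [hn]) (by simp [hn])
  have h2 := isWittFun_ratSign.sum_orthogonal_eq hB' hv' (fun i => (hsign _ (hB1' i)).1) h0'
    (by simp [hn']) (by simp [hn'])
  rw [Finset.sum_congr rfl fun i _ => (hsign _ (hB1 i)).2] at h1
  rw [Finset.sum_congr rfl fun i _ => (hsign _ (hB1' i)).2] at h2
  obtain ⟨σ, hσ⟩ := exists_perm_of_sum_eq hB1 hB1' (h1.trans (hs.trans h2.symm))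
  let T := B.equiv B' σ
  have hT : ∀ i, T (B i) = B' (σ i) := fun i => Basis.equiv_apply _ _ _ _
  refine ⟨T, fun x y => ?_⟩
  have h3 : b'.compl₁₂ (T : M →ₗ[ℤ] M') (T : M →ₗ[ℤ] M') = b := by
    refine B.ext fun i => B.ext fun j => ?_
    rw [LinearMap.compl₁₂_apply]
    change b' (T (B i)) (T (B j)) = _
    rw [hT, hT]
    by_cases hij : i = j
    · subst hij; exact (hσ i).symm
    · rw [hB i j hij, hB' _ _ (fun h => hij (σ.injective h))]
  exact LinearMap.congr_fun (LinearMap.congr_fun h3 x) y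

end Odd

/-! ### Classification of indefinite even unimodular forms. -/

section Even

variable {M : Type} [AddCommGroup M]

/-- The form obtained from `b` by replacing the hyperbolic plane spanned by `x` and `y` by the
plane in which `x` and `y` are orthogonal of squares `1` and `-1`. -/
def oddForm (b : LinearMap.BilinForm ℤ M) (x y : M) : LinearMap.BilinForm ℤ M :=
  b + (LinearMap.BilinForm.linMulLin (b y) (b y) - LinearMap.BilinForm.linMulLin (b x) (b x) -
    LinearMap.BilinForm.linMulLin (b y) (b x) - LinearMap.BilinForm.linMulLin (b x) (b y))

theorem oddForm_apply (b : LinearMap.BilinForm ℤ M) (x y m n : M) :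
    oddForm b x y m n = b m n + (b y m * b y n - b x m * b x n - b y m * b x n - b x m * b y n) :=
  rfl

/-- The similarity, with factor `4`, from the form `b` to the form `oddForm b x y`. -/
def toOddForm (b : LinearMap.BilinForm ℤ M) (x y : M) : M →ₗ[ℤ] M :=
  (2 : ℤ) • LinearMap.id + ((2 : ℤ) • b x - b y).smulRight x + (b y - (4 : ℤ) • b x).smulRight y

/-- For a hyperbolic pair this sends `x` to `x + y` and `y` to `2x - 2y`, which are isotropic for
the new form with product 4, and it doubles the orthogonal complement. -/
theorem toOddForm_apply (b : LinearMap.BilinForm ℤ M) (x y m : M) :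
    toOddForm b x y m = (2 : ℤ) • m + (2 * b x m - b y m) • x + (b y m - 4 * b x m) • y := rfl

/-- A hyperbolic pair for a symmetric form. -/
structure IsHyperbolicPair (b : LinearMap.BilinForm ℤ M) (x y : M) : Prop where
  left : b x x = 0
  right : b y y = 0
  pair : b x y = 1
  pair' : b y x = 1

variable {b : LinearMap.BilinForm ℤ M} {x y : M}

theorem IsUnimodularForm.oddForm (hb : IsUnimodularForm b) (h : IsHyperbolicPair b x y) :
    IsUnimodularForm (oddForm b x y) := by
  -- The new form is `b` composed with `f`, which has the integral inverse `g`.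
  let f : M → M := fun m => m + b y m • y - b x m • x - b y m • x - b x m • y
  let g : M → M := fun m => m - b y m • x - b x m • y + b x m • x - b y m • y
  have hfg : Function.LeftInverse f g := by
    intro m
    simp only [f, g, map_sub, map_add, map_smul, smul_eq_mul, h.left, h.right, h.pair, h.pair']
    module
  have hgf : Function.LeftInverse g f := by
    intro m
    simp only [f, g, map_sub, map_add, map_smul, smul_eq_mul, h.left, h.right, h.pair, h.pair']
    module
  refine ⟨fun m n => ?_, ?_⟩
  · rw [oddForm_apply, oddForm_apply, hb.symm m n]; ring
  · have h1 : (_root_.oddForm b x y : M → M →ₗ[ℤ] ℤ) = b ∘ f := by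
      funext m
      ext n
      simp only [oddForm_apply, Function.comp_apply, f, map_sub, map_add, map_smul,
        LinearMap.sub_apply, LinearMap.add_apply, LinearMap.smul_apply, smul_eq_mul]
      ring
    rw [h1]
    exact hb.bij.comp ⟨hgf.injective, hfg.surjective⟩

theorem oddForm_toOddForm_left (h : IsHyperbolicPair b x y) (m z : M) :
    oddForm b x y (toOddForm b x y m) z =
      2 * b m z + b y m * b y z + (2 * b x m - 3 * b y m) * b x z := by
  simp only [oddForm_apply, toOddForm_apply, map_add, map_smul, LinearMap.add_apply,
    LinearMap.smul_apply, smul_eq_mul, h.left, h.right, h.pair, h.pair']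
  ring

theorem oddForm_toOddForm (hb : IsUnimodularForm b) (h : IsHyperbolicPair b x y) (m n : M) :
    oddForm b x y (toOddForm b x y m) (toOddForm b x y n) = 4 * b m n := by
  rw [oddForm_toOddForm_left h]
  simp only [toOddForm_apply, map_add, map_smul, smul_eq_mul, h.left, h.right, h.pair, h.pair',
    hb.symm m x, hb.symm m y]
  ring

theorem toOddForm_injective (hb : IsUnimodularForm b) (h : IsHyperbolicPair b x y) :
    Function.Injective (toOddForm b x y) := by
  refine (injective_iff_map_eq_zero _).2 fun m hm => hb.bij.1 ?_
  rw [map_zero]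
  ext n
  have h1 := oddForm_toOddForm hb h m n
  rw [hm, map_zero, LinearMap.zero_apply] at h1
  rw [LinearMap.zero_apply]
  omega

theorem even_oddForm_sub (h2 : ∀ m, Even (b m m)) (m : M) :
    Even (oddForm b x y m m - (b y m + b x m)) := by
  obtain ⟨k, hk⟩ := h2 m
  have h3 := Int.even_mul_pred_self (b y m)
  have h4 := Int.even_mul_succ_self (b x m)
  have : oddForm b x y m m - (b y m + b x m) = 2 * (k - b y m * b x m) + b y m * (b y m - 1) -
      b x m * (b x m + 1) := by
    rw [oddForm_apply, hk]; ring
  rw [this]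
  exact ((even_two_mul _).add h3).sub h4

/-- Modulo 2, pairing with a vector in the image of `toOddForm` is a multiple of the functional `z ↦
z²`. This property is preserved by isometries of the odd forms, and that is how the image can be
followed through `T`. -/
theorem even_oddForm_toOddForm_sub (h : IsHyperbolicPair b x y)
    (h2 : ∀ m, Even (b m m)) (m z : M) :
    Even (oddForm b x y (toOddForm b x y m) z - b y m * oddForm b x y z z) := by
  have h3 := (even_oddForm_sub (x := x) (y := y) h2 z).mul_left (b y m)
  rw [oddForm_toOddForm_left h]
  have : 2 * b m z + b y m * b y z + (2 * b x m - 3 * b y m) * b x z -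
      b y m * oddForm b x y z z = 2 * (b m z + (b x m - 2 * b y m) * b x z) -
      b y m * (oddForm b x y z z - (b y z + b x z)) := by ring
  rw [this]
  exact (even_two_mul _).sub h3

section Transfer

variable {M' : Type} [AddCommGroup M'] {b' : LinearMap.BilinForm ℤ M'} {x' y' : M'}

/-- The congruence of `even_oddForm_toOddForm_sub` is transported by `T`. Tested on the complement
of the plane, where squares are even, it makes the complementary component divisible by 2; tested on
`x'` and `y'`, it gives the parities of the two coordinates. -/
theorem exists_component_eq_two_smul (hb' : IsUnimodularForm b')
    (h : IsHyperbolicPair b x y) (h' : IsHyperbolicPair b' x' y') (h2 : ∀ m, Even (b m m))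
    (h2' : ∀ m, Even (b' m m)) (T : M ≃ₗ[ℤ] M')
    (hT : ∀ m n, oddForm b' x' y' (T m) (T n) = oddForm b x y m n) (m : M) :
    (∃ e, T (toOddForm b x y m) = b' y' (T (toOddForm b x y m)) • x' +
      b' x' (T (toOddForm b x y m)) • y' + (2 : ℤ) • e) ∧
      Even (b' y' (T (toOddForm b x y m)) - b y m) ∧
      Even (b' x' (T (toOddForm b x y m)) - b y m) := by
  have key : ∀ z', Even (oddForm b' x' y' (T (toOddForm b x y m)) z' -
      b y m * oddForm b' x' y' z' z') := by
    intro z'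
    obtain ⟨z, rfl⟩ := T.surjective z'
    rw [hT, hT]
    exact even_oddForm_toOddForm_sub h h2 m z
  set w := T (toOddForm b x y m)
  refine ⟨?_, ?_, ?_⟩
  · obtain ⟨e, he⟩ := exists_eq_smul_of_dvd hb'.bij 2 (m := w - b' y' w • x' - b' x' w • y') (by
      intro z
      have h3 := key (z - b' y' z • x' - b' x' z • y')
      obtain ⟨k, hk⟩ := h2' (z - b' y' z • x' - b' x' z • y')
      have hy : b' y' (z - b' y' z • x' - b' x' z • y') = 0 := by
        simp [h'.right, h'.pair']
      have hx : b' x' (z - b' y' z • x' - b' x' z • y') = 0 := by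
        simp [h'.left, h'.pair]
      have e1 : oddForm b' x' y' w (z - b' y' z • x' - b' x' z • y') =
          b' (w - b' y' w • x' - b' x' w • y') z := by
        rw [oddForm_apply, hy, hx]
        simp only [map_sub, map_smul, LinearMap.sub_apply, LinearMap.smul_apply, smul_eq_mul,
          hb'.symm w x', hb'.symm w y']
        ring
      have e2 : oddForm b' x' y' (z - b' y' z • x' - b' x' z • y')
          (z - b' y' z • x' - b' x' z • y') = 2 * k := by
        rw [oddForm_apply, hy, hx, hk]; ring
      rw [e1, e2] at h3
      obtain ⟨l, hl⟩ := h3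
      exact ⟨l + b y m * k, by linear_combination hl⟩)
    exact ⟨e, by rw [← he]; module⟩
  · have h3 := key x'
    have e1 : oddForm b' x' y' w x' = b' y' w := by
      rw [oddForm_apply, h'.left, h'.pair', hb'.symm w x']; ring
    have e2 : oddForm b' x' y' x' x' = 1 := by
      rw [oddForm_apply, h'.left, h'.pair']; ring
    rwa [e1, e2, mul_one] at h3
  · have h3 := key y'
    have e1 : oddForm b' x' y' w y' = -b' x' w := by
      rw [oddForm_apply, h'.right, h'.pair, hb'.symm w y']; ring
    have e2 : oddForm b' x' y' y' y' = -1 := by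
      rw [oddForm_apply, h'.right, h'.pair]; ring
    rw [e1, e2] at h3
    have := h3.neg
    rwa [show -(-b' x' w - b y m * -1) = b' x' w - b y m by ring] at this

theorem mem_range_toOddForm (h : IsHyperbolicPair b x y) {w e : M}
    (he : w = b y w • x + b x w • y + (2 : ℤ) • e) (hd : 4 ∣ b y w - b x w) :
    w ∈ LinearMap.range (toOddForm b x y) := by
  obtain ⟨t, ht⟩ := hd
  have h1 := congrArg (b y) he
  have h2 := congrArg (b x) he
  simp only [map_add, map_smul, smul_eq_mul, h.left, h.right, h.pair, h.pair', mul_one, mul_zero,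
    add_zero, zero_add] at h1 h2
  have hye : b y e = 0 := by omega
  have hxe : b x e = 0 := by omega
  refine ⟨(b x w + 2 * t) • x + t • y + e, ?_⟩
  rw [toOddForm_apply]
  simp only [map_add, map_smul, smul_eq_mul, h.left, h.right, h.pair, h.pair', mul_one, mul_zero,
    add_zero, zero_add, hye, hxe]
  conv_rhs => rw [he, show b y w = b x w + 4 * t by omega]
  module

theorem oddForm_eq_of_component (hb : IsUnimodularForm b) (h : IsHyperbolicPair b x y)
    {w e w' e' : M}
    (he : w = b y w • x + b x w • y + (2 : ℤ) • e)
    (he' : w' = b y w' • x + b x w' • y + (2 : ℤ) • e') :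
    oddForm b x y w w' = b y w * b y w' - b x w * b x w' + 4 * b e e' := by
  have h1 := congrArg (b y) he
  have h2 := congrArg (b x) he
  simp only [map_add, map_smul, smul_eq_mul, h.left, h.right, h.pair, h.pair', mul_one, mul_zero,
    add_zero, zero_add] at h1 h2
  have hye : b y e = 0 := by omega
  have hxe : b x e = 0 := by omega
  have h1' := congrArg (b y) he'
  have h2' := congrArg (b x) he'
  simp only [map_add, map_smul, smul_eq_mul, h.left, h.right, h.pair, h.pair', mul_one, mul_zero,
    add_zero, zero_add] at h1' h2'
  have hye' : b y e' = 0 := by omega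
  have hxe' : b x e' = 0 := by omega
  have h5 : b w w' = b y w * b x w' + b x w * b y w' + 4 * b e e' := by
    generalize b y w = p at *
    generalize b x w = q at *
    generalize b y w' = r at *
    generalize b x w' = s at *
    rw [he, he']
    simp only [map_add, map_smul, LinearMap.add_apply, LinearMap.smul_apply, smul_eq_mul, h.left,
      h.right, h.pair, h.pair', hb.symm e x, hb.symm e y, hye, hxe, hye', hxe']
    ring
  rw [oddForm_apply, h5]; ring

/-- The image of `toOddForm b' x' y'` is cut out by a congruence modulo 4 between the two plane
coordinates. It is assumed for the image of `x`, whose coordinates `r`, `s` are odd; since all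
products with that image are divisible by 4, `4 ∣ r * (p - q)` follows for any other vector, and `r`
can be removed. -/
theorem exists_map_of_dvd (hb : IsUnimodularForm b) (hb' : IsUnimodularForm b')
    (h : IsHyperbolicPair b x y) (h' : IsHyperbolicPair b' x' y') (h2 : ∀ m, Even (b m m))
    (h2' : ∀ m, Even (b' m m)) (T : M ≃ₗ[ℤ] M')
    (hT : ∀ m n, oddForm b' x' y' (T m) (T n) = oddForm b x y m n)
    (hd : 4 ∣ b' y' (T (toOddForm b x y x)) - b' x' (T (toOddForm b x y x))) :
    ∃ S : M →ₗ[ℤ] M', ∀ m n, b' (S m) (S n) = b m n := by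
  have hcomp := exists_component_eq_two_smul hb' h h' h2 h2' T hT
  have hmem : ∀ m, T (toOddForm b x y m) ∈ LinearMap.range (toOddForm b' x' y') := by
    intro m
    obtain ⟨⟨e, he⟩, -, -⟩ := hcomp m
    obtain ⟨⟨e₁, he₁⟩, hodd, -⟩ := hcomp x
    refine mem_range_toOddForm h' he ?_
    have h3 := oddForm_eq_of_component hb' h' he he₁
    rw [hT, oddForm_toOddForm hb h] at h3
    rw [h.pair'] at hodd
    generalize b' y' (T (toOddForm b x y m)) = p at *
    generalize b' x' (T (toOddForm b x y m)) = q at *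
    generalize b' y' (T (toOddForm b x y x)) = r at *
    generalize b' x' (T (toOddForm b x y x)) = s at *
    have h4 : (4 : ℤ) ∣ r * (p - q) := by
      obtain ⟨t, ht⟩ := hd
      exact ⟨b m x - b' e e₁ - q * t, by linear_combination (-1) * h3 - q * ht⟩
    have h5 : IsCoprime (4 : ℤ) r := by
      have h6 : IsCoprime (2 : ℤ) r := by
        obtain ⟨k, hk⟩ := hodd
        exact ⟨-k, 1, by linear_combination hk⟩
      exact (show (4 : ℤ) = 2 * 2 by norm_num) ▸ h6.mul_left h6
    exact h5.dvd_of_dvd_mul_left h4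
  let J := LinearEquiv.ofInjective (toOddForm b' x' y') (toOddForm_injective hb' h')
  let S : M →ₗ[ℤ] M' := J.symm.toLinearMap ∘ₗ
    LinearMap.codRestrict _ (T.toLinearMap ∘ₗ toOddForm b x y) hmem
  have hS : ∀ m, toOddForm b' x' y' (S m) = T (toOddForm b x y m) := by
    intro m
    exact congrArg Subtype.val (J.apply_symm_apply ⟨T (toOddForm b x y m), hmem m⟩)
  refine ⟨S, fun m n => ?_⟩
  have h3 := oddForm_toOddForm hb' h' (S m) (S n)
  rw [hS, hS, hT, oddForm_toOddForm hb h] at h3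
  omega

theorem exists_map_of_oddForm (hb : IsUnimodularForm b) (hb' : IsUnimodularForm b')
    (h : IsHyperbolicPair b x y) (h' : IsHyperbolicPair b' x' y') (h2 : ∀ m, Even (b m m))
    (h2' : ∀ m, Even (b' m m)) (T : M ≃ₗ[ℤ] M')
    (hT : ∀ m n, oddForm b' x' y' (T m) (T n) = oddForm b x y m n) :
    ∃ S : M →ₗ[ℤ] M', ∀ m n, b' (S m) (S n) = b m n := by
  obtain ⟨-, h3, h4⟩ := exists_component_eq_two_smul hb' h h' h2 h2' T hT x
  rw [h.pair'] at h3 h4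
  by_cases hd : 4 ∣ b' y' (T (toOddForm b x y x)) - b' x' (T (toOddForm b x y x))
  · exact exists_map_of_dvd hb hb' h h' h2 h2' T hT hd
  -- Two odd coordinates are congruent modulo 4 either to each other or to each other's negative.
  -- The reflection negating the `y'` coordinate is an isometry of the odd form and exchanges the
  -- two cases.
  let R₀ : M' →ₗ[ℤ] M' := LinearMap.id - (b' x').smulRight ((2 : ℤ) • y')
  have hR₀ : ∀ m, R₀ m = m - b' x' m • (2 : ℤ) • y' := fun m => rfl
  have hinv : ∀ m, R₀ (R₀ m) = m := by
    intro m
    simp only [hR₀, map_sub, map_smul, smul_eq_mul, h'.pair]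
    module
  let R : M' ≃ₗ[ℤ] M' := LinearEquiv.ofLinearMap R₀ R₀ (LinearMap.ext hinv) (LinearMap.ext hinv)
  have hR : ∀ m, R m = m - b' x' m • (2 : ℤ) • y' := fun m => rfl
  refine exists_map_of_dvd hb hb' h h' h2 h2' (T.trans R) (fun m n => ?_) ?_
  · rw [← hT m n, LinearEquiv.trans_apply, LinearEquiv.trans_apply]
    generalize T m = m'
    generalize T n = n'
    simp only [hR, oddForm_apply, map_sub, map_smul, LinearMap.sub_apply, LinearMap.smul_apply,
      smul_eq_mul, h'.right, h'.pair, hb'.symm m' y']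
    ring
  · rw [LinearEquiv.trans_apply]
    generalize T (toOddForm b x y x) = w at *
    simp only [hR, map_sub, map_smul, smul_eq_mul, h'.right, h'.pair]
    obtain ⟨k, hk⟩ := h3
    obtain ⟨l, hl⟩ := h4
    omega

end Transfer

theorem exists_hyperbolicPair [Module.Free ℤ M] [Module.Finite ℤ M] (hb : IsUnimodularForm b)
    (h2 : ∀ m, Even (b m m)) {x y : M} (hx : 0 < b x x) (hy : b y y < 0) :
    ∃ x y, IsHyperbolicPair b x y := by
  obtain ⟨x, y, hxx, hxy⟩ := exists_isotropic_pair hb hx hy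
  obtain ⟨k, hk⟩ := h2 y
  -- Evenness of `y²` allows it to be cancelled by half as many copies of `x`.
  refine ⟨x, y - k • x, hxx, ?_, ?_, ?_⟩
  · simp only [map_sub, map_smul, LinearMap.sub_apply, LinearMap.smul_apply, smul_eq_mul, hxx, hxy,
      hb.symm y x, hk]
    ring
  · simp [hxx, hxy]
  · simp [hxx, hxy, hb.symm y x]

/-- Indefinite even unimodular forms with equal rank and signature are isometric. -/
theorem exists_map_of_even {M' : Type} [AddCommGroup M'] [Module.Free ℤ M]
    [Module.Finite ℤ M] [Module.Free ℤ M'] [Module.Finite ℤ M'] {b : LinearMap.BilinForm ℤ M}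
    {b' : LinearMap.BilinForm ℤ M'} (hb : IsUnimodularForm b) (hb' : IsUnimodularForm b') {n : ℕ}
    (hn : finrank ℤ M = n) (hn' : finrank ℤ M' = n)
    (h2 : ∀ m, Even (b m m)) (h2' : ∀ m, Even (b' m m))
    (hi : (∃ x, 0 < b x x) ∧ ∃ x, b x x < 0) (hi' : (∃ x, 0 < b' x x) ∧ ∃ x, b' x x < 0)
    {v : Fin n → M} {v' : Fin n → M'} (hv : ∀ i j, i ≠ j → b (v i) (v j) = 0)
    (hv' : ∀ i j, i ≠ j → b' (v' i) (v' j) = 0) (h0 : ∀ i, b (v i) (v i) ≠ 0)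
    (h0' : ∀ i, b' (v' i) (v' i) ≠ 0)
    (hs : ∑ i, ratSign (b (v i) (v i)) = ∑ i, ratSign (b' (v' i) (v' i))) :
    ∃ S : M →ₗ[ℤ] M', ∀ m n, b' (S m) (S n) = b m n := by
  obtain ⟨⟨p, hp⟩, ⟨q, hq⟩⟩ := hi
  obtain ⟨⟨p', hp'⟩, ⟨q', hq'⟩⟩ := hi'
  obtain ⟨x, y, h⟩ := exists_hyperbolicPair hb h2 hp hq
  obtain ⟨x', y', h'⟩ := exists_hyperbolicPair hb' h2' hp' hq'
  have hodd : ∀ {M : Type} [AddCommGroup M] {b : LinearMap.BilinForm ℤ M} {x y : M},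
      IsHyperbolicPair b x y → (∃ z, Odd (oddForm b x y z z)) ∧ (∃ z, 0 < oddForm b x y z z) ∧
        ∃ z, oddForm b x y z z < 0 := by
    intro M _ b x y h
    have e1 : oddForm b x y x x = 1 := by rw [oddForm_apply, h.left, h.pair']; ring
    have e2 : oddForm b x y y y = -1 := by rw [oddForm_apply, h.right, h.pair]; ring
    exact ⟨⟨x, by rw [e1]; exact odd_one⟩, ⟨x, by rw [e1]; exact one_pos⟩,
      ⟨y, by rw [e2]; norm_num⟩⟩
  have hsign : ∀ a : ℤ, ratSign ((4 * a : ℤ) : ℚ) = ratSign (a : ℚ) := by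
    intro a
    rw [← isWittFun_ratSign.mul_sq (a : ℚ) 2 two_ne_zero]
    congr 1
    push_cast; ring
  -- The images of the families under `toOddForm` are orthogonal with values multiplied by 4, so the
  -- odd forms inherit the equality of signatures.
  obtain ⟨T, hT⟩ := exists_isometry_of_odd (hb.oddForm h) (hb'.oddForm h') hn hn' (hodd h) (hodd h')
    (v := fun i => toOddForm b x y (v i)) (v' := fun i => toOddForm b' x' y' (v' i))
    (fun i j hij => by rw [oddForm_toOddForm hb h, hv i j hij, mul_zero])
    (fun i j hij => by rw [oddForm_toOddForm hb' h', hv' i j hij, mul_zero])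
    (fun i => by rw [oddForm_toOddForm hb h]; exact mul_ne_zero four_ne_zero (h0 i))
    (fun i => by rw [oddForm_toOddForm hb' h']; exact mul_ne_zero four_ne_zero (h0' i))
    (by simpa only [oddForm_toOddForm hb h, oddForm_toOddForm hb' h', hsign] using hs)
  exact exists_map_of_oddForm hb hb' h h' h2 h2' T hT

end Even

/-! ### Primitive recursive integer arithmetic and search. -/

section Primrec

variable {α : Type*} [Primcodable α]

namespace Primrec

theorem nat_pow : Primrec₂ ((· ^ ·) : ℕ → ℕ → ℕ) := Primrec₂.unpaired'.1 Nat.Primrec.pow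

/-- Nonnegative integers have even codes and negative ones odd codes; integer operations are thereby
reduced to operations on positive and negative parts. -/
theorem int_ofNat_even (a : ℕ) : Denumerable.ofNat ℤ (2 * a) = a :=
  (Denumerable.ofNat_of_decode (b := (a : ℤ)) (by
    rw [show 2 * a = Encodable.encode (a : ℤ) from rfl, Encodable.encodek]))

theorem int_ofNat_odd (a : ℕ) : Denumerable.ofNat ℤ (2 * a + 1) = Int.negSucc a :=
  (Denumerable.ofNat_of_decode (b := Int.negSucc a) (by
    rw [show 2 * a + 1 = Encodable.encode (Int.negSucc a) from rfl, Encodable.encodek]))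

theorem int_toNat : Primrec Int.toNat := by
  have h := (Primrec.ite (Primrec.eq.comp (nat_mod.comp Primrec.encode (const 2)) (const 0))
    (nat_div.comp Primrec.encode (const 2)) (const 0) :
      Primrec fun z : ℤ => if Encodable.encode z % 2 = 0 then Encodable.encode z / 2 else 0)
  refine h.of_eq fun z => ?_
  rcases z with a | a
  · rw [show Encodable.encode (Int.ofNat a) = 2 * a from rfl]; simp
  · rw [show Encodable.encode (Int.negSucc a) = 2 * a + 1 from rfl, if_neg (by omega)]; rfl

theorem int_neg_toNat : Primrec fun z : ℤ => (-z).toNat := by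
  have h := (Primrec.ite (Primrec.eq.comp (nat_mod.comp Primrec.encode (const 2)) (const 0))
    (const 0) (succ.comp (nat_div.comp Primrec.encode (const 2))) :
      Primrec fun z : ℤ => if Encodable.encode z % 2 = 0 then 0 else
        (Encodable.encode z / 2).succ)
  refine h.of_eq fun z => ?_
  rcases z with a | a
  · rw [show Encodable.encode (Int.ofNat a) = 2 * a from rfl]; simp
  · rw [show Encodable.encode (Int.negSucc a) = 2 * a + 1 from rfl, if_neg (by omega)]
    rw [Int.neg_negSucc]
    simp only [Int.toNat_natCast]
    omega

theorem nat_sub_int : Primrec₂ fun a b : ℕ => (a : ℤ) - b := by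
  have h := ((Primrec.ofNat ℤ).comp (Primrec.ite (nat_le.comp snd fst)
    (nat_mul.comp (const 2) (nat_sub.comp fst snd))
    (succ.comp (nat_mul.comp (const 2) (nat_sub.comp (nat_sub.comp snd fst) (const 1)))) :
      Primrec fun p : ℕ × ℕ => if p.2 ≤ p.1 then 2 * (p.1 - p.2)
        else (2 * (p.2 - p.1 - 1)).succ))
  refine h.of_eq fun p => ?_
  dsimp only
  split_ifs with hle
  · rw [int_ofNat_even]; omega
  · rw [Nat.succ_eq_add_one, int_ofNat_odd]; omega

variable {f g : α → ℤ}

theorem int_sub_of_toNat {a b : α → ℕ} (ha : Primrec a) (hb : Primrec b) :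
    Primrec fun x => (a x : ℤ) - b x :=
  nat_sub_int.comp ha hb

theorem int_natCast {a : α → ℕ} (ha : Primrec a) : Primrec fun x => (a x : ℤ) :=
  (int_sub_of_toNat ha (const 0)).of_eq fun x => by simp

theorem int_add (hf : Primrec f) (hg : Primrec g) : Primrec fun x => f x + g x :=
  (int_sub_of_toNat (nat_add.comp (int_toNat.comp hf) (int_toNat.comp hg))
    (nat_add.comp (int_neg_toNat.comp hf) (int_neg_toNat.comp hg))).of_eq fun x => by omega

theorem int_mul (hf : Primrec f) (hg : Primrec g) : Primrec fun x => f x * g x :=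
  (int_sub_of_toNat
    (nat_add.comp (nat_mul.comp (int_toNat.comp hf) (int_toNat.comp hg))
      (nat_mul.comp (int_neg_toNat.comp hf) (int_neg_toNat.comp hg)))
    (nat_add.comp (nat_mul.comp (int_toNat.comp hf) (int_neg_toNat.comp hg))
      (nat_mul.comp (int_neg_toNat.comp hf) (int_toNat.comp hg)))).of_eq fun x => by
    have h1 : f x = (f x).toNat - (-f x).toNat := by omega
    have h2 : g x = (g x).toNat - (-g x).toNat := by omega
    conv_rhs => rw [h1, h2]
    push_cast; ring

theorem int_natAbs (hf : Primrec f) : Primrec fun x => (f x).natAbs :=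
  (nat_add.comp (int_toNat.comp hf) (int_neg_toNat.comp hf)).of_eq fun x => by omega

theorem int_sign (hf : Primrec f) : Primrec fun x => (f x).sign :=
  (Primrec.ite (nat_lt.comp (const 0) (int_toNat.comp hf)) (const 1)
    (Primrec.ite (nat_lt.comp (const 0) (int_neg_toNat.comp hf)) (const (-1)) (const 0))).of_eq
    fun x => by
      split_ifs with h1 h2
      · rw [Int.sign_eq_one_of_pos (by omega)]
      · rw [Int.sign_eq_neg_one_of_neg (by omega)]
      · rw [show f x = 0 by omega]; rfl

theorem int_sum {a : α → ℕ} {g : α → ℕ → ℤ} (ha : Primrec a) (hg : Primrec₂ g) :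
    Primrec fun x => ∑ k ∈ Finset.range (a x), g x k := by
  have h : Primrec₂ fun (x : α) (p : ℕ × ℤ) => p.2 + g x p.1 :=
    int_add (snd.comp snd) (hg.comp fst (fst.comp snd))
  refine (Primrec.nat_rec' ha (const 0) h).of_eq fun x => ?_
  induction a x with
  | zero => rfl
  | succ n ih => rw [Finset.sum_range_succ, ← ih]

end Primrec

theorem PrimrecPred.forall_lt' {a : α → ℕ} {p : α → ℕ → Prop} (ha : Primrec a)
    (hp : PrimrecRel p) : PrimrecPred fun x => ∀ k < a x, p x k :=
  (hp.swap.forall_mem_list.comp (Primrec.list_range.comp ha) Primrec.id).of_eq fun x => by simp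

theorem PrimrecPred.exists_lt' {a : α → ℕ} {p : α → ℕ → Prop} (ha : Primrec a)
    (hp : PrimrecRel p) : PrimrecPred fun x => ∃ k < a x, p x k :=
  (hp.swap.exists_mem_list.comp (Primrec.list_range.comp ha) Primrec.id).of_eq fun x => by simp

/-- Unbounded search is computable. -/
theorem computable_find {p : α → ℕ → Prop} [∀ x, DecidablePred (p x)] (hp : PrimrecRel p)
    (h : ∀ x, ∃ k, p x k) : Computable fun x => Nat.find (h x) := by
  have h1 : Partrec₂ fun (x : α) (k : ℕ) => (Part.some (decide (p x k)) : Part Bool) :=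
    (PrimrecPred.decide hp).to_comp.partrec
  refine (Partrec.rfind h1).of_eq fun x => ?_
  refine Part.eq_some_iff.2 (Nat.mem_rfind.2 ⟨?_, fun {m} hm => ?_⟩)
  · simpa using Nat.find_spec (h x)
  · simpa using Nat.find_min (h x) hm

end Primrec

/-! ### The algorithm. -/

section Algorithm

/-- The entries of the symmetric matrix whose upper triangle is read off from a list of rows. -/
def symmEntry (L : List (List ℤ)) (i j : ℕ) : ℤ := (L.getD (min i j) []).getD (max i j) 0

/-- The entries of the `n × n` matrix coded by the pair of a bound `N` on the entries and a number
whose digits in base `2 * N + 1` are the entries, shifted by `N`. -/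
def codeEntry (c n i j : ℕ) : ℤ :=
  ((c.unpair.2 / (2 * c.unpair.1 + 1) ^ (j + n * i) % (2 * c.unpair.1 + 1) : ℕ) : ℤ) - c.unpair.1

/-- The entries of `Pᵀ * V * P` for the matrix `P` coded by `c`. -/
def gramEntry (L : List (List ℤ)) (c n i j : ℕ) : ℤ :=
  ∑ k ∈ Finset.range n, ∑ l ∈ Finset.range n,
    codeEntry c n k i * symmEntry L k l * codeEntry c n l j

/-- The entries of `V * P` for the matrix `P` coded by `c`. -/
def mulEntry (L : List (List ℤ)) (c n i j : ℕ) : ℤ :=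
  ∑ k ∈ Finset.range n, symmEntry L i k * codeEntry c n k j

/-- The code `c` diagonalizes the form over `ℚ`, or it witnesses the degeneracy of the form. -/
def IsReduction (L : List (List ℤ)) (c : ℕ) : Prop :=
  (∀ i < L.length, ∀ j < L.length, (i = j ↔ gramEntry L c L.length i j ≠ 0)) ∨
    ((∀ i < L.length, ∀ j < L.length, mulEntry L c L.length i j = 0) ∧
      ∃ i < L.length, ∃ j < L.length, codeEntry c L.length i j ≠ 0)

/-- The signature, as computed from a diagonalization. -/
def codeSign (L : List (List ℤ)) (c : ℕ) : ℤ :=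
  ∑ i ∈ Finset.range L.length, (gramEntry L c L.length i i).sign

def HasEvenDiagonal (L : List (List ℤ)) : Prop :=
  ∀ i < L.length, (symmEntry L i i).natAbs % 2 = 0

/-- The matrix coded by `c` carries the form of `L'` to the form of `L`. -/
def IsCongruence (L L' : List (List ℤ)) (c : ℕ) : Prop :=
  ∀ i < L.length, ∀ j < L.length, gramEntry L' c L.length i j = symmEntry L i j

/-- A bound for the entries of a matrix carrying the form of `L'` to the form of `L`, when the
forms are definite and `c` diagonalizes the form of `L'`. -/
def congruenceBound (L : List (List ℤ)) (c : ℕ) : ℕ :=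
  ((∑ i ∈ Finset.range L.length, ∑ j ∈ Finset.range L.length,
      ((codeEntry c L.length i j).natAbs : ℤ)) *
    ∑ i ∈ Finset.range L.length, ∑ j ∈ Finset.range L.length,
      ((symmEntry L i j).natAbs : ℤ)).natAbs

/-- The congruence criterion: equality of rank, signature and parity for indefinite forms, and a
bounded search for definite ones. -/
def CongruenceCriterion (L L' : List (List ℤ)) (c c' : ℕ) : Prop :=
  L.length = L'.length ∧ codeSign L c = codeSign L' c' ∧
    (((codeSign L c).natAbs ≠ L.length ∧ (HasEvenDiagonal L ↔ HasEvenDiagonal L')) ∨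
      ((codeSign L c).natAbs = L.length ∧
        ∃ k < (2 * congruenceBound L c' + 1) ^ (L.length * L.length),
          IsCongruence L L' (Nat.pair (congruenceBound L c') k)))

end Algorithm

/-! ### Computability of the algorithm. -/

section Primrec

variable {α : Type*} [Primcodable α] {L L' : α → List (List ℤ)} {c c' n i j : α → ℕ}

open Primrec

theorem primrec_symmEntry (hL : Primrec L) (hi : Primrec i) (hj : Primrec j) :
    Primrec fun x => symmEntry (L x) (i x) (j x) :=
  (list_getD 0).comp ((list_getD []).comp hL (nat_min.comp hi hj)) (nat_max.comp hi hj)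

theorem primrec_codeEntry (hc : Primrec c) (hn : Primrec n) (hi : Primrec i) (hj : Primrec j) :
    Primrec fun x => codeEntry (c x) (n x) (i x) (j x) := by
  have hN : Primrec fun x => (c x).unpair.1 := fst.comp (unpair.comp hc)
  have hb : Primrec fun x => 2 * (c x).unpair.1 + 1 :=
    succ.comp (nat_mul.comp (const 2) hN)
  exact nat_sub_int.comp (nat_mod.comp (nat_div.comp (snd.comp (unpair.comp hc))
    (nat_pow.comp hb (nat_add.comp hj (nat_mul.comp hn hi)))) hb) hN

theorem primrec_gramEntry (hL : Primrec L) (hc : Primrec c) (hn : Primrec n) (hi : Primrec i)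
    (hj : Primrec j) : Primrec fun x => gramEntry (L x) (c x) (n x) (i x) (j x) :=
  int_sum hn <| int_sum (hn.comp fst) <|
    int_mul (int_mul
      (primrec_codeEntry (hc.comp (fst.comp fst)) (hn.comp (fst.comp fst)) (snd.comp fst)
        (hi.comp (fst.comp fst)))
      (primrec_symmEntry (hL.comp (fst.comp fst)) (snd.comp fst) snd))
      (primrec_codeEntry (hc.comp (fst.comp fst)) (hn.comp (fst.comp fst)) snd
        (hj.comp (fst.comp fst)))

theorem primrec_mulEntry (hL : Primrec L) (hc : Primrec c) (hn : Primrec n) (hi : Primrec i)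
    (hj : Primrec j) : Primrec fun x => mulEntry (L x) (c x) (n x) (i x) (j x) :=
  int_sum hn <| int_mul
    (primrec_symmEntry (hL.comp fst) (hi.comp fst) snd)
    (primrec_codeEntry (hc.comp fst) (hn.comp fst) snd (hj.comp fst))

theorem primrecPred_iff {p q : α → Prop} (hp : PrimrecPred p) (hq : PrimrecPred q) :
    PrimrecPred fun x => (p x ↔ q x) :=
  ((hp.and hq).or (hp.not.and hq.not)).of_eq fun x => by tauto

theorem primrecPred_forall_lt_lt {p : α → ℕ → ℕ → Prop} (hn : Primrec n)
    (hp : PrimrecPred fun q : (α × ℕ) × ℕ => p q.1.1 q.1.2 q.2) :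
    PrimrecPred fun x => ∀ i < n x, ∀ j < n x, p x i j := by
  have h : PrimrecPred fun q : α × ℕ => ∀ j < n q.1, p q.1 q.2 j :=
    PrimrecPred.forall_lt' (p := fun q : α × ℕ => p q.1 q.2) (hn.comp fst) hp
  exact PrimrecPred.forall_lt' (p := fun x i => ∀ j < n x, p x i j) hn h

theorem primrecPred_exists_lt_lt {p : α → ℕ → ℕ → Prop} (hn : Primrec n)
    (hp : PrimrecPred fun q : (α × ℕ) × ℕ => p q.1.1 q.1.2 q.2) :
    PrimrecPred fun x => ∃ i < n x, ∃ j < n x, p x i j := by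
  have h : PrimrecPred fun q : α × ℕ => ∃ j < n q.1, p q.1 q.2 j :=
    PrimrecPred.exists_lt' (p := fun q : α × ℕ => p q.1 q.2) (hn.comp fst) hp
  exact PrimrecPred.exists_lt' (p := fun x i => ∃ j < n x, p x i j) hn h

theorem primrecPred_gramEntry (hL : Primrec L) (hc : Primrec c) (hn : Primrec n) :
    PrimrecPred fun x => ∀ i < n x, ∀ j < n x, (i = j ↔ gramEntry (L x) (c x) (n x) i j ≠ 0) := by
  refine primrecPred_forall_lt_lt
    (p := fun x i j => i = j ↔ gramEntry (L x) (c x) (n x) i j ≠ 0) hn ?_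
  have hf : Primrec fun q : (α × ℕ) × ℕ => q.1.1 := fst.comp fst
  have hi : Primrec fun q : (α × ℕ) × ℕ => q.1.2 := snd.comp fst
  exact primrecPred_iff (Primrec.eq.comp hi snd)
    (Primrec.eq.comp (primrec_gramEntry (hL.comp hf) (hc.comp hf) (hn.comp hf) hi snd)
      (const 0)).not

theorem primrecPred_mulEntry (hL : Primrec L) (hc : Primrec c) (hn : Primrec n) :
    PrimrecPred fun x => ∀ i < n x, ∀ j < n x, mulEntry (L x) (c x) (n x) i j = 0 := by
  refine primrecPred_forall_lt_lt (p := fun x i j => mulEntry (L x) (c x) (n x) i j = 0) hn ?_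
  have hf : Primrec fun q : (α × ℕ) × ℕ => q.1.1 := fst.comp fst
  have hi : Primrec fun q : (α × ℕ) × ℕ => q.1.2 := snd.comp fst
  exact Primrec.eq.comp (primrec_mulEntry (hL.comp hf) (hc.comp hf) (hn.comp hf) hi snd) (const 0)

theorem primrecPred_codeEntry (hc : Primrec c) (hn : Primrec n) :
    PrimrecPred fun x => ∃ i < n x, ∃ j < n x, codeEntry (c x) (n x) i j ≠ 0 := by
  refine primrecPred_exists_lt_lt (p := fun x i j => codeEntry (c x) (n x) i j ≠ 0) hn ?_
  have hf : Primrec fun q : (α × ℕ) × ℕ => q.1.1 := fst.comp fst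
  have hi : Primrec fun q : (α × ℕ) × ℕ => q.1.2 := snd.comp fst
  exact (Primrec.eq.comp (primrec_codeEntry (hc.comp hf) (hn.comp hf) hi snd) (const 0)).not

theorem primrecRel_isReduction : PrimrecRel IsReduction := by
  have hn : Primrec fun p : List (List ℤ) × ℕ => p.1.length := list_length.comp fst
  exact (primrecPred_gramEntry fst snd hn).or
    ((primrecPred_mulEntry fst snd hn).and (primrecPred_codeEntry snd hn))

theorem primrec_codeSign (hL : Primrec L) (hc : Primrec c) :
    Primrec fun x => codeSign (L x) (c x) :=
  int_sum (list_length.comp hL) <| int_sign <|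
    primrec_gramEntry (hL.comp fst) (hc.comp fst) (list_length.comp (hL.comp fst)) snd snd

theorem primrecPred_hasEvenDiagonal (hL : Primrec L) :
    PrimrecPred fun x => HasEvenDiagonal (L x) :=
  PrimrecPred.forall_lt' (list_length.comp hL) <|
    Primrec.eq.comp (nat_mod.comp (int_natAbs (primrec_symmEntry (hL.comp fst) snd snd)) (const 2))
      (const 0)

theorem primrecPred_isCongruence (hL : Primrec L) (hL' : Primrec L') (hc : Primrec c) :
    PrimrecPred fun x => IsCongruence (L x) (L' x) (c x) := by
  have hn := list_length.comp hL
  refine primrecPred_forall_lt_lt (p := fun x i j =>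
    gramEntry (L' x) (c x) (L x).length i j = symmEntry (L x) i j) hn ?_
  have hf : Primrec fun q : (α × ℕ) × ℕ => q.1.1 := fst.comp fst
  have hi : Primrec fun q : (α × ℕ) × ℕ => q.1.2 := snd.comp fst
  exact Primrec.eq.comp (primrec_gramEntry (hL'.comp hf) (hc.comp hf) (hn.comp hf) hi snd)
    (primrec_symmEntry (hL.comp hf) hi snd)

theorem primrec_congruenceBound (hL : Primrec L) (hc : Primrec c) :
    Primrec fun x => congruenceBound (L x) (c x) :=
  int_natAbs <| int_mul
    (int_sum (list_length.comp hL) <| int_sum (list_length.comp (hL.comp fst)) <| int_natCast <|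
      int_natAbs <| primrec_codeEntry (hc.comp (fst.comp fst))
        (list_length.comp (hL.comp (fst.comp fst))) (snd.comp fst) snd)
    (int_sum (list_length.comp hL) <| int_sum (list_length.comp (hL.comp fst)) <| int_natCast <|
      int_natAbs <| primrec_symmEntry (hL.comp (fst.comp fst)) (snd.comp fst) snd)

theorem primrecPred_congruenceCriterion (hL : Primrec L) (hL' : Primrec L') (hc : Primrec c)
    (hc' : Primrec c') :
    PrimrecPred fun x => CongruenceCriterion (L x) (L' x) (c x) (c' x) := by
  have hn := list_length.comp hL
  have hs := primrec_codeSign hL hc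
  have hN := primrec_congruenceBound hL hc'
  have hd := Primrec.eq.comp (int_natAbs hs) hn
  have h := PrimrecPred.exists_lt' (nat_pow.comp (succ.comp (nat_mul.comp (const 2) hN))
    (nat_mul.comp hn hn))
      (p := fun x k => IsCongruence (L x) (L' x) (Nat.pair (congruenceBound (L x) (c' x)) k))
      (primrecPred_isCongruence (hL.comp fst) (hL'.comp fst)
      (Primrec₂.natPair.comp (hN.comp fst) snd))
  exact (Primrec.eq.comp hn (list_length.comp hL')).and
    ((Primrec.eq.comp hs (primrec_codeSign hL' hc')).and
      ((hd.not.and (primrecPred_iff (primrecPred_hasEvenDiagonal hL)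
        (primrecPred_hasEvenDiagonal hL'))).or (hd.and h)))

open Classical in
-- Only the search for reductions is unbounded; once they are given, the criterion is primitive
-- recursive.
theorem computable₂_congruenceCriterion (h : ∀ L, ∃ c, IsReduction L c) :
    Computable₂ fun L L' : List (List ℤ) =>
      decide (CongruenceCriterion L L' (Nat.find (h L)) (Nat.find (h L'))) := by
  have h1 := computable_find primrecRel_isReduction h
  have h2 : Primrec fun p : (List (List ℤ) × List (List ℤ)) × ℕ × ℕ =>
      decide (CongruenceCriterion p.1.1 p.1.2 p.2.1 p.2.2) :=
    PrimrecPred.decide (primrecPred_congruenceCriterion (fst.comp fst) (snd.comp fst)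
      (fst.comp snd) (snd.comp snd))
  exact h2.to_comp.comp (Computable.pair (Computable.pair Computable.fst Computable.snd)
    (Computable.pair (h1.comp Computable.fst) (h1.comp Computable.snd)))

end Primrec

/-! ### From lattices to matrices; bounds for definite forms. -/

section Matrix

open Module Matrix

variable {n : ℕ} {V V' : Matrix (Fin n) (Fin n) ℤ}

theorem IsUnimodular.isUnit_det (hV : IsUnimodular V) : IsUnit V.det := Int.isUnit_iff.2 hV

theorem isUnimodularForm_toBilin' (hs : V.IsSymm) (hV : IsUnimodular V) :
    IsUnimodularForm (toBilin' V) where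
  symm x y := by
    rw [toBilin'_apply', toBilin'_apply', dotProduct_mulVec, dotProduct_comm, ← mulVec_transpose,
      hs.eq]
  bij := by
    constructor
    · refine (injective_iff_map_eq_zero (toBilin' V)).2 fun x hx => ?_
      have h1 : x ᵥ* V = 0 := by
        refine dotProduct_eq_zero _ fun y => ?_
        rw [← dotProduct_mulVec, ← toBilin'_apply']
        exact LinearMap.congr_fun hx y
      simpa [vecMul_vecMul, mul_nonsing_inv V hV.isUnit_det] using congrArg (· ᵥ* V⁻¹) h1
    · intro f
      refine ⟨(fun j => f (Pi.single j 1)) ᵥ* V⁻¹, LinearMap.ext fun y => ?_⟩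
      rw [toBilin'_apply', dotProduct_mulVec, vecMul_vecMul, nonsing_inv_mul V hV.isUnit_det,
        vecMul_one]
      conv_rhs => rw [pi_eq_sum_univ' y, map_sum]
      refine Finset.sum_congr rfl fun j _ => ?_
      rw [map_smul, smul_eq_mul, mul_comm]

theorem isCongruent_iff :
    IsCongruent V V' ↔ ∃ P : Matrix (Fin n) (Fin n) ℤ, IsUnimodular P ∧ V = Pᵀ * V' * P :=
  ⟨fun ⟨_, P, hP⟩ => ⟨P, hP⟩, fun ⟨P, hP⟩ => ⟨rfl, P, hP⟩⟩

theorem toBilin'_transpose_mul_mul (P : Matrix (Fin n) (Fin n) ℤ) (x y : Fin n → ℤ) :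
    toBilin' (Pᵀ * V' * P) x y = toBilin' V' (P *ᵥ x) (P *ᵥ y) := by
  rw [← toBilin'_comp]
  simp

theorem isUnimodular_of_eq {P : Matrix (Fin n) (Fin n) ℤ} (hV : IsUnimodular V)
    (h : V = Pᵀ * V' * P) : IsUnimodular P := by
  have h1 := hV.isUnit_det
  rw [h, det_mul] at h1
  exact Int.isUnit_iff.1 (isUnit_of_mul_isUnit_right h1)

/-- Invertibility of the map is automatic: the determinant of its matrix divides the unit `V.det`.
-/
theorem isCongruent_of_map (hV : IsUnimodular V) {S : (Fin n → ℤ) →ₗ[ℤ] (Fin n → ℤ)}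
    (hS : ∀ x y, toBilin' V' (S x) (S y) = toBilin' V x y) : IsCongruent V V' := by
  have h : V = (LinearMap.toMatrix' S)ᵀ * V' * LinearMap.toMatrix' S := by
    refine toBilin'.injective (LinearMap.ext₂ fun x y => ?_)
    rw [toBilin'_transpose_mul_mul, ← hS]
    simp [LinearMap.toMatrix'_mulVec]
  exact isCongruent_iff.2 ⟨_, isUnimodular_of_eq hV h, h⟩

theorem even_toBilin' (hs : V.IsSymm) (he : ∀ i, Even (V i i)) (x : Fin n → ℤ) :
    Even (toBilin' V x x) := by
  have h1 : ∀ y z, (Even (toBilin' V y y)) → Even (toBilin' V z z) →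
      Even (toBilin' V (y + z) (y + z)) := by
    intro y z hy hz
    have h2 : toBilin' V z y = toBilin' V y z := by
      rw [toBilin'_apply', toBilin'_apply', dotProduct_mulVec, dotProduct_comm,
        ← mulVec_transpose, hs.eq]
    have h3 : toBilin' V (y + z) (y + z) =
        toBilin' V y y + toBilin' V z z + 2 * toBilin' V y z := by
      simp only [map_add, LinearMap.add_apply, h2]; ring
    rw [h3]
    exact (hy.add hz).add (even_two_mul _)
  rw [pi_eq_sum_univ' x]
  refine Finset.sum_induction _ (fun y => Even (toBilin' V y y)) (fun y z hy hz => h1 y z hy hz)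
    (by simp) fun i _ => ?_
  simp only [map_smul, LinearMap.smul_apply, toBilin'_single, smul_eq_mul]
  exact ((he i).mul_left _).mul_left _

theorem even_diag_iff (hs : V.IsSymm) :
    (∀ i, Even (V i i)) ↔ ∀ x, Even (toBilin' V x x) :=
  ⟨even_toBilin' hs, fun h i => by simpa using h (Pi.single i 1)⟩

theorem IsCongruent.even_diag_iff (hs : V.IsSymm) (hs' : V'.IsSymm) (h : IsCongruent V V') :
    (∀ i, Even (V i i)) ↔ ∀ i, Even (V' i i) := by
  obtain ⟨P, hP, rfl⟩ := isCongruent_iff.1 h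
  rw [_root_.even_diag_iff hs, _root_.even_diag_iff hs']
  refine ⟨fun h x => ?_, fun h x => by rw [toBilin'_transpose_mul_mul]; exact h _⟩
  have := h (P⁻¹ *ᵥ x)
  rwa [toBilin'_transpose_mul_mul, mulVec_mulVec, mul_nonsing_inv P hP.isUnit_det,
    one_mulVec] at this

theorem ratSign_intCast (z : ℤ) : ratSign z = z.sign := by
  rcases lt_trichotomy z 0 with h | rfl | h
  · rw [ratSign_of_neg (by exact_mod_cast h), Int.sign_eq_neg_one_of_neg h]
  · simp [ratSign_zero]
  · rw [ratSign_of_pos (by exact_mod_cast h), Int.sign_eq_one_of_pos h]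

variable {v v' : Fin n → Fin n → ℤ}

theorem IsCongruent.sum_sign_eq (h : IsCongruent V V')
    (hv : ∀ i j, i ≠ j → toBilin' V (v i) (v j) = 0)
    (hv' : ∀ i j, i ≠ j → toBilin' V' (v' i) (v' j) = 0)
    (h0 : ∀ i, toBilin' V (v i) (v i) ≠ 0) (h0' : ∀ i, toBilin' V' (v' i) (v' i) ≠ 0) :
    ∑ i, (toBilin' V (v i) (v i)).sign = ∑ i, (toBilin' V' (v' i) (v' i)).sign := by
  obtain ⟨P, -, rfl⟩ := isCongruent_iff.1 h
  simp only [toBilin'_transpose_mul_mul] at hv h0 ⊢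
  simpa only [ratSign_intCast] using isWittFun_ratSign.sum_orthogonal_eq
    (v := fun i => P *ᵥ v i) hv hv' h0 h0' (by simp) (by simp)

theorem exists_pos_and_neg {d : Fin n → ℤ} (h0 : ∀ i, d i ≠ 0)
    (hs : (∑ i, (d i).sign).natAbs ≠ n) : (∃ i, 0 < d i) ∧ ∃ i, d i < 0 := by
  constructor <;> by_contra hcon <;> push Not at hcon <;> apply hs
  · rw [Finset.sum_congr rfl fun i _ =>
      Int.sign_eq_neg_one_of_neg (lt_of_le_of_ne (hcon i) (h0 i))]
    simp
  · rw [Finset.sum_congr rfl fun i _ =>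
      Int.sign_eq_one_of_pos (lt_of_le_of_ne (hcon i) (h0 i).symm)]
    simp

theorem isCongruent_of_indefinite (hs : V.IsSymm) (hV : IsUnimodular V) (hs' : V'.IsSymm)
    (hV' : IsUnimodular V') (hv : ∀ i j, i ≠ j → toBilin' V (v i) (v j) = 0)
    (hv' : ∀ i j, i ≠ j → toBilin' V' (v' i) (v' j) = 0)
    (h0 : ∀ i, toBilin' V (v i) (v i) ≠ 0) (h0' : ∀ i, toBilin' V' (v' i) (v' i) ≠ 0)
    (h : ∑ i, (toBilin' V (v i) (v i)).sign = ∑ i, (toBilin' V' (v' i) (v' i)).sign)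
    (hn : (∑ i, (toBilin' V (v i) (v i)).sign).natAbs ≠ n)
    (he : (∀ i, Even (V i i)) ↔ ∀ i, Even (V' i i)) : IsCongruent V V' := by
  have hb := isUnimodularForm_toBilin' hs hV
  have hb' := isUnimodularForm_toBilin' hs' hV'
  have hi : (∃ x, 0 < toBilin' V x x) ∧ ∃ x, toBilin' V x x < 0 := by
    obtain ⟨⟨i, hi⟩, j, hj⟩ := exists_pos_and_neg h0 hn
    exact ⟨⟨_, hi⟩, _, hj⟩
  have hi' : (∃ x, 0 < toBilin' V' x x) ∧ ∃ x, toBilin' V' x x < 0 := by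
    obtain ⟨⟨i, hi⟩, j, hj⟩ := exists_pos_and_neg h0' (h ▸ hn)
    exact ⟨⟨_, hi⟩, _, hj⟩
  simp only [← ratSign_intCast] at h
  by_cases hev : ∀ i, Even (V i i)
  · obtain ⟨S, hS⟩ := exists_map_of_even hb hb' (by simp) (by simp) (even_toBilin' hs hev)
      (even_toBilin' hs' (he.1 hev)) hi hi' hv hv' h0 h0' h
    exact isCongruent_of_map hV hS
  · have hev' := hev
    rw [he] at hev'
    push Not at hev hev'
    obtain ⟨i, hi2⟩ := hev
    obtain ⟨i', hi2'⟩ := hev'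
    obtain ⟨T, hT⟩ := exists_isometry_of_odd hb hb' (by simp) (by simp)
      ⟨⟨Pi.single i 1, by simpa using hi2⟩, hi⟩ ⟨⟨Pi.single i' 1, by simpa using hi2'⟩, hi'⟩
      hv hv' h0 h0' h
    exact isCongruent_of_map hV (S := T.toLinearMap) hT

theorem forall_pos_or_forall_neg {d : Fin n → ℤ} (h0 : ∀ i, d i ≠ 0)
    (hs : (∑ i, (d i).sign).natAbs = n) : (∀ i, 0 < d i) ∨ ∀ i, d i < 0 := by
  by_contra! hcon
  obtain ⟨⟨i, hi⟩, j, hj⟩ := hcon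
  have hi' := Int.sign_eq_neg_one_of_neg (lt_of_le_of_ne hi (h0 i))
  have hj' := Int.sign_eq_one_of_pos (lt_of_le_of_ne hj (h0 j).symm)
  have hb : ∀ k, -1 ≤ (d k).sign ∧ (d k).sign ≤ 1 := fun k => by
    rcases Int.sign_trichotomy (d k) with h | h | h <;> omega
  have h1 : ∑ k, (d k).sign < ∑ _k : Fin n, 1 :=
    Finset.sum_lt_sum (fun k _ => (hb k).2) ⟨i, Finset.mem_univ _, by omega⟩
  have h2 : ∑ _k : Fin n, -1 < ∑ k, (d k).sign :=
    Finset.sum_lt_sum (fun k _ => (hb k).1) ⟨j, Finset.mem_univ _, by omega⟩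
  simp at h1 h2
  omega

/-- Write `k x = ∑ c i • v i`. In a definite form the terms of `k² q(x)` do not cancel and the
diagonal values are nonzero integers, so `c i ^ 2 ≤ k² |q(x)|`. As `|q(x)|` is an integer, it is at
most its square, whence `|c i| ≤ |k| |q(x)|`; the factor `|k|` then drops out. -/
theorem abs_apply_le_of_definite (hv : ∀ i j, i ≠ j → toBilin' V (v i) (v j) = 0)
    (h0 : ∀ i, toBilin' V (v i) (v i) ≠ 0)
    (hd : (∑ i, (toBilin' V (v i) (v i)).sign).natAbs = n) (x : Fin n → ℤ) (l : Fin n) :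
    |x l| ≤ |toBilin' V x x| * ∑ i, |v i l| := by
  obtain ⟨k, c, hk, hkc⟩ := exists_smul_eq_sum (b := toBilin' V) (by simp) hv h0 x
  have h1 : k * k * toBilin' V x x = ∑ i, toBilin' V (v i) (v i) * c i * c i := by
    rw [← gram_sum hv, ← hkc, map_smul, map_smul, LinearMap.smul_apply]; simp [mul_assoc]
  have h2 : |k * k * toBilin' V x x| = ∑ i, |toBilin' V (v i) (v i)| * c i * c i := by
    rw [h1]
    rcases forall_pos_or_forall_neg h0 hd with h | h
    · rw [abs_of_nonneg (Finset.sum_nonneg fun i _ => by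
        rw [mul_assoc]; exact mul_nonneg (h i).le (mul_self_nonneg _))]
      exact Finset.sum_congr rfl fun i _ => by rw [abs_of_pos (h i)]
    · rw [abs_of_nonpos (Finset.sum_nonpos fun i _ => by
        rw [mul_assoc]; exact mul_nonpos_of_nonpos_of_nonneg (h i).le (mul_self_nonneg _)),
        ← Finset.sum_neg_distrib]
      exact Finset.sum_congr rfl fun i _ => by rw [abs_of_neg (h i)]; ring
  have h3 : ∀ i, |c i| ≤ |k| * |toBilin' V x x| := by
    intro i
    have h4 : |c i| * |c i| ≤ |k * k * toBilin' V x x| := by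
      rw [h2, abs_mul_abs_self]
      refine le_trans ?_ (Finset.single_le_sum (f := fun i =>
        |toBilin' V (v i) (v i)| * c i * c i) (fun j _ => ?_) (Finset.mem_univ i))
      · have := Int.one_le_abs (h0 i)
        nlinarith [mul_self_nonneg (c i)]
      · rw [mul_assoc]; exact mul_nonneg (abs_nonneg _) (mul_self_nonneg _)
    rw [abs_mul, abs_mul] at h4
    rcases eq_or_ne (toBilin' V x x) 0 with h5 | h5
    · rw [h5] at h4 ⊢
      simp only [abs_zero, mul_zero] at h4 ⊢
      nlinarith [abs_nonneg (c i)]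
    · have := Int.one_le_abs h5
      refine abs_le_of_sq_le_sq' ?_ (by positivity) |>.2
      nlinarith [mul_nonneg (abs_nonneg k) (abs_nonneg k), mul_nonneg (mul_nonneg (abs_nonneg k)
        (abs_nonneg k)) (abs_nonneg (toBilin' V x x))]
  have h4 : |k| * |x l| ≤ |k| * (|toBilin' V x x| * ∑ i, |v i l|) := by
    have h5 : k * x l = ∑ i, c i * v i l := by simpa using congrFun hkc l
    rw [← abs_mul, h5, ← mul_assoc, Finset.mul_sum]
    refine (Finset.abs_sum_le_sum_abs _ _).trans (Finset.sum_le_sum fun i _ => ?_)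
    rw [abs_mul]
    exact mul_le_mul_of_nonneg_right (h3 i) (abs_nonneg _)
  exact le_of_mul_le_mul_left h4 (abs_pos.2 hk)

end Matrix

/-! ### Correctness of the algorithm. -/

section Correctness

open Module Matrix

variable {n : ℕ} {L L' : List (List ℤ)} {V V' : Matrix (Fin n) (Fin n) ℤ}

/-- The columns of the matrix coded by `c`. -/
def codeColumn (c n : ℕ) (j : Fin n) : Fin n → ℤ := fun i => codeEntry c n i j

theorem gramEntry_eq (hL : ∀ i j : Fin n, symmEntry L i j = V i j) (c : ℕ) (i j : Fin n) :
    gramEntry L c n i j = toBilin' V (codeColumn c n i) (codeColumn c n j) := by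
  simp_rw [gramEntry, toBilin'_apply, Finset.sum_range, hL]
  rfl

theorem mulEntry_eq (hL : ∀ i j : Fin n, symmEntry L i j = V i j) (c : ℕ) (i j : Fin n) :
    mulEntry L c n i j = (V *ᵥ codeColumn c n j) i := by
  simp_rw [mulEntry, Finset.sum_range, hL]
  rfl

theorem exists_code {N : ℕ} {P : Matrix (Fin n) (Fin n) ℤ} (hP : ∀ i j, |P i j| ≤ N) :
    ∃ k < (2 * N + 1) ^ (n * n), ∀ i j : Fin n, codeEntry (Nat.pair N k) n i j = P i j := by
  have hb : ∀ i j, (P i j + N).toNat < 2 * N + 1 := fun i j => by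
    have := abs_le.1 (hP i j); omega
  let g : Fin (n * n) → Fin (2 * N + 1) := fun q =>
    ⟨_, hb (finProdFinEquiv.symm q).1 (finProdFinEquiv.symm q).2⟩
  refine ⟨finFunctionFinEquiv g, (finFunctionFinEquiv g).2, fun i j => ?_⟩
  -- `finProdFinEquiv` numbers the pair `(i, j)` by `j + n * i`, which is the digit position used in
  -- `codeEntry`.
  have h := finFunctionFinEquiv_symm_apply_val (finFunctionFinEquiv g) (finProdFinEquiv (i, j))
  rw [Equiv.symm_apply_apply, finProdFinEquiv_apply_val] at h
  have hg : (g (finProdFinEquiv (i, j)) : ℕ) = (P i j + N).toNat := by simp [g]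
  rw [codeEntry, Nat.unpair_pair]
  dsimp only at h ⊢
  rw [← h, hg]
  have := abs_le.1 (hP i j); omega

theorem exists_code_eq (P : Matrix (Fin n) (Fin n) ℤ) :
    ∃ c, ∀ i j : Fin n, codeEntry c n i j = P i j := by
  obtain ⟨k, -, hk⟩ := exists_code (N := ∑ i, ∑ j, (P i j).natAbs) (P := P) fun i j => by
    rw [Int.abs_eq_natAbs, Nat.cast_le]
    exact (Finset.single_le_sum (f := fun j => (P i j).natAbs) (fun _ _ => Nat.zero_le _)
      (Finset.mem_univ j)).trans (Finset.single_le_sum (f := fun i => ∑ j, (P i j).natAbs)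
        (fun _ _ => Nat.zero_le _) (Finset.mem_univ i))
  exact ⟨_, hk⟩

theorem isReduction_iff (hn : L.length = n) (hL : ∀ i j : Fin n, symmEntry L i j = V i j) (c : ℕ) :
    IsReduction L c ↔
      (∀ i j, i = j ↔ toBilin' V (codeColumn c n i) (codeColumn c n j) ≠ 0) ∨
        (∀ j, V *ᵥ codeColumn c n j = 0) ∧ ∃ j, codeColumn c n j ≠ 0 := by
  subst hn
  refine or_congr ⟨fun h i j => ?_, fun h i hi j hj => ?_⟩ 
    (and_congr ⟨fun h j => ?_, fun h i hi j hj => ?_⟩ ⟨?_, ?_⟩)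
  · rw [← gramEntry_eq hL, ← h i i.2 j j.2, Fin.ext_iff]
  · have := h ⟨i, hi⟩ ⟨j, hj⟩
    rwa [← gramEntry_eq hL, Fin.ext_iff] at this
  · funext i
    rw [← mulEntry_eq hL]
    exact h i i.2 j j.2
  · have := mulEntry_eq hL c ⟨i, hi⟩ ⟨j, hj⟩
    rwa [h] at this
  · rintro ⟨i, hi, j, hj, h⟩
    exact ⟨⟨j, hj⟩, fun h0 => h (congrFun h0 ⟨i, hi⟩)⟩
  · rintro ⟨j, h⟩
    obtain ⟨i, hi⟩ := Function.ne_iff.1 h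
    exact ⟨i, i.2, j, j.2, hi⟩

theorem symmEntry_comm (L : List (List ℤ)) (i j : ℕ) : symmEntry L i j = symmEntry L j i := by
  rw [symmEntry, symmEntry, min_comm, max_comm]

theorem exists_isReduction (L : List (List ℤ)) : ∃ c, IsReduction L c := by
  let V : Matrix (Fin L.length) (Fin L.length) ℤ := of fun i j => symmEntry L i j
  -- Reading only the upper triangle makes the matrix symmetric for an arbitrary list of rows.
  have hs : V.IsSymm := IsSymm.ext fun i j => symmEntry_comm _ _ _
  have hb : ∀ x y, toBilin' V x y = toBilin' V y x := fun x y => by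
    rw [toBilin'_apply', toBilin'_apply', dotProduct_mulVec, dotProduct_comm, ← mulVec_transpose,
      hs.eq]
  simp only [isReduction_iff (V := V) rfl fun _ _ => rfl]
  -- For `p = 0` divisibility means vanishing, so this condition is nondegeneracy, and its failure
  -- provides a nonzero vector of the radical, used for every column of the code.
  by_cases h : ∀ m, (∀ m', (0 : ℤ) ∣ toBilin' V m m') → ∃ m₀ : Fin L.length → ℤ, m = (0 : ℤ) • m₀
  · obtain ⟨v, hv, h0⟩ := exists_orthogonal_family (p := 0) (by simp) (by simp) L.length
      (toBilin' V) hb (by simp) h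
    obtain ⟨c, hc⟩ := exists_code_eq (of v)ᵀ
    have hcv : codeColumn c L.length = v := by funext j i; exact hc i j
    refine ⟨c, Or.inl fun i j => ?_⟩
    rw [hcv]
    exact ⟨fun h1 => h1 ▸ fun h2 => h0 i (by simp [h2]),
      fun h1 => not_not.1 fun h2 => h1 (hv i j h2)⟩
  · push Not at h
    obtain ⟨m, hm, hm0⟩ := h
    obtain ⟨c, hc⟩ := exists_code_eq (of fun i _ => m i)
    have hcm : ∀ j, codeColumn c L.length j = m := fun j => by funext i; exact hc i j
    have hne : m ≠ 0 := by simpa using hm0 0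
    refine ⟨c, Or.inr ⟨fun j => ?_, ?_⟩⟩
    · rw [hcm]
      refine dotProduct_eq_zero _ fun y => ?_
      rw [dotProduct_comm, ← toBilin'_apply', hb]
      exact zero_dvd_iff.1 (hm y)
    · obtain ⟨i, -⟩ := Function.ne_iff.1 hne
      exact ⟨i, by rwa [hcm]⟩

/-- An invertible matrix has no nonzero vector in its kernel, so the alternative of a degenerate
form is excluded. -/
theorem IsReduction.of_isUnimodular {c : ℕ} (h : IsReduction L c) (hn : L.length = n)
    (hL : ∀ i j : Fin n, symmEntry L i j = V i j) (hV : IsUnimodular V) :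
    (∀ i j, i ≠ j → toBilin' V (codeColumn c n i) (codeColumn c n j) = 0) ∧
      ∀ i, toBilin' V (codeColumn c n i) (codeColumn c n i) ≠ 0 := by
  rcases (isReduction_iff hn hL c).1 h with h | ⟨h, j, hj⟩
  · exact ⟨fun i j hij => not_not.1 (mt (h i j).2 hij), fun i => (h i i).1 rfl⟩
  · have h1 := congrArg (fun x => V⁻¹ *ᵥ x) (h j)
    simp only [mulVec_mulVec, nonsing_inv_mul V hV.isUnit_det, one_mulVec, mulVec_zero] at h1
    exact absurd h1 hj

theorem hasEvenDiagonal_iff (hn : L.length = n) (hL : ∀ i j : Fin n, symmEntry L i j = V i j) :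
    HasEvenDiagonal L ↔ ∀ i, Even (V i i) := by
  subst hn
  have h : ∀ i : Fin L.length, (symmEntry L i i).natAbs % 2 = 0 ↔ Even (V i i) := fun i => by
    rw [hL, ← Nat.even_iff, Int.natAbs_even]
  exact ⟨fun hi i => (h i).1 (hi i i.2), fun hi i hi' => (h ⟨i, hi'⟩).2 (hi _)⟩

theorem codeSign_eq (hn : L.length = n) (hL : ∀ i j : Fin n, symmEntry L i j = V i j) (c : ℕ) :
    codeSign L c = ∑ i, (toBilin' V (codeColumn c n i) (codeColumn c n i)).sign := by
  subst hn
  simp_rw [codeSign, Finset.sum_range, gramEntry_eq hL]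

theorem isCongruence_iff (hn : L.length = n) (hL : ∀ i j : Fin n, symmEntry L i j = V i j)
    (hL' : ∀ i j : Fin n, symmEntry L' i j = V' i j) (c : ℕ) :
    IsCongruence L L' c ↔
      V = (of fun i j : Fin n => codeEntry c n i j)ᵀ * V' *
        of fun i j : Fin n => codeEntry c n i j := by
  subst hn
  have h : ∀ i j : Fin L.length, gramEntry L' c L.length i j =
      ((of fun i j : Fin L.length => codeEntry c L.length i j)ᵀ * V' *
        of fun i j : Fin L.length => codeEntry c L.length i j) i j := fun i j => by
    have h1 := toBilin'_single (R₁ := ℤ) ((of fun i j : Fin L.length => codeEntry c L.length i j)ᵀ *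
      V' * of fun i j : Fin L.length => codeEntry c L.length i j) i j
    rw [← h1, toBilin'_transpose_mul_mul, gramEntry_eq hL']
    simp only [mulVec_single_one]
    rfl
  rw [← Matrix.ext_iff]
  simp only [← h, ← hL]
  exact ⟨fun hc i j => (hc i i.2 j j.2).symm, fun hc i hi j hj => (hc ⟨i, hi⟩ ⟨j, hj⟩).symm⟩

/-- Column `j` of `P` is a vector on which the form of `V'` takes the value `V j j`, so a bound on
vectors of given value bounds the entries of `P`. -/
theorem abs_apply_le_congruenceBound {c : ℕ} (hn : L.length = n)
    (hL : ∀ i j : Fin n, symmEntry L i j = V i j) {P : Matrix (Fin n) (Fin n) ℤ}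
    (hP : V = Pᵀ * V' * P)
    (h : ∀ x l, |x l| ≤ |toBilin' V' x x| * ∑ i, |codeColumn c n i l|) (i j : Fin n) :
    |P i j| ≤ congruenceBound L c := by
  subst hn
  have h1 := h (P *ᵥ Pi.single j 1) i
  rw [← toBilin'_transpose_mul_mul, ← hP, toBilin'_single, mulVec_single_one, mul_comm] at h1
  refine h1.trans ?_
  have h2 : ∀ f : Fin L.length → Fin L.length → ℤ, ∀ i j, |f i j| ≤ ∑ i, ∑ j, |f i j| :=
    fun f i j => (Finset.single_le_sum (f := fun j => |f i j|) (fun _ _ => abs_nonneg _)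
      (Finset.mem_univ j)).trans (Finset.single_le_sum (f := fun i => ∑ j, |f i j|)
        (fun _ _ => Finset.sum_nonneg fun _ _ => abs_nonneg _) (Finset.mem_univ i))
  have h3 : ∑ k, |codeColumn c L.length k i| ≤
      ∑ i : Fin L.length, ∑ k : Fin L.length, |codeEntry c L.length i k| :=
    Finset.single_le_sum (f := fun i : Fin L.length =>
      ∑ k : Fin L.length, |codeEntry c L.length i k|)
      (fun _ _ => Finset.sum_nonneg fun _ _ => abs_nonneg _) (Finset.mem_univ i)
  rw [congruenceBound]
  simp_rw [Finset.sum_range, ← Int.abs_eq_natAbs, hL]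
  exact le_trans (mul_le_mul h3 (h2 V j j) (abs_nonneg _) (Finset.sum_nonneg fun _ _ =>
    Finset.sum_nonneg fun _ _ => abs_nonneg _)) (le_abs_self _)

theorem congruenceCriterion_iff {c c' : ℕ} (hc : IsReduction L c) (hc' : IsReduction L' c')
    (hn : L.length = n) (hn' : L'.length = n) (hL : ∀ i j : Fin n, symmEntry L i j = V i j)
    (hL' : ∀ i j : Fin n, symmEntry L' i j = V' i j) (hs : V.IsSymm) (hV : IsUnimodular V)
    (hs' : V'.IsSymm) (hV' : IsUnimodular V') :
    CongruenceCriterion L L' c c' ↔ IsCongruent V V' := by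
  obtain ⟨hv, h0⟩ := hc.of_isUnimodular hn hL hV
  obtain ⟨hv', h0'⟩ := hc'.of_isUnimodular hn' hL' hV'
  rw [CongruenceCriterion, codeSign_eq hn hL, codeSign_eq hn' hL', hasEvenDiagonal_iff hn hL,
    hasEvenDiagonal_iff hn' hL', hn, hn']
  constructor
  · rintro ⟨-, h1, ⟨h2, h3⟩ | ⟨-, k, -, h3⟩⟩
    · exact isCongruent_of_indefinite hs hV hs' hV' hv hv' h0 h0' h1 h2 h3
    · rw [isCongruence_iff hn hL hL'] at h3
      exact isCongruent_iff.2 ⟨_, isUnimodular_of_eq hV h3, h3⟩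
  · intro h
    have h1 := h.sum_sign_eq hv hv' h0 h0'
    refine ⟨rfl, h1, ?_⟩
    by_cases h2 : (∑ i, (toBilin' V (codeColumn c n i) (codeColumn c n i)).sign).natAbs = n
    · obtain ⟨P, -, hP⟩ := isCongruent_iff.1 h
      obtain ⟨k, hk, hkP⟩ := exists_code (abs_apply_le_congruenceBound hn hL hP
        (abs_apply_le_of_definite hv' h0' (h1 ▸ h2)))
      refine Or.inr ⟨h2, k, hk, (isCongruence_iff hn hL hL' _).2 ?_⟩
      rw [show (of fun i j : Fin n => codeEntry (Nat.pair (congruenceBound L c') k) n i j) = P from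
        Matrix.ext hkP]
      exact hP
    · exact Or.inl ⟨h2, h.even_diag_iff hs hs'⟩

theorem length_matrixRows (V : Matrix (Fin n) (Fin n) ℤ) : (matrixRows V).length = n := by
  simp [matrixRows]

theorem symmEntry_matrixRows (hs : V.IsSymm) (i j : Fin n) :
    symmEntry (matrixRows V) i j = V i j := by
  have h : ∀ i j : Fin n, ((matrixRows V).getD i []).getD j 0 = V i j := fun i j => by
    simp [matrixRows, List.getD_eq_getElem?_getD]
  rw [symmEntry]
  rcases le_total i j with hij | hij
  · rw [min_eq_left (Fin.le_def.1 hij), max_eq_right (Fin.le_def.1 hij), h]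
  · rw [min_eq_right (Fin.le_def.1 hij), max_eq_left (Fin.le_def.1 hij), h, hs.apply]

end Correctness

/-- Congruence over `ℤ` of integral symmetric unimodular matrices is algorithmically decidable:
a single total computable function, fed with the rows of two such matrices of arbitrary sizes,
outputs whether they are congruent. -/
theorem proposition7p1 :
    ∃ f : List (List ℤ) → List (List ℤ) → Bool, Computable₂ f ∧
      ∀ (m n : ℕ) (V : Matrix (Fin m) (Fin m) ℤ) (V' : Matrix (Fin n) (Fin n) ℤ),
        V.IsSymm → IsUnimodular V → V'.IsSymm → IsUnimodular V' →
          (f (matrixRows V) (matrixRows V') = true ↔ IsCongruent V V') := by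
  classical
  classical
  classical
  classical
  refine ⟨_, computable₂_congruenceCriterion exists_isReduction, fun m n V V' hs hV hs' hV' => ?_⟩
  rw [decide_eq_true_iff]
  by_cases h : m = n
  · subst h
    exact congruenceCriterion_iff (Nat.find_spec (exists_isReduction _))
      (Nat.find_spec (exists_isReduction _)) (length_matrixRows V) (length_matrixRows V')
      (symmEntry_matrixRows hs) (symmEntry_matrixRows hs') hs hV hs' hV'
  · refine ⟨fun h1 => absurd h1.1 ?_, fun h1 => absurd h1.1 h⟩
    rwa [length_matrixRows, length_matrixRows]
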